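/- Identify $S^3$ with $SU(2)$ by $p=\begin{pmatrix}s&-\bar t\\ t&\bar s\end{pmatrix}$, $s\bar s+t\bar t=1$, and let $\Gamma\subset SU(2)$ be the binary tetrahedral group (of order 24) generated by $\begin{pmatrix}i&0\\0&-i\end{pmatrix}$ and $\frac12\begin{pmatrix}1+i&-1+i\\1+i&1-i\end{pmatrix}$, acting on $S^3$ by left multiplication. Let $J_z^R=\frac12(s\partial_s-\bar t\partial_{\bar t}+t\partial_t-\bar s\partial_{\bar s})$, $J_+^R=-s\partial_{\bar t}+t\partial_{\bar s}$, $J_-^R=-\bar t\partial_s+\bar s\partial_t$, let $$V=s^4+t^4+2i\sqrt3\,s^2t^2,\qquad v_l=\tfrac{(4-l)!}{4!}(J_-^R)^lV\quad(l=0,\dots,4),$$ and let $v=(v_0,\dots,v_4):S^3\to\mathbb C^5$. On $\mathbb C[X_0,\dots,X_4]$ let $L_z,L_+,L_-$ be the derivations $L_zX_l=(2-l)X_l$, $L_+X_l=l\,X_{l-1}$, $L_-X_l=(4-l)X_{l+1}$. A highest weight vector of spin $j$ and degree $d$ is a homogeneous $F$ of degree $d$ with $L_+F=0$, $L_zF=jF$;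 the multiplicity of spin $j$ in degree $d$ is the dimension of the space of these. A function on $S^3/\Gamma$ means one whose pull-back to $S^3$ is a polynomial in $s,t,\bar s,\bar t$ (equivalently, a finite sum of eigenfunctions of the Laplacian). Then: 1. There is a non-trivial character $\chi:\Gamma\to\mathbb C^\times$ with $\chi^3=1$ such that $V(\gamma\cdot(s,t))=\chi(\gamma)V(s,t)$ for all $(s,t)\in\mathbb C^2$ and $v(\gamma p)=\chi(\gamma)v(p)$ for all $\gamma\in\Gamma$, $p\in S^3$. 2. $v_0,\dots,v_4$ form a spin-2 multiplet of $SU(2)^R$: $J_z^Rv_l=(2-l)v_l$, $J_+^Rv_l=l\,v_{l-1}$, $J_-^Rv_l=(4-l)v_{l+1}$; they are linearly independent functions on $S^3$, and for each $g\in SU(2)$ there is a matrix $A$ with $v(pg)=A\,v(p)$ for all $p$. 3. $v$ has no zero on $S^3$, and $p\mapsto[v_0(p):\dots:v_4(p)]$ induces an embedding $S^3/\Gamma\to\mathbb P^4(\mathbb C)$ (a topological embedding, and an immersion). 4. In degree 2 the spins $0,2,4$ occur, each with multiplicity one, and no others. A quadratic form in five variables vanishes on $v(S^3)$ if and only if it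 is a spin-0 one; thus there is, up to scalars, a single quadratic relation between the $v_l$. If $F\neq0$ is a highest weight vector of degree 2 and spin 2, then $F(v)$ is a non-zero multiple of $s^4+t^4-2i\sqrt3\,s^2t^2$, and there is $c\ne0$ with $\overline{v_l}=c\,(-1)^l F_{4-l}(v)$ on $S^3$ for all $l$, where $F_k=\frac{(4-k)!}{4!}L_-^kF$. 5. In degree 3 the spins $0,2,3,4,6$ occur, each with multiplicity one, and no others. If $K\ne0$ is a spin-0 cubic, then $K(v)$ is a non-zero constant $c$ on $S^3$, and a vector $z=\lambda v(p)$, $\lambda\in\mathbb C^\times$, satisfies $K(z)=c$ if and only if $z=\zeta v(p)$ with $\zeta^3=1$. The highest weight vectors of spin 2 are the products of $X_0$ with the spin-0 quadratic forms. Non-zero highest weight vectors of spin 3, 4, 6 take on $v$ the values of non-zero multiples of $P=st(s^4-t^4)$, $W=s^8+14s^4t^4+t^8$ and $V^3$ respectively, and $P,W,V^3$ generate the algebra $\mathbb C[s,t]^\Gamma$. 6. If $F\in\mathbb C[X_0,\dots,X_4]$ is homogeneous of degree $3n$, then $F(v)$ is $\Gamma$-invariant. A function $f:S^3/\Gamma\to\mathbb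 C$ is a function on the quotient in the above sense if and only if, for some $n\geq0$, there is $F$ homogeneous of degree $3n$ such that $f$ pulls back to $F(v)$ on $S^3$. -/

import Mathlib

noncomputable section

namespace TetrahedralQuotient

open MvPolynomial
open scoped ComplexConjugate

/-- The three-sphere, identified with the group `SU(2)`: a point is a matrix
`p = !![s, -conj t; t, conj s]` with `s * conj s + t * conj t = 1`. -/
abbrev SU2 : Type := Matrix.specialUnitaryGroup (Fin 2) ℂ

/-- The element `i` of the binary tetrahedral group. -/
def genI : SU2 :=
  ⟨!![Complex.I, 0; 0, -Complex.I], by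
    rw [Matrix.mem_specialUnitaryGroup_iff, Matrix.mem_unitaryGroup_iff]
    constructor
    · ext a b
      fin_cases a <;> fin_cases b <;> simp [Matrix.mul_apply, Fin.sum_univ_two]
    · simp [Matrix.det_fin_two]⟩

/-- An element of order six of the binary tetrahedral group, of the form
`(1 ± i ± j ± k) / 2`. -/
def genOmega : SU2 :=
  ⟨!![(1 + Complex.I) / 2, (-1 + Complex.I) / 2; (1 + Complex.I) / 2, (1 - Complex.I) / 2], by
    rw [Matrix.mem_specialUnitaryGroup_iff, Matrix.mem_unitaryGroup_iff]
    constructor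
    · ext a b
      have h2 : (starRingEnd ℂ) 2 = 2 := Complex.conj_ofNat 2
      fin_cases a <;> fin_cases b <;>
        simp [Matrix.mul_apply, Fin.sum_univ_two, h2, Complex.ext_iff] <;> norm_num
    · simp [Matrix.det_fin_two, Complex.ext_iff]
      norm_num⟩

/-- The (binary) tetrahedral group, of order 24, in the position for which the zeros of the
form `formV` are the vertices of the tetrahedron. -/
def tetra : Subgroup SU2 := Subgroup.closure {genI, genOmega}

/-- The quotient of the three-sphere by the tetrahedral group acting by left translations. -/
abbrev Quot3 : Type := MulAction.orbitRel.Quotient tetra SU2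

/-- The projection of the sphere to the quotient. -/
def proj (p : SU2) : Quot3 := Quotient.mk _ p

/-- The quotient topology on the complex projective space of dimension four. -/
instance instTopologicalSpaceProj : TopologicalSpace (Projectivization ℂ (Fin 5 → ℂ)) :=
  TopologicalSpace.coinduced
    (fun x : {x : Fin 5 → ℂ // x ≠ 0} => Projectivization.mk ℂ x.1 x.2) inferInstance

/-! ### Binary forms in `s = X 0`, `t = X 1` -/

/-- `V = s⁴ + t⁴ + 2 i √3 s² t²`. -/
def formV : MvPolynomial (Fin 2) ℂ :=
  X 0 ^ 4 + X 1 ^ 4 + C (2 * Complex.I * (Real.sqrt 3 : ℂ)) * X 0 ^ 2 * X 1 ^ 2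

/-- `V` with `i` replaced by `-i`. -/
def formVbar : MvPolynomial (Fin 2) ℂ :=
  X 0 ^ 4 + X 1 ^ 4 - C (2 * Complex.I * (Real.sqrt 3 : ℂ)) * X 0 ^ 2 * X 1 ^ 2

/-- `P = s t (s⁴ - t⁴)`. -/
def formP : MvPolynomial (Fin 2) ℂ := X 0 * X 1 * (X 0 ^ 4 - X 1 ^ 4)

/-- The form of degree eight `s⁸ + 14 s⁴ t⁴ + t⁸`. -/
def formW : MvPolynomial (Fin 2) ℂ := X 0 ^ 8 + 14 * X 0 ^ 4 * X 1 ^ 4 + X 1 ^ 8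

/-- The values `(s, t)` at a point of the sphere. -/
def st (p : SU2) : Fin 2 → ℂ := ![p.1 0 0, p.1 1 0]

/-! ### Polynomials in `s = X 0`, `t = X 1`, `conj s = X 2`, `conj t = X 3` -/

/-- `J_z^R = (s ∂_s - t̄ ∂_t̄ + t ∂_t - s̄ ∂_s̄) / 2`. -/
def JZ : Derivation ℂ (MvPolynomial (Fin 4) ℂ) (MvPolynomial (Fin 4) ℂ) :=
  mkDerivation ℂ ![C (1 / 2) * X 0, C (1 / 2) * X 1, -(C (1 / 2) * X 2), -(C (1 / 2) * X 3)]

/-- `J_+^R = -s ∂_t̄ + t ∂_s̄`. -/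
def JPlus : Derivation ℂ (MvPolynomial (Fin 4) ℂ) (MvPolynomial (Fin 4) ℂ) :=
  mkDerivation ℂ ![0, 0, X 1, -X 0]

/-- `J_-^R = -t̄ ∂_s + s̄ ∂_t`. -/
def JMinus : Derivation ℂ (MvPolynomial (Fin 4) ℂ) (MvPolynomial (Fin 4) ℂ) :=
  mkDerivation ℂ ![-X 3, X 2, 0, 0]

/-- The element `⟨j, j - l⟩` of the multiplet of spin `j = N / 2` with highest weight vector `f`,
for a lowering operator `D`: `(N - l)! / N! • D ^ l f`. -/
def descendant {A : Type} [CommRing A] [Algebra ℂ A] (D : Derivation ℂ A A) (N l : ℕ) (f : A) : A :=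
  (((N - l).factorial : ℂ) / (N.factorial : ℂ)) • (D^[l] f)

/-- The five elements `⟨2, 2 - l⟩`, `l = 0, …, 4`, of the spin 2 multiplet generated by `V`. -/
def multiplet (l : Fin 5) : MvPolynomial (Fin 4) ℂ :=
  descendant JMinus 4 l (rename ![0, 1] formV)

/-- The five coordinates as functions of arbitrary complex numbers `s`, `t`. -/
def coordAt (x : ℂ × ℂ) : Fin 5 → ℂ :=
  fun l => eval ![x.1, x.2, conj x.1, conj x.2] (multiplet l)

/-- The five coordinates on the three-sphere. -/
def coord (p : SU2) : Fin 5 → ℂ := coordAt (p.1 0 0, p.1 1 0)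

/-- Functions on the quotient: those whose pullback to the sphere is (the restriction of) a
polynomial in `s`, `t`, `conj s`, `conj t`, that is, a finite sum of eigenfunctions of the
Laplacian. -/
def IsPolynomialFunction (f : Quot3 → ℂ) : Prop :=
  ∃ G : MvPolynomial (Fin 4) ℂ, ∀ p : SU2,
    f (proj p) = eval ![p.1 0 0, p.1 1 0, conj (p.1 0 0), conj (p.1 1 0)] G

/-! ### Polynomials in five variables `X l = ⟨2, 2 - l⟩` carrying the spin 2 representation -/

/-- `L_z ⟨2, m⟩ = m ⟨2, m⟩`, extended as a derivation. -/
def LZ : Derivation ℂ (MvPolynomial (Fin 5) ℂ) (MvPolynomial (Fin 5) ℂ) :=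
  mkDerivation ℂ ![2 * X 0, X 1, 0, -X 3, -(2 * X 4)]

/-- `L_+ ⟨2, m⟩ = (2 - m) ⟨2, m + 1⟩`, extended as a derivation. -/
def LPlus : Derivation ℂ (MvPolynomial (Fin 5) ℂ) (MvPolynomial (Fin 5) ℂ) :=
  mkDerivation ℂ ![0, X 0, 2 * X 1, 3 * X 2, 4 * X 3]

/-- `L_- ⟨2, m⟩ = (2 + m) ⟨2, m - 1⟩`, extended as a derivation. -/
def LMinus : Derivation ℂ (MvPolynomial (Fin 5) ℂ) (MvPolynomial (Fin 5) ℂ) :=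
  mkDerivation ℂ ![4 * X 1, 3 * X 2, 2 * X 3, X 4, 0]

/-- The highest weight vectors of spin `j` among the homogeneous polynomials of degree `d` in the
five variables. Its dimension is the multiplicity of the spin `j` representation; for `j = 0` it
is the space of spin 0 combinations itself. -/
def highestWeight (d j : ℕ) : Submodule ℂ (MvPolynomial (Fin 5) ℂ) :=
  homogeneousSubmodule (Fin 5) ℂ d ⊓
    (LinearMap.ker LPlus.toLinearMap ⊓ Module.End.eigenspace LZ.toLinearMap (j : ℂ))

end TetrahedralQuotient

end

set_option linter.unusedSimpArgs false

open MvPolynomial ComplexConjugate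

namespace TetrahedralQuotient

/-! The vector `coord p` lists the coefficients of the binary quartic `V ∘ p`, where `V = x⁴ + y⁴ +
6μx²y²` and `3μ² = -1` (`multiplet_eq`, `coord_eq`). Right translation is therefore a linear
substitution (`coord_mul`), and left translation by a matrix preserving `V` up to a scalar rescales
the whole vector. Everything reduces to the invariant theory of this one equianharmonic quartic: its
quadratic invariant vanishes, its cubic invariant is a nonzero multiple of `det⁶`, its Hessian is `μ
det²` times the conjugate form, and its sextic covariant is `4 det³ P` (the lemmas on `binaryCoeff`
in the section on covariants).

If `coord g = c • coord 1`, the cubic invariant gives `c³ = 1`; after division by a power of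
`genOmega` the matrix fixes `V` and lies in the quaternion group. So two points have proportional
coordinates exactly when they lie in one `Γ`-orbit (`mem_tetra_of_coord_eq_smul`). A continuous
injection from a compact space to a Hausdorff space is an embedding, and right translation reduces
the immersion property to the identity matrix.

A highest weight vector involves only monomials of its own weight, so each multiplicity is a small
linear system `L_+ F = 0`. A quadric vanishing on the sphere vanishes on all substitutions of `V`,
since `s, t, s̄, t̄` are algebraically independent as functions on `ℂ²`; three curves of
substitutions then determine it (`vanishing_quadric_iff`).

Invariant forms in `s, t` are found by averaging successively over `genI`, over `1, genK`, and over
the powers of `genOmega` (`invariant_iff_mem_adjoin`). The generators `P, W, V³` are values of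
cubics in the coordinates. Finally, `ℂ[s, t]` generates all polynomials in `s, t, s̄, t̄` under
`J_-` and multiplication by `s s̄ + t t̄` (`eq_top_of_JMinus_mem`). Averaging over `Γ` commutes with
both operations, and the forms of degree `3n` are stable under both, so every average is such a form
on the sphere (`sphereAverage_mem`). -/

/-! ### The constant `i / √3` -/

/-- The number `i / √3`; the coefficient of `s² t²` in `V` is six times it. -/
noncomputable def mu : ℂ := Complex.I * (Real.sqrt 3 : ℂ) / 3

lemma ofReal_sqrt_three_sq : ((Real.sqrt 3 : ℝ) : ℂ) ^ 2 = 3 := by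
  rw [← Complex.ofReal_pow, Real.sq_sqrt (by norm_num)]
  norm_num

lemma three_mul_mu_sq : 3 * mu ^ 2 = -1 := by
  unfold mu
  linear_combination (1 / 3 * Complex.I ^ 2) * ofReal_sqrt_three_sq + Complex.I_sq

lemma mu_ne_zero : mu ≠ 0 := by
  intro h
  have := three_mul_mu_sq
  rw [h] at this
  norm_num at this

lemma conj_mu : conj mu = -mu := by
  simp [mu, Complex.conj_ofNat]
  ring

lemma six_mul_mu : 2 * Complex.I * (Real.sqrt 3 : ℂ) = 6 * mu := by
  unfold mu
  ring

/-! ### Coefficients of the form `V` after a linear substitution -/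

/-- The coefficients `u l` in
`x⁴ + y⁴ + 6 m x² y² = ∑ l, (4.choose l) * u l * X ^ (4 - l) * Y ^ l` for
`x = s X + b Y`, `y = t X + d Y`. -/
def binaryCoeff {A : Type*} [CommRing A] (m s t b d : A) : Fin 5 → A :=
  ![s ^ 4 + t ^ 4 + 6 * m * s ^ 2 * t ^ 2,
    s ^ 3 * b + t ^ 3 * d + 3 * m * (s * b * t ^ 2 + s ^ 2 * t * d),
    s ^ 2 * b ^ 2 + t ^ 2 * d ^ 2 + m * (b ^ 2 * t ^ 2 + 4 * s * b * t * d + s ^ 2 * d ^ 2),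
    s * b ^ 3 + t * d ^ 3 + 3 * m * (b ^ 2 * t * d + s * b * d ^ 2),
    b ^ 4 + d ^ 4 + 6 * m * b ^ 2 * d ^ 2]

/-- The action of the substitution `X ↦ e X + f Y`, `Y ↦ g X + h Y` on the coefficients of
binary quartic forms. -/
def substMatrix {A : Type*} [CommRing A] (e f g h : A) : Matrix (Fin 5) (Fin 5) A :=
  !![e ^ 4, 4 * e ^ 3 * g, 6 * e ^ 2 * g ^ 2, 4 * e * g ^ 3, g ^ 4;
    e ^ 3 * f, e ^ 3 * h + 3 * e ^ 2 * g * f, 3 * e ^ 2 * g * h + 3 * e * g ^ 2 * f,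
      3 * e * g ^ 2 * h + g ^ 3 * f, g ^ 3 * h;
    e ^ 2 * f ^ 2, 2 * e ^ 2 * f * h + 2 * e * g * f ^ 2,
      e ^ 2 * h ^ 2 + 4 * e * g * f * h + g ^ 2 * f ^ 2, 2 * e * g * h ^ 2 + 2 * g ^ 2 * f * h,
      g ^ 2 * h ^ 2;
    f ^ 3 * e, f ^ 3 * g + 3 * f ^ 2 * h * e, 3 * f ^ 2 * h * g + 3 * f * h ^ 2 * e,
      3 * f * h ^ 2 * g + h ^ 3 * e, h ^ 3 * g;
    f ^ 4, 4 * f ^ 3 * h, 6 * f ^ 2 * h ^ 2, 4 * f * h ^ 3, h ^ 4]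

lemma map_binaryCoeff {A B : Type*} [CommRing A] [CommRing B] (φ : A →+* B) (m s t b d : A)
    (l : Fin 5) :
    φ (binaryCoeff m s t b d l) = binaryCoeff (φ m) (φ s) (φ t) (φ b) (φ d) l := by
  fin_cases l <;> simp [binaryCoeff, map_ofNat φ]

/-- Substituting by a product of matrices is substituting twice, and the second substitution acts
linearly on the coefficients of any quartic. This gives the equivariance under right translations.
-/
lemma binaryCoeff_mul {A : Type*} [CommRing A] (m s t b d e f g h : A) :
    binaryCoeff m (s * e + b * g) (t * e + d * g) (s * f + b * h) (t * f + d * h) =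
      (substMatrix e f g h).mulVec (binaryCoeff m s t b d) := by
  ext l
  fin_cases l <;>
    simp [binaryCoeff, substMatrix, Matrix.mulVec, dotProduct, Fin.sum_univ_five] <;> ring

/-! ### The spin 2 multiplet as coefficients of a substituted quartic. -/

lemma C_eq_six_mul_mu {σ : Type*} :
    (C (2 * Complex.I * (Real.sqrt 3 : ℂ)) : MvPolynomial σ ℂ) = 6 * C mu := by
  rw [six_mul_mu, map_mul, map_ofNat]

lemma derivation_ofNat {σ : Type*} (D : Derivation ℂ (MvPolynomial σ ℂ) (MvPolynomial σ ℂ))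
    (n : ℕ) [n.AtLeastTwo] : D (OfNat.ofNat n) = 0 :=
  D.map_natCast n

/-- The multiplet of `V`, written out. -/
noncomputable def genericCoeff : Fin 5 → MvPolynomial (Fin 4) ℂ :=
  binaryCoeff (C mu) (X 0) (X 1) (-X 3) (X 2)

lemma JZ_genericCoeff (l : Fin 5) : JZ (genericCoeff l) = aeval genericCoeff (LZ (X l)) := by
  have hmu : JZ (C mu) = 0 := JZ.map_algebraMap mu
  have n3 : JZ 3 = 0 := derivation_ofNat JZ 3
  have n4 : JZ 4 = 0 := derivation_ofNat JZ 4
  have n6 : JZ 6 = 0 := derivation_ofNat JZ 6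
  have x0 : JZ (X 0) = C (1 / 2) * X 0 := by simp [JZ]
  have x1 : JZ (X 1) = C (1 / 2) * X 1 := by simp [JZ]
  have x2 : JZ (X 2) = -(C (1 / 2) * X 2) := by simp [JZ]
  have x3 : JZ (X 3) = -(C (1 / 2) * X 3) := by simp [JZ]
  have hc : 2 * C (1 / 2) = (1 : MvPolynomial (Fin 4) ℂ) := by
    rw [← map_ofNat C 2, ← map_mul]; norm_num
  -- The constant `1/2` becomes an atom `c` known only through `2c = 1`, so that each remaining
  -- identity is a multiple of `hc`.
  generalize (C (1 / 2) : MvPolynomial (Fin 4) ℂ) = c at *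
  fin_cases l <;>
    simp [genericCoeff, binaryCoeff, LZ, Derivation.leibniz, Derivation.leibniz_pow, x0, x1, x2,
      x3, hmu, n3, n4, n6, map_ofNat]
  · linear_combination (2 * (X 0 ^ 4 + X 1 ^ 4 + 6 * C mu * X 0 ^ 2 * X 1 ^ 2)) * hc
  · linear_combination (-X 0 ^ 3 * X 3 + X 1 ^ 3 * X 2 + 3 * C mu * (-X 0 * X 3 * X 1 ^ 2 +
      X 0 ^ 2 * X 1 * X 2)) * hc
  · ring
  · linear_combination (-(-X 0 * X 3 ^ 3 + X 1 * X 2 ^ 3 + 3 * C mu * (X 3 ^ 2 * X 1 * X 2 -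
      X 0 * X 3 * X 2 ^ 2))) * hc
  · linear_combination (-2 * (X 3 ^ 4 + X 2 ^ 4 + 6 * C mu * X 3 ^ 2 * X 2 ^ 2)) * hc

lemma JPlus_genericCoeff (l : Fin 5) :
    JPlus (genericCoeff l) = aeval genericCoeff (LPlus (X l)) := by
  have hmu : JPlus (C mu) = 0 := JPlus.map_algebraMap mu
  have n3 : JPlus 3 = 0 := derivation_ofNat JPlus 3
  have n4 : JPlus 4 = 0 := derivation_ofNat JPlus 4
  have n6 : JPlus 6 = 0 := derivation_ofNat JPlus 6
  have x0 : JPlus (X 0) = 0 := by simp [JPlus]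
  have x1 : JPlus (X 1) = 0 := by simp [JPlus]
  have x2 : JPlus (X 2) = X 1 := by simp [JPlus]
  have x3 : JPlus (X 3) = -X 0 := by simp [JPlus]
  fin_cases l <;>
    simp [genericCoeff, binaryCoeff, LPlus, Derivation.leibniz, Derivation.leibniz_pow, x0, x1, x2,
      x3, hmu, n3, n4, n6, map_ofNat] <;> ring

lemma JMinus_genericCoeff (l : Fin 5) :
    JMinus (genericCoeff l) = aeval genericCoeff (LMinus (X l)) := by
  have hmu : JMinus (C mu) = 0 := JMinus.map_algebraMap mu
  have n3 : JMinus 3 = 0 := derivation_ofNat JMinus 3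
  have n4 : JMinus 4 = 0 := derivation_ofNat JMinus 4
  have n6 : JMinus 6 = 0 := derivation_ofNat JMinus 6
  have x0 : JMinus (X 0) = -X 3 := by simp [JMinus]
  have x1 : JMinus (X 1) = X 2 := by simp [JMinus]
  have x2 : JMinus (X 2) = 0 := by simp [JMinus]
  have x3 : JMinus (X 3) = 0 := by simp [JMinus]
  fin_cases l <;>
    simp [genericCoeff, binaryCoeff, LMinus, Derivation.leibniz, Derivation.leibniz_pow, x0, x1,
      x2, x3, hmu, n3, n4, n6, map_ofNat] <;> ring

/-- Successive lowering from the top coefficient produces the factors 4, 3, 2, 1, which the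
normalization `(4 - l)! / 4!` cancels. -/
lemma multiplet_eq : multiplet = genericCoeff := by
  have e0 : rename ![0, 1] formV = genericCoeff 0 := by
    simp only [formV, C_eq_six_mul_mu]
    simp [genericCoeff, binaryCoeff, map_ofNat (rename _)]
  have s0 : JMinus (genericCoeff 0) = C 4 * genericCoeff 1 := by
    simp [JMinus_genericCoeff, LMinus, map_ofNat]
  have s1 : JMinus (genericCoeff 1) = C 3 * genericCoeff 2 := by
    simp [JMinus_genericCoeff, LMinus, map_ofNat]
  have s2 : JMinus (genericCoeff 2) = C 2 * genericCoeff 3 := by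
    simp [JMinus_genericCoeff, LMinus, map_ofNat]
  have s3 : JMinus (genericCoeff 3) = genericCoeff 4 := by
    simp [JMinus_genericCoeff, LMinus]
  simp only [C_mul'] at s0 s1 s2
  ext1 l
  fin_cases l <;>
    norm_num [multiplet, descendant, e0, Nat.factorial, s0, s1, s2, s3, smul_smul] <;> rfl

lemma coordAt_eq (s t : ℂ) : coordAt (s, t) = binaryCoeff mu s t (-conj t) (conj s) := by
  ext l
  simp only [coordAt, multiplet_eq, genericCoeff]
  rw [map_binaryCoeff]
  simp

/-! ### Points of the sphere -/

lemma SU2.apply_zero_one (p : SU2) : p.1 0 1 = -conj (p.1 1 0) := by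
  have h := p.2
  rw [Matrix.mem_specialUnitaryGroup_iff, Matrix.mem_unitaryGroup_iff'] at h
  obtain ⟨h, hd⟩ := h
  have h00 := congrFun (congrFun h 0) 0
  have h01 := congrFun (congrFun h 0) 1
  simp [Matrix.mul_apply, Fin.sum_univ_two, Matrix.star_apply] at h00 h01
  rw [Matrix.det_fin_two] at hd
  -- Cramer's rule: the second column is determined by its inner product with the first column and
  -- by the determinant.
  linear_combination (-conj (p.1 1 0)) * hd + p.1 0 0 * h01 - p.1 0 1 * h00 

lemma SU2.apply_one_one (p : SU2) : p.1 1 1 = conj (p.1 0 0) := by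
  have h := p.2
  rw [Matrix.mem_specialUnitaryGroup_iff, Matrix.mem_unitaryGroup_iff'] at h
  obtain ⟨h, hd⟩ := h
  have h00 := congrFun (congrFun h 0) 0
  have h01 := congrFun (congrFun h 0) 1
  simp [Matrix.mul_apply, Fin.sum_univ_two, Matrix.star_apply] at h00 h01
  rw [Matrix.det_fin_two] at hd
  linear_combination (conj (p.1 0 0)) * hd + p.1 1 0 * h01 - p.1 1 1 * h00 

lemma SU2.det_eq (p : SU2) : p.1 0 0 * p.1 1 1 - p.1 1 0 * p.1 0 1 = 1 := by
  have h := p.2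
  rw [Matrix.mem_specialUnitaryGroup_iff, Matrix.det_fin_two] at h
  linear_combination h.2

lemma SU2.normSq_eq (p : SU2) :
    p.1 0 0 * conj (p.1 0 0) + p.1 1 0 * conj (p.1 1 0) = 1 := by
  have h := p.det_eq
  rw [p.apply_zero_one, p.apply_one_one] at h
  linear_combination h

lemma SU2.ext_column {p q : SU2} (h0 : p.1 0 0 = q.1 0 0) (h1 : p.1 1 0 = q.1 1 0) : p = q := by
  apply Subtype.ext
  ext i j
  fin_cases i <;> fin_cases j
  · exact h0
  · simp [SU2.apply_zero_one, h1]
  · exact h1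
  · simp [SU2.apply_one_one, h0]

/-- The point of the sphere with given first column. -/
def SU2.mk (s t : ℂ) (h : s * conj s + t * conj t = 1) : SU2 :=
  ⟨!![s, -conj t; t, conj s], by
    rw [Matrix.mem_specialUnitaryGroup_iff, Matrix.mem_unitaryGroup_iff]
    constructor
    · ext a b
      fin_cases a <;> fin_cases b <;>
        simp [Matrix.mul_apply, Fin.sum_univ_two] <;> first | (ring; done) | linear_combination h
    · simp [Matrix.det_fin_two]
      linear_combination h⟩

lemma coord_eq (p : SU2) :
    coord p = binaryCoeff mu (p.1 0 0) (p.1 1 0) (p.1 0 1) (p.1 1 1) := by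
  rw [coord, coordAt_eq, p.apply_zero_one, p.apply_one_one]

lemma coord_mul (p g : SU2) :
    coord (p * g) =
      (substMatrix (g.1 0 0) (g.1 0 1) (g.1 1 0) (g.1 1 1)).mulVec (coord p) := by
  simp only [coord_eq, ← binaryCoeff_mul]
  simp [Matrix.mul_apply, Fin.sum_univ_two]

lemma coord_one : coord 1 = ![1, 0, mu, 0, 1] := by
  rw [coord_eq]
  ext l
  fin_cases l <;> simp [binaryCoeff]

/-! ### Covariants of the form `V` -/

section Covariants

variable {A : Type*} [CommRing A] {m : A} (s t b d : A)

/-- The left side is quadratic in `m` and divisible by `3m² + 1`, so the quotient is its value at `m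
= 0`. The Hessian identities below follow in the same way. -/
lemma quadratic_invariant_binaryCoeff (hm : 3 * m ^ 2 = -1) :
    let v := binaryCoeff m s t b d
    v 0 * v 4 - 4 * (v 1 * v 3) + 3 * v 2 ^ 2 = 0 := by
  simp only [binaryCoeff, Matrix.cons_val]
  linear_combination ((s ^ 4 + t ^ 4) * (b ^ 4 + d ^ 4)
    - 4 * (s ^ 3 * b + t ^ 3 * d) * (s * b ^ 3 + t * d ^ 3)
    + 3 * (s ^ 2 * b ^ 2 + t ^ 2 * d ^ 2) ^ 2) * hm

lemma hessian_binaryCoeff_zero (hm : 3 * m ^ 2 = -1) :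
    let v := binaryCoeff m s t b d
    v 0 * v 2 - v 1 ^ 2 = m * (s * d - t * b) ^ 2 * binaryCoeff (-m) s t b d 0 := by
  simp only [binaryCoeff, Matrix.cons_val]
  linear_combination ((s ^ 4 + t ^ 4) * (s ^ 2 * b ^ 2 + t ^ 2 * d ^ 2)
    - (s ^ 3 * b + t ^ 3 * d) ^ 2) * hm

lemma hessian_binaryCoeff_one (hm : 3 * m ^ 2 = -1) :
    let v := binaryCoeff m s t b d
    v 0 * v 3 - v 1 * v 2 = 2 * m * (s * d - t * b) ^ 2 * binaryCoeff (-m) s t b d 1 := by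
  simp only [binaryCoeff, Matrix.cons_val]
  linear_combination ((s ^ 4 + t ^ 4) * (s * b ^ 3 + t * d ^ 3)
    - (s ^ 3 * b + t ^ 3 * d) * (s ^ 2 * b ^ 2 + t ^ 2 * d ^ 2)) * hm

lemma hessian_binaryCoeff_two (hm : 3 * m ^ 2 = -1) :
    let v := binaryCoeff m s t b d
    v 0 * v 4 + 2 * (v 1 * v 3) - 3 * v 2 ^ 2 =
      6 * m * (s * d - t * b) ^ 2 * binaryCoeff (-m) s t b d 2 := by
  simp only [binaryCoeff, Matrix.cons_val]
  linear_combination ((s ^ 4 + t ^ 4) * (b ^ 4 + d ^ 4)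
    + 2 * (s ^ 3 * b + t ^ 3 * d) * (s * b ^ 3 + t * d ^ 3)
    - 3 * (s ^ 2 * b ^ 2 + t ^ 2 * d ^ 2) ^ 2) * hm

lemma hessian_binaryCoeff_three (hm : 3 * m ^ 2 = -1) :
    let v := binaryCoeff m s t b d
    v 1 * v 4 - v 2 * v 3 = 2 * m * (s * d - t * b) ^ 2 * binaryCoeff (-m) s t b d 3 := by
  simp only [binaryCoeff, Matrix.cons_val]
  linear_combination ((s ^ 3 * b + t ^ 3 * d) * (b ^ 4 + d ^ 4)
    - (s ^ 2 * b ^ 2 + t ^ 2 * d ^ 2) * (s * b ^ 3 + t * d ^ 3)) * hm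

lemma hessian_binaryCoeff_four (hm : 3 * m ^ 2 = -1) :
    let v := binaryCoeff m s t b d
    v 2 * v 4 - v 3 ^ 2 = m * (s * d - t * b) ^ 2 * binaryCoeff (-m) s t b d 4 := by
  simp only [binaryCoeff, Matrix.cons_val]
  linear_combination ((s ^ 2 * b ^ 2 + t ^ 2 * d ^ 2) * (b ^ 4 + d ^ 4)
    - (s * b ^ 3 + t * d ^ 3) ^ 2) * hm

lemma cubic_invariant_binaryCoeff (hm : 3 * m ^ 2 = -1) :
    let v := binaryCoeff m s t b d
    3 * (v 0 * v 2 * v 4 + 2 * (v 1 * v 2 * v 3) - v 2 ^ 3 - v 0 * v 3 ^ 2 - v 1 ^ 2 * v 4) =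
      4 * m * (s * d - t * b) ^ 6 := by
  -- The coefficients split as `v = u + m w`. The difference of the two sides is cubic in `m` and
  -- divisible by `3m² + 1`, so the quotient `e` consists of its terms of degree at most one in `m`.
  obtain ⟨u, hu⟩ : ∃ u : Fin 5 → A, u = ![s ^ 4 + t ^ 4, s ^ 3 * b + t ^ 3 * d,
    s ^ 2 * b ^ 2 + t ^ 2 * d ^ 2, s * b ^ 3 + t * d ^ 3, b ^ 4 + d ^ 4] := ⟨_, rfl⟩
  obtain ⟨w, hw⟩ : ∃ w : Fin 5 → A, w = ![6 * s ^ 2 * t ^ 2,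
    3 * (s * b * t ^ 2 + s ^ 2 * t * d), b ^ 2 * t ^ 2 + 4 * s * b * t * d + s ^ 2 * d ^ 2,
    3 * (b ^ 2 * t * d + s * b * d ^ 2), 6 * b ^ 2 * d ^ 2] := ⟨_, rfl⟩
  have key : ∀ e : A, e = 3 * (u 0 * u 2 * u 4 + 2 * (u 1 * u 2 * u 3) - u 2 ^ 3 - u 0 * u 3 ^ 2
      - u 1 ^ 2 * u 4) + m * (3 * (w 0 * u 2 * u 4 + u 0 * w 2 * u 4 + u 0 * u 2 * w 4
      + 2 * (w 1 * u 2 * u 3 + u 1 * w 2 * u 3 + u 1 * u 2 * w 3) - 3 * u 2 ^ 2 * w 2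
      - w 0 * u 3 ^ 2 - 2 * u 0 * u 3 * w 3 - 2 * u 1 * w 1 * u 4 - u 1 ^ 2 * w 4)
      - 4 * (s * d - t * b) ^ 6) → e * (3 * m ^ 2 + 1) = 0 := by
    intro e _
    linear_combination e * hm
  have := key _ rfl
  simp only [hu, hw, Matrix.cons_val] at this
  simp only [binaryCoeff, Matrix.cons_val]
  linear_combination this

lemma cubic_covariant_binaryCoeff (hm : 3 * m ^ 2 = -1) :
    let v := binaryCoeff m s t b d
    v 0 ^ 2 * v 3 - 3 * (v 0 * v 1 * v 2) + 2 * v 1 ^ 3 =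
      4 * (s * d - t * b) ^ 3 * (s * t * (s ^ 4 - t ^ 4)) := by
  -- As for the cubic invariant: `e` is the part of degree at most one in `m` of the difference of
  -- the two sides.
  obtain ⟨u, hu⟩ : ∃ u : Fin 5 → A, u = ![s ^ 4 + t ^ 4, s ^ 3 * b + t ^ 3 * d,
    s ^ 2 * b ^ 2 + t ^ 2 * d ^ 2, s * b ^ 3 + t * d ^ 3, b ^ 4 + d ^ 4] := ⟨_, rfl⟩
  obtain ⟨w, hw⟩ : ∃ w : Fin 5 → A, w = ![6 * s ^ 2 * t ^ 2,
    3 * (s * b * t ^ 2 + s ^ 2 * t * d), b ^ 2 * t ^ 2 + 4 * s * b * t * d + s ^ 2 * d ^ 2,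
    3 * (b ^ 2 * t * d + s * b * d ^ 2), 6 * b ^ 2 * d ^ 2] := ⟨_, rfl⟩
  have key : ∀ e : A, e = u 0 ^ 2 * u 3 - 3 * (u 0 * u 1 * u 2) + 2 * u 1 ^ 3
      - 4 * (s * d - t * b) ^ 3 * (s * t * (s ^ 4 - t ^ 4))
      + m * (2 * u 0 * w 0 * u 3 + u 0 ^ 2 * w 3
      - 3 * (w 0 * u 1 * u 2 + u 0 * w 1 * u 2 + u 0 * u 1 * w 2) + 6 * u 1 ^ 2 * w 1)
      → e * (3 * m ^ 2 + 1) = 0 := by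
    intro e _
    linear_combination e * hm
  have := key _ rfl
  simp only [hu, hw, Matrix.cons_val] at this
  simp only [binaryCoeff, Matrix.cons_val]
  linear_combination this

/-- The quartic `x⁴ + y⁴ + 6m x² y²` is symmetric and even in each variable. The new substitution
therefore gives the old form at `(Y, -X)`. -/
lemma binaryCoeff_reverse (l : Fin 5) :
    binaryCoeff m d (-b) (-t) s l = (-1) ^ (l : ℕ) * binaryCoeff m s t b d l.rev := by
  fin_cases l <;> simp [binaryCoeff, Fin.rev] <;> ring

end Covariants

/-! ### The character of the tetrahedral group -/

/-- The value of the character on `genOmega`. -/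
noncomputable def zeta : ℂ := -(1 + 3 * mu) / 2

lemma zeta_sq_add : zeta ^ 2 + zeta + 1 = 0 := by
  unfold zeta
  linear_combination (3 / 4) * three_mul_mu_sq

lemma zeta_pow_three : zeta ^ 3 = 1 := by
  linear_combination (zeta - 1) * zeta_sq_add

lemma zeta_ne_one : zeta ≠ 1 := by
  intro h
  have := zeta_sq_add
  rw [h] at this
  norm_num at this

lemma eq_zeta_pow_of_pow_three_eq_one {c : ℂ} (hc : c ^ 3 = 1) : ∃ k : Fin 3, c = zeta ^ (k : ℕ) := by
  have h : (c - 1) * ((c - zeta) * (c - zeta ^ 2)) = 0 := by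
    linear_combination hc + (c - c ^ 2) * zeta_sq_add + (c - 1) * zeta_pow_three
  rcases mul_eq_zero.1 h with h | h
  · exact ⟨0, by simpa using sub_eq_zero.1 h⟩
  rcases mul_eq_zero.1 h with h | h
  · exact ⟨1, by simpa using sub_eq_zero.1 h⟩
  · exact ⟨2, by simpa using sub_eq_zero.1 h⟩

lemma coord_genI : coord genI = coord 1 := by
  have h4 : Complex.I ^ 4 = 1 := Complex.I_pow_four
  rw [coord_one, coord_eq]
  ext l
  fin_cases l <;> simp [binaryCoeff, genI, h4, Even.neg_pow (show Even 4 by decide)]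

/-- Both entries of the first column are `(1 + i)/2`, whose fourth power is `-1/4`; hence `V` takes
there the value `-(2 + 6μ)/4 = zeta`. -/
lemma coord_genOmega : coord genOmega = zeta • coord 1 := by
  have hI := Complex.I_sq
  have h3 : Complex.I ^ 3 = -Complex.I := Complex.I_pow_three
  have h4 : Complex.I ^ 4 = 1 := Complex.I_pow_four
  have hm := three_mul_mu_sq
  rw [coord_one, coord_eq]
  ext l
  fin_cases l <;> simp [binaryCoeff, genOmega, zeta] <;> ring_nf <;> 
    simp only [hI, h3, h4] <;> ring_nf <;> linear_combination (1 / 2) * hm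

/-- Right translation by `p` acts linearly on coordinates, so a proportionality at the identity
spreads over the whole sphere. -/
lemma coord_mul_of_coord_eq {g : SU2} {c : ℂ} (hg : coord g = c • coord 1) (p : SU2) :
    coord (g * p) = c • coord p := by
  rw [coord_mul, hg, Matrix.mulVec_smul, ← coord_mul, one_mul]

lemma exists_coord_eq_smul {g : SU2} (hg : g ∈ tetra) :
    ∃ c : ℂ, c ^ 3 = 1 ∧ coord g = c • coord 1 := by
  induction hg using Subgroup.closure_induction with
  | mem x hx =>
    rcases hx with rfl | rfl
    · exact ⟨1, one_pow 3, by rw [coord_genI, one_smul]⟩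
    · exact ⟨zeta, zeta_pow_three, coord_genOmega⟩
  | one => exact ⟨1, one_pow 3, (one_smul _ _).symm⟩
  | mul x y _ _ hx hy =>
    obtain ⟨c, hc, hx⟩ := hx
    obtain ⟨e, he, hy⟩ := hy
    exact ⟨c * e, by rw [mul_pow, hc, he, one_mul], by
      rw [coord_mul_of_coord_eq hx, hy, smul_smul]⟩
  | inv x _ hx =>
    obtain ⟨c, hc, hx⟩ := hx
    have hc0 : c ≠ 0 := by rintro rfl; norm_num at hc
    refine ⟨c⁻¹, by rw [inv_pow, hc, inv_one], ?_⟩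
    have h := coord_mul_of_coord_eq hx x⁻¹
    rw [mul_inv_cancel] at h
    rw [h, smul_smul, inv_mul_cancel₀ hc0, one_smul]

lemma coord_eq_apply_zero_smul {g : SU2} (hg : g ∈ tetra) : coord g = coord g 0 • coord 1 := by
  obtain ⟨c, -, h⟩ := exists_coord_eq_smul hg
  have : coord g 0 = c := by rw [h, coord_one]; simp
  rw [this, h]

lemma coord_apply_zero_pow_three {g : SU2} (hg : g ∈ tetra) : coord g 0 ^ 3 = 1 := by
  obtain ⟨c, hc, h⟩ := exists_coord_eq_smul hg
  rw [h, coord_one]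
  simpa using hc

lemma coord_mul_of_mem {g : SU2} (hg : g ∈ tetra) (p : SU2) :
    coord (g * p) = coord g 0 • coord p :=
  coord_mul_of_coord_eq (coord_eq_apply_zero_smul hg) p

lemma coord_one_zero : coord 1 0 = 1 := by simp [coord_one]

/-- The character by which the tetrahedral group acts on `V`. -/
noncomputable def tetraChar : tetra →* ℂˣ :=
  MonoidHom.toHomUnits
    { toFun := fun g => coord g.1 0
      map_one' := coord_one_zero
      map_mul' := fun g h => by
        change coord (g.1 * h.1) 0 = _
        rw [coord_mul_of_mem g.2]
        simp }

lemma coe_tetraChar (g : tetra) : (tetraChar g : ℂ) = coord g.1 0 := rfl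

lemma genI_mem : genI ∈ tetra := Subgroup.subset_closure (by simp)

lemma genOmega_mem : genOmega ∈ tetra := Subgroup.subset_closure (by simp)

lemma coord_genOmega_zero : coord genOmega 0 = zeta := by
  simp [coord_genOmega, coord_one]

lemma tetraChar_ne_one : tetraChar ≠ 1 := by
  intro h
  have := congrArg (fun u : ℂˣ => (u : ℂ)) (DFunLike.congr_fun h ⟨genOmega, genOmega_mem⟩)
  simp only [coe_tetraChar, coord_genOmega_zero] at this
  exact zeta_ne_one this

lemma tetraChar_pow_three (g : tetra) : tetraChar g ^ 3 = 1 := by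
  ext
  simpa [coe_tetraChar] using coord_apply_zero_pow_three g.2

lemma eval_formV (x : Fin 2 → ℂ) :
    eval x formV = x 0 ^ 4 + x 1 ^ 4 + 6 * mu * x 0 ^ 2 * x 1 ^ 2 := by
  simp [formV, six_mul_mu]

lemma eval_formV_mulVec (g : tetra) (x : Fin 2 → ℂ) :
    eval (g.1.1.mulVec x) formV = tetraChar g * eval x formV := by
  -- With second column zero, the substitution has the value of the quartic at `(x 0, x 1)` as its
  -- top coefficient. This reaches arbitrary complex points, not only those of the sphere.
  have h := binaryCoeff_mul mu (g.1.1 0 0) (g.1.1 1 0) (g.1.1 0 1) (g.1.1 1 1) (x 0) 0 (x 1) 0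
  rw [← coord_eq, coord_eq_apply_zero_smul g.2, coord_one, Matrix.mulVec_smul] at h
  have h0 := congrFun h 0
  simp [binaryCoeff, substMatrix] at h0
  rw [coe_tetraChar, eval_formV, eval_formV]
  simp only [Matrix.mulVec, dotProduct, Fin.sum_univ_two]
  linear_combination h0

/-! ### The stabilizer of the form `V` up to scalars -/

/-- A third element of order four of the tetrahedral group, `!![0, i; i, 0]`. -/
noncomputable def genK : SU2 := SU2.mk 0 Complex.I (by simp)

lemma genK_mem : genK ∈ tetra := by
  have h : genK = genOmega * genI * genOmega⁻¹ := by
    rw [eq_mul_inv_iff_mul_eq]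
    apply SU2.ext_column <;>
      simp [genK, SU2.mk, genOmega, genI] <;> ring
  rw [h]
  exact mul_mem (mul_mem genOmega_mem genI_mem) (inv_mem genOmega_mem)

lemma genI_pow (k : ℕ) :
    genI.1 ^ k = !![Complex.I ^ k, 0; 0, (-Complex.I) ^ k] := by
  induction k with
  | zero => simp [Matrix.one_fin_two]
  | succ k ih => rw [pow_succ, ih]; simp [genI, pow_succ]

lemma eq_pow_of_pow_four_eq_one {w z : ℂ} (hw : w ^ 2 = -1) (hz : z ^ 4 = 1) :
    ∃ k : Fin 4, z = w ^ (k : ℕ) := by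
  have h : (z - 1) * ((z - w) * ((z - w ^ 2) * (z - w ^ 3))) = 0 := by
    have h3 : w ^ 3 = -w := by linear_combination w * hw
    rw [h3, hw]
    linear_combination hz - (z ^ 2 - 1) * hw
  rcases mul_eq_zero.1 h with h | h
  · exact ⟨0, by simpa using sub_eq_zero.1 h⟩
  rcases mul_eq_zero.1 h with h | h
  · exact ⟨1, by simpa using sub_eq_zero.1 h⟩
  rcases mul_eq_zero.1 h with h | h
  · exact ⟨2, by simpa using sub_eq_zero.1 h⟩
  · exact ⟨3, by simpa using sub_eq_zero.1 h⟩

/-- By unitarity the conjugate of the last coefficient is the first one with `μ` replaced by `-μ`.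
Both equal 1, so `st = 0` and the nonzero entry is a fourth root of unity. -/
lemma exists_eq_of_coord_eq_coord_one {g : SU2} (hg : coord g = coord 1) :
    ∃ (k : Fin 4) (e : Fin 2), g = genI ^ (k : ℕ) * genK ^ (e : ℕ) := by
  have h0 := congrFun hg 0
  have h4 := congrArg conj (congrFun hg 4)
  rw [coord_one, coord_eq, g.apply_zero_one, g.apply_one_one] at h0 h4
  simp [binaryCoeff, conj_mu, map_ofNat (starRingEnd ℂ)] at h0 h4
  have hst : mu * (g.1 0 0 * g.1 1 0) ^ 2 = 0 := by linear_combination (h0 - h4) / 12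
  have hst : g.1 0 0 * g.1 1 0 = 0 := by simpa [mu_ne_zero] using hst
  rcases mul_eq_zero.1 hst with hs | ht
  · rw [hs] at h0
    have hI : Complex.I ^ 4 = 1 := Complex.I_pow_four
    obtain ⟨k, hk⟩ := eq_pow_of_pow_four_eq_one (w := -Complex.I) (z := -Complex.I * g.1 1 0)
      (by simp) (by linear_combination hI * g.1 1 0 ^ 4 + h0)
    refine ⟨k, 1, SU2.ext_column ?_ ?_⟩
    · simp [Matrix.mul_apply, Fin.sum_univ_two, genI_pow, genK, SU2.mk, hs]
    · simp [Matrix.mul_apply, Fin.sum_univ_two, genI_pow, genK, SU2.mk, ← hk]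
      linear_combination g.1 1 0 * Complex.I_sq
  · rw [ht] at h0
    obtain ⟨k, hk⟩ := eq_pow_of_pow_four_eq_one (z := g.1 0 0) Complex.I_sq
      (by linear_combination h0)
    refine ⟨k, 0, SU2.ext_column ?_ ?_⟩ <;> simp [genI_pow, hk, ht]

/-- The cubic invariant is nonzero, homogeneous of degree three and unchanged by substitutions of
determinant one. -/
lemma pow_three_eq_one_of_coord_eq {g : SU2} {c : ℂ} (hg : coord g = c • coord 1) : c ^ 3 = 1 := by
  have h := cubic_invariant_binaryCoeff (g.1 0 0) (g.1 1 0) (g.1 0 1) (g.1 1 1) three_mul_mu_sq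
  rw [← coord_eq, g.det_eq, hg, coord_one] at h
  simp at h
  have : (4 * mu) * (c ^ 3 - 1) = 0 := by
    linear_combination h + (c ^ 3 * mu) * three_mul_mu_sq
  simpa [mu_ne_zero, sub_eq_zero] using this

lemma exists_eq_of_coord_eq_smul {g : SU2} {c : ℂ} (hg : coord g = c • coord 1) :
    ∃ (n : Fin 3) (k : Fin 4) (e : Fin 2),
      g = genOmega ^ (n : ℕ) * (genI ^ (k : ℕ) * genK ^ (e : ℕ)) := by
  obtain ⟨n, hn⟩ := eq_zeta_pow_of_pow_three_eq_one (pow_three_eq_one_of_coord_eq hg)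
  have hz : zeta ≠ 0 := by
    intro h
    have := zeta_pow_three
    norm_num [h] at this
  have hpow : ∀ j : ℕ, coord (genOmega ^ j) = zeta ^ j • coord 1 := by
    intro j
    induction j with
    | zero => simp
    | succ j ih => rw [pow_succ, coord_mul_of_coord_eq ih, coord_genOmega, smul_smul, pow_succ]
  -- Left division by `genOmega ^ n`, on which the character takes the value `c`, reduces to a
  -- matrix fixing `V` exactly.
  have h := coord_mul_of_coord_eq (hpow n) ((genOmega ^ (n : ℕ))⁻¹ * g)
  rw [mul_inv_cancel_left, hg, hn] at h
  obtain ⟨k, e, hke⟩ := exists_eq_of_coord_eq_coord_one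
    (smul_right_injective _ (pow_ne_zero (n : ℕ) hz) h).symm
  exact ⟨n, k, e, by rw [← hke, mul_inv_cancel_left]⟩

lemma mem_tetra_of_coord_eq_smul {g : SU2} {c : ℂ} (hg : coord g = c • coord 1) : g ∈ tetra := by
  obtain ⟨n, k, e, rfl⟩ := exists_eq_of_coord_eq_smul hg
  exact mul_mem (pow_mem genOmega_mem _) (mul_mem (pow_mem genI_mem _) (pow_mem genK_mem _))

instance finite_tetra : Finite tetra := by
  have : (tetra : Set SU2) ⊆ Set.range (fun x : Fin 3 × Fin 4 × Fin 2 =>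
      genOmega ^ (x.1 : ℕ) * (genI ^ (x.2.1 : ℕ) * genK ^ (x.2.2 : ℕ))) := by
    intro g hg
    obtain ⟨n, k, e, h⟩ := exists_eq_of_coord_eq_smul (coord_eq_apply_zero_smul hg)
    exact ⟨(n, k, e), h.symm⟩
  exact (Set.finite_range _).subset this

/-! ### The embedding -/

lemma coord_ne_zero (p : SU2) : coord p ≠ 0 := by
  intro h
  have h1 := coord_mul p p⁻¹
  rw [mul_inv_cancel, h, Matrix.mulVec_zero, coord_one] at h1
  simpa using congrFun h1 0

lemma mul_inv_mem_of_coord_eq_smul {p q : SU2} {c : ℂ} (h : coord p = c • coord q) :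
    p * q⁻¹ ∈ tetra := by
  apply mem_tetra_of_coord_eq_smul (c := c)
  rw [coord_mul, h, Matrix.mulVec_smul, ← coord_mul, mul_inv_cancel]

lemma proj_eq_proj_iff (p q : SU2) : proj p = proj q ↔ ∃ g : tetra, g.1 * q = p := by
  unfold proj
  rw [Quotient.eq]
  rfl

lemma continuous_coord : Continuous coord := by
  have h (i j : Fin 2) : Continuous fun p : SU2 => p.1 i j :=
    (continuous_apply_apply i j).comp continuous_subtype_val
  have hb : Continuous fun x : ℂ × ℂ × ℂ × ℂ => binaryCoeff mu x.1 x.2.1 x.2.2.1 x.2.2.2 := by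
    refine continuous_pi fun l => ?_
    fin_cases l <;> simp only [binaryCoeff] <;> simp <;> fun_prop
  exact (hb.comp ((h 0 0).prodMk ((h 1 0).prodMk ((h 0 1).prodMk (h 1 1))))).congr
    fun p => (coord_eq p).symm

instance compactSpace_SU2 : CompactSpace SU2 := by
  have hc : IsCompact (Set.pi Set.univ fun _ : Fin 2 => Set.pi Set.univ fun _ : Fin 2 =>
      Metric.closedBall (0 : ℂ) 1) :=
    isCompact_univ_pi fun _ => isCompact_univ_pi fun _ => isCompact_closedBall _ _
  have hcl : IsClosed ((Matrix.specialUnitaryGroup (Fin 2) ℂ : Set (Matrix (Fin 2) (Fin 2) ℂ))) := by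
    have : (Matrix.specialUnitaryGroup (Fin 2) ℂ : Set (Matrix (Fin 2) (Fin 2) ℂ)) =
        {A | A * star A = 1} ∩ {A | A.det = 1} := by
      ext A
      simp [Matrix.mem_specialUnitaryGroup_iff, Matrix.mem_unitaryGroup_iff]
    rw [this]
    exact (isClosed_eq (by fun_prop) continuous_const).inter
      (isClosed_eq (by fun_prop) continuous_const)
  refine isCompact_iff_compactSpace.1 (hc.of_isClosed_subset hcl ?_)
  intro A hA i _ j _
  simpa using entry_norm_bound_of_unitary (Matrix.mem_specialUnitaryGroup_iff.1 hA).1 i j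

/-- A line is determined by its orthogonal projector `x x* / ‖x‖²`, which depends continuously on
it; a continuous injection into a Hausdorff space makes the source Hausdorff. -/
instance t2Space_projectivization : T2Space (Projectivization ℂ (Fin 5 → ℂ)) := by
  let N (x : Fin 5 → ℂ) : ℂ := ∑ k, x k * conj (x k)
  have hN {x : Fin 5 → ℂ} (hx : x ≠ 0) : N x ≠ 0 := by
    intro h
    apply hx
    simp only [N, Complex.mul_conj] at h
    norm_cast at h
    rw [Finset.sum_eq_zero_iff_of_nonneg fun _ _ => Complex.normSq_nonneg _] at h
    ext k
    simpa using h k (Finset.mem_univ k)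
  let f : Projectivization ℂ (Fin 5 → ℂ) → Fin 5 → Fin 5 → ℂ :=
    Projectivization.lift (fun x i j => x.1 i * conj (x.1 j) / N x.1) (by
      rintro ⟨x, hx⟩ ⟨y, hy⟩ c hc
      simp only at hc
      have hc0 : c ≠ 0 := by rintro rfl; exact hx (by simp [hc])
      have hcc : conj c ≠ 0 := by simpa using hc0
      have hNx : N x = c * conj c * N y := by
        simp only [N, hc, Finset.mul_sum]
        refine Finset.sum_congr rfl fun k _ => ?_
        simp
        ring
      ext i j
      have := hN hy
      rw [hNx]
      simp only [hc, Pi.smul_apply, smul_eq_mul, map_mul]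
      field_simp)
  have hf : Continuous f := by
    rw [continuous_coinduced_dom]
    change Continuous fun x : {x : Fin 5 → ℂ // x ≠ 0} => fun i j => x.1 i * conj (x.1 j) / N x.1
    have hx (i : Fin 5) : Continuous fun x : {x : Fin 5 → ℂ // x ≠ 0} => x.1 i :=
      (continuous_apply i).comp continuous_subtype_val
    refine continuous_pi fun i => continuous_pi fun j => ?_
    refine Continuous.div ?_ ?_ fun x => hN x.2
    · exact (hx i).mul (Complex.continuous_conj.comp (hx j))
    · exact continuous_finsetSum _ fun k _ => (hx k).mul (Complex.continuous_conj.comp (hx k))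
  refine T2Space.of_injective_continuous (f := f) ?_ hf
  intro a b
  induction a using Projectivization.ind with | h x hx => ?_
  induction b using Projectivization.ind with | h y hy => ?_
  intro h
  have h' (i j) : x i * conj (x j) / N x = y i * conj (y j) / N y := congrFun (congrFun h i) j
  obtain ⟨j, hj⟩ := Function.ne_iff.1 hy
  have hj' : conj (y j) ≠ 0 := by simpa using hj
  have hNx := hN hx
  have hNy := hN hy
  have hxj : conj (x j) ≠ 0 := by
    intro h0
    have := h' j j
    rw [h0, mul_zero, zero_div, eq_comm, div_eq_zero_iff] at this
    simp_all
  rw [Projectivization.mk_eq_mk_iff']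
  -- The ratio of the `j`-th columns of the two equal projectors, at an index where `y j ≠ 0`.
  refine ⟨conj (y j) * N x / (N y * conj (x j)), ?_⟩
  ext i
  have := h' i j
  rw [div_eq_div_iff hNx hNy] at this
  rw [Pi.smul_apply, smul_eq_mul, div_mul_eq_mul_div, div_eq_iff (mul_ne_zero hNy hxj)]
  linear_combination -this

lemma exists_isEmbedding : ∃ φ : Quot3 → Projectivization ℂ (Fin 5 → ℂ),
    (∀ p (h : coord p ≠ 0), φ (proj p) = Projectivization.mk ℂ (coord p) h) ∧
      Topology.IsEmbedding φ := by
  let φ : Quot3 → Projectivization ℂ (Fin 5 → ℂ) :=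
    Quotient.lift (fun p => Projectivization.mk ℂ (coord p) (coord_ne_zero p)) (by
      rintro p q ⟨g, hg⟩
      simp only at hg ⊢
      rw [Projectivization.mk_eq_mk_iff']
      refine ⟨coord g.1 0, ?_⟩
      rw [← coord_mul_of_mem g.2, ← hg]
      rfl)
  have hφ (p : SU2) : φ (proj p) = Projectivization.mk ℂ (coord p) (coord_ne_zero p) := rfl
  refine ⟨φ, fun p h => rfl, ?_⟩
  have hcont : Continuous φ := by
    refine Continuous.quotient_lift ?_ _
    have h1 : Continuous fun x : {x : Fin 5 → ℂ // x ≠ 0} => Projectivization.mk ℂ x.1 x.2 :=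
      continuous_coinduced_rng
    exact h1.comp (continuous_coord.subtype_mk coord_ne_zero)
  have hinj : Function.Injective φ := by
    intro a b
    induction a using Quotient.inductionOn with | h p => ?_
    induction b using Quotient.inductionOn with | h q => ?_
    intro h
    change φ (proj p) = φ (proj q) at h
    rw [hφ, hφ, Projectivization.mk_eq_mk_iff'] at h
    obtain ⟨c, hc⟩ := h
    exact (proj_eq_proj_iff p q).2 ⟨⟨_, mul_inv_mem_of_coord_eq_smul hc.symm⟩, by simp⟩
  have : CompactSpace Quot3 := Quotient.compactSpace
  exact (hcont.isClosedEmbedding hinj).isEmbedding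

/-! ### The immersion -/

/-- The derivative of `binaryCoeff m` at `(s, t, b, d)` in the direction `(s', t', b', d')`. -/
def binaryCoeffDeriv {A : Type*} [CommRing A] (m s t b d s' t' b' d' : A) : Fin 5 → A :=
  ![4 * s ^ 3 * s' + 4 * t ^ 3 * t' + 12 * m * (s * t ^ 2 * s' + s ^ 2 * t * t'),
    3 * s ^ 2 * b * s' + s ^ 3 * b' + 3 * t ^ 2 * d * t' + t ^ 3 * d'
      + 3 * m * (s' * b * t ^ 2 + s * b' * t ^ 2 + 2 * s * b * t * t' + 2 * s * t * d * s'
        + s ^ 2 * t' * d + s ^ 2 * t * d'),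
    2 * s * b ^ 2 * s' + 2 * s ^ 2 * b * b' + 2 * t * d ^ 2 * t' + 2 * t ^ 2 * d * d'
      + m * (2 * b * t ^ 2 * b' + 2 * b ^ 2 * t * t'
        + 4 * (s' * b * t * d + s * b' * t * d + s * b * t' * d + s * b * t * d')
        + 2 * s * d ^ 2 * s' + 2 * s ^ 2 * d * d'),
    s' * b ^ 3 + 3 * s * b ^ 2 * b' + t' * d ^ 3 + 3 * t * d ^ 2 * d'
      + 3 * m * (2 * b * t * d * b' + b ^ 2 * t' * d + b ^ 2 * t * d' + s' * b * d ^ 2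
        + s * b' * d ^ 2 + 2 * s * b * d * d'),
    4 * b ^ 3 * b' + 4 * d ^ 3 * d' + 12 * m * (b * d ^ 2 * b' + b ^ 2 * d * d')]

/-- Differentiation commutes with a fixed linear substitution; this moves the tangent computation to
the identity matrix. -/
lemma binaryCoeffDeriv_mul {A : Type*} [CommRing A] (m s t b d s' t' b' d' e f g h : A) :
    binaryCoeffDeriv m (s * e + b * g) (t * e + d * g) (s * f + b * h) (t * f + d * h)
      (s' * e + b' * g) (t' * e + d' * g) (s' * f + b' * h) (t' * f + d' * h) =
      (substMatrix e f g h).mulVec (binaryCoeffDeriv m s t b d s' t' b' d') := by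
  ext l
  fin_cases l <;>
    simp [binaryCoeffDeriv, substMatrix, Matrix.mulVec, dotProduct, Fin.sum_univ_five] <;> ring

lemma hasDerivAt_binaryCoeff {m s' t' b' d' : ℂ} {s t b d : ℝ → ℂ} {r : ℝ}
    (hs : HasDerivAt s s' r) (ht : HasDerivAt t t' r) (hb : HasDerivAt b b' r)
    (hd : HasDerivAt d d' r) (l : Fin 5) :
    HasDerivAt (fun r => binaryCoeff m (s r) (t r) (b r) (d r) l)
      (binaryCoeffDeriv m (s r) (t r) (b r) (d r) s' t' b' d' l) r := by
  fin_cases l <;> simp only [binaryCoeff, binaryCoeffDeriv]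
  · refine HasDerivAt.congr_deriv (((hs.pow 4).add (ht.pow 4)).add (((hs.pow 2).const_mul (6 * m)).mul (ht.pow 2))) ?_
    simp
    ring
  · refine HasDerivAt.congr_deriv ((((hs.pow 3).mul hb).add ((ht.pow 3).mul hd)).add
      ((((hs.mul hb).mul (ht.pow 2)).add (((hs.pow 2).mul ht).mul hd)).const_mul (3 * m))) ?_
    simp
    ring
  · refine HasDerivAt.congr_deriv ((((hs.pow 2).mul (hb.pow 2)).add ((ht.pow 2).mul (hd.pow 2))).add
      (((((hb.pow 2).mul (ht.pow 2)).add ((((hs.const_mul 4).mul hb).mul ht).mul hd)).add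
        ((hs.pow 2).mul (hd.pow 2))).const_mul m)) ?_
    simp
    ring
  · refine HasDerivAt.congr_deriv (((hs.mul (hb.pow 3)).add (ht.mul (hd.pow 3))).add
      (((((hb.pow 2).mul ht).mul hd).add ((hs.mul hb).mul (hd.pow 2))).const_mul (3 * m))) ?_
    simp
    ring
  · refine HasDerivAt.congr_deriv (((hb.pow 4).add (hd.pow 4)).add (((hb.pow 2).const_mul (6 * m)).mul (hd.pow 2))) ?_
    simp
    ring

lemma differentiable_coordAt : Differentiable ℝ coordAt := by
  have hconj : Differentiable ℝ (fun z : ℂ => conj z) := Complex.conjCLE.differentiable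
  have h3 : Differentiable ℝ fun x : ℂ × ℂ => -conj x.2 := (hconj.comp differentiable_snd).neg
  have h4 : Differentiable ℝ fun x : ℂ × ℂ => conj x.1 := hconj.comp differentiable_fst
  have h : coordAt = fun x : ℂ × ℂ => binaryCoeff mu x.1 x.2 (-conj x.2) (conj x.1) :=
    funext fun x => coordAt_eq x.1 x.2
  rw [h, differentiable_pi]
  intro l
  fin_cases l <;> simp only [binaryCoeff] <;> simp <;> fun_prop

/-- Along a line with real parameter, conjugation differentiates to conjugation of the direction, so
the real derivative is found with `s, t, -t̄, s̄` treated as four curves. -/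
lemma fderiv_coordAt (s t a b : ℂ) : fderiv ℝ coordAt (s, t) (a, b) =
    binaryCoeffDeriv mu s t (-conj t) (conj s) a b (-conj b) (conj a) := by
  have line (z w : ℂ) : HasDerivAt (fun r : ℝ => z + r * w) w 0 := by
    simpa using ((Complex.ofRealCLM.hasDerivAt (x := 0)).mul_const w).const_add z
  have h1 : HasDerivAt (fun r : ℝ => ((s + r * a, t + r * b) : ℂ × ℂ)) (a, b) 0 :=
    (line s a).prodMk (line t b)
  have hd : HasFDerivAt coordAt (fderiv ℝ coordAt (s, t)) (s + (0 : ℝ) * a, t + (0 : ℝ) * b) := by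
    simpa using (differentiable_coordAt (s, t)).hasFDerivAt
  have h2 := hasDerivAt_pi.1 (hd.comp_hasDerivAt (0 : ℝ) h1)
  ext l
  have h3 := hasDerivAt_binaryCoeff (m := mu) (line s a) (line t b) (line (-conj t) (-conj b))
    (line (conj s) (conj a)) l
  have h4 := (h2 l).unique (h3.congr_of_eventuallyEq (Filter.Eventually.of_forall fun r => by
    simp only [Function.comp_apply, coordAt_eq]
    congr 1 <;> simp
    ring))
  simpa using h4

lemma immersion (s t a b : ℂ) (hst : s * conj s + t * conj t = 1)
    (hab : (conj s * a + conj t * b).re = 0)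
    (h : ∃ c : ℂ, fderiv ℝ coordAt (s, t) (a, b) = c • coordAt (s, t)) : a = 0 ∧ b = 0 := by
  obtain ⟨c, hc⟩ := h
  rw [fderiv_coordAt, coordAt_eq] at hc
  -- Right multiplication by the inverse matrix, with entries `s̄, t̄, -t, s`, carries the base
  -- point to the identity and the tangent vector to an element of `su(2)` with entries `α, β`.
  have key := binaryCoeffDeriv_mul mu s t (-conj t) (conj s) a b (-conj b) (conj a)
    (conj s) (conj t) (-t) s
  have key' := binaryCoeff_mul mu s t (-conj t) (conj s) (conj s) (conj t) (-t) s
  rw [hc, Matrix.mulVec_smul, ← key'] at key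
  have e1 : s * conj s + -conj t * -t = 1 := by linear_combination hst
  have e2 : t * conj s + conj s * -t = 0 := by ring
  have e3 : s * conj t + -conj t * s = 0 := by ring
  have e4 : t * conj t + conj s * s = 1 := by linear_combination hst
  rw [e1, e2, e3, e4] at key
  obtain ⟨α, hα⟩ : ∃ α, α = a * conj s + conj b * t := ⟨_, rfl⟩
  obtain ⟨β, hβ⟩ : ∃ β, β = b * conj s - conj a * t := ⟨_, rfl⟩
  have k1 : a * conj s + -conj b * -t = α := by rw [hα]; ring
  have k2 : b * conj s + conj a * -t = β := by rw [hβ]; ring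
  have k3 : a * conj t + -conj b * s = -conj β := by rw [hβ]; simp; ring
  have k4 : b * conj t + conj a * s = conj α := by rw [hα]; simp; ring
  rw [k1, k2, k3, k4] at key
  -- Tangency to the sphere says that `α` is purely imaginary.
  have hαre : conj α = -α := by
    have h1 : α.re = 0 := by
      rw [← hab, hα]
      simp
      ring
    apply Complex.ext <;> simp [h1]
  have r0 := congrFun key 0
  have r1 := congrFun key 1
  have r2 := congrFun key 2
  simp [binaryCoeff, binaryCoeffDeriv, hαre] at r0 r1 r2
  -- The middle coefficient has derivative `2μ(α + ᾱ) = 0` at the identity, while its value there is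
  -- `μ ≠ 0`.
  have hc0 : c = 0 := r2.resolve_right mu_ne_zero
  rw [hc0] at r0
  have hα0 : α = 0 := by simpa using r0
  have hβ' : conj β = 3 * mu * β := by linear_combination -r1
  -- Since `|3μ| = √3 ≠ 1`, the relation `β̄ = 3μβ` kills `β`; conjugating it once more gives `β =
  -- -9μ²β = 3β`.
  have hβ0 : β = 0 := by
    have h1 := congrArg conj hβ'
    simp only [map_mul, map_ofNat (starRingEnd ℂ), conj_mu, Complex.conj_conj] at h1
    linear_combination (-1 / 2 : ℂ) * h1 + (3 / 2 * mu) * hβ' + (3 / 2 * β) * three_mul_mu_sq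
  have ha : a = s * α - t * conj β := by
    rw [hα, hβ]
    simp
    linear_combination -a * hst
  have hb : b = t * conj α + s * β := by
    rw [hα, hβ]
    simp
    linear_combination -b * hst
  simp [ha, hb, hα0, hβ0]

/-! ### Highest weight vectors of degrees two and three -/

lemma LZ_eq : LZ = (2 * X 0 : MvPolynomial (Fin 5) ℂ) • pderiv 0 + (X 1 : MvPolynomial (Fin 5) ℂ) •
    pderiv 1 - (X 3 : MvPolynomial (Fin 5) ℂ) • pderiv 3 - (2 * X 4 : MvPolynomial (Fin 5) ℂ) •
    pderiv 4 := by
  refine derivation_ext fun i => ?_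
  fin_cases i <;> simp [LZ, pderiv_X]

lemma LZ_monomial (m : Fin 5 →₀ ℕ) (c : ℂ) :
    LZ (monomial m c) = (2 * m 0 + m 1 - m 3 - 2 * m 4 : ℂ) • monomial m c := by
  have h (i : Fin 5) : X i * pderiv i (monomial m c) = (m i : ℂ) • monomial m c := by
    rw [X_mul_pderiv_monomial, Nat.cast_smul_eq_nsmul]
  rw [LZ_eq]
  simp only [Derivation.coe_sub, Derivation.coe_add, Derivation.coe_smul, Pi.sub_apply,
    Pi.add_apply, Pi.smul_apply, smul_eq_mul, mul_assoc, h]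
  simp only [sub_smul, add_smul, two_mul]

lemma coeff_LZ (m : Fin 5 →₀ ℕ) (F : MvPolynomial (Fin 5) ℂ) :
    coeff m (LZ F) = (2 * m 0 + m 1 - m 3 - 2 * m 4 : ℂ) * coeff m F := by
  induction F using MvPolynomial.induction_on' with
  | monomial n c =>
    rw [LZ_monomial, coeff_smul, coeff_monomial]
    split_ifs with h
    · rw [h, smul_eq_mul]
    · simp
  | add p q hp hq => rw [map_add, coeff_add, hp, hq, coeff_add, mul_add]

/-- `L_z` is diagonal on monomials, so an eigenvector contains only those of its own weight.
Negative weights are moved across to give an equation in natural numbers. -/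
lemma weight_of_mem_support {j : ℕ} {F : MvPolynomial (Fin 5) ℂ} (hF : LZ F = (j : ℂ) • F)
    {m : Fin 5 →₀ ℕ} (hm : m ∈ F.support) : 2 * m 0 + m 1 = j + m 3 + 2 * m 4 := by
  have h := coeff_LZ m F
  rw [hF, coeff_smul, smul_eq_mul] at h
  have h2 := mul_right_cancel₀ (mem_support_iff.1 hm) h
  have h3 : (2 * m 0 + m 1 : ℂ) = j + m 3 + 2 * m 4 := by linear_combination -h2
  exact_mod_cast h3

lemma mem_highestWeight_iff {d j : ℕ} {F : MvPolynomial (Fin 5) ℂ} : F ∈ highestWeight d j ↔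
    F.IsHomogeneous d ∧ LPlus F = 0 ∧ LZ F = (j : ℂ) • F := by
  simp [highestWeight, Submodule.mem_inf, mem_homogeneousSubmodule]

/-- A polynomial in five variables as the sum over a finite set of exponents containing those of
its monomials. -/
lemma eq_sum_of_support_subset {F : MvPolynomial (Fin 5) ℂ} {T : Finset (Fin 5 → ℕ)}
    (h : ∀ m ∈ F.support, ⇑m ∈ T) :
    F = ∑ e ∈ T, C (coeff (Finsupp.equivFunOnFinite.symm e) F) *
      (X 0 ^ e 0 * X 1 ^ e 1 * X 2 ^ e 2 * X 3 ^ e 3 * X 4 ^ e 4) := by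
  have hmon (e : Fin 5 → ℕ) : C (coeff (Finsupp.equivFunOnFinite.symm e) F) *
      (X 0 ^ e 0 * X 1 ^ e 1 * X 2 ^ e 2 * X 3 ^ e 3 * X 4 ^ e 4) =
      monomial (Finsupp.equivFunOnFinite.symm e)
        (coeff (Finsupp.equivFunOnFinite.symm e) F) := by
    rw [monomial_eq, Finsupp.prod_fintype _ _ (fun _ => pow_zero _), Fin.prod_univ_five]
    rfl
  simp only [hmon]
  conv_lhs => rw [F.as_sum]
  have hT : F.support ⊆ T.map Finsupp.equivFunOnFinite.symm.toEmbedding := by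
    intro m hm
    rw [Finset.mem_map]
    exact ⟨m, h m hm, by simp⟩
  rw [Finset.sum_subset hT, Finset.sum_map]
  · rfl
  · intro m _ hm
    rw [notMem_support_iff.1 hm, monomial_zero]

lemma mem_antidiagonalTuple_of_mem_support {d : ℕ} {F : MvPolynomial (Fin 5) ℂ}
    (hF : F.IsHomogeneous d) {m : Fin 5 →₀ ℕ} (hm : m ∈ F.support) :
    ⇑m ∈ Finset.Nat.antidiagonalTuple 5 d := by
  rw [Finset.Nat.mem_antidiagonalTuple, ← hF (mem_support_iff.1 hm), Finsupp.weight_apply,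
    Finsupp.sum_fintype _ _ (by simp)]
  simp

/-- A highest weight vector as the sum over a finite set containing all exponents of its degree and
weight. -/
lemma eq_sum_of_mem_highestWeight {d j : ℕ} {F : MvPolynomial (Fin 5) ℂ}
    (hF : F ∈ highestWeight d j) (T : Finset (Fin 5 → ℕ))
    (hT : ∀ m ∈ Finset.Nat.antidiagonalTuple 5 d, 2 * m 0 + m 1 = j + m 3 + 2 * m 4 → m ∈ T) :
    F = ∑ e ∈ T, C (coeff (Finsupp.equivFunOnFinite.symm e) F) *
      (X 0 ^ e 0 * X 1 ^ e 1 * X 2 ^ e 2 * X 3 ^ e 3 * X 4 ^ e 4) := by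
  obtain ⟨h1, -, h3⟩ := mem_highestWeight_iff.1 hF
  exact eq_sum_of_support_subset fun m hm =>
    hT m (mem_antidiagonalTuple_of_mem_support h1 hm) (weight_of_mem_support h3 hm)

lemma highestWeight_eq_bot_of_gt {d j : ℕ} (h : 2 * d < j) : highestWeight d j = ⊥ := by
  rw [eq_bot_iff]
  intro F hF
  rw [eq_sum_of_mem_highestWeight hF ∅, Finset.sum_empty]
  · exact Submodule.zero_mem _
  · intro m hm hw
    rw [Finset.Nat.mem_antidiagonalTuple, Fin.sum_univ_five] at hm
    omega

/-! ### Explicit highest weight vectors from classical covariants of the quartic. -/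

/-- The quadratic invariant. -/
noncomputable def quadInvariant : MvPolynomial (Fin 5) ℂ :=
  X 0 * X 4 - C 4 * (X 1 * X 3) + C 3 * X 2 ^ 2

/-- The Hessian covariant. -/
noncomputable def hessCovariant : MvPolynomial (Fin 5) ℂ := X 0 * X 2 - X 1 ^ 2

/-- The cubic invariant. -/
noncomputable def cubicInvariant : MvPolynomial (Fin 5) ℂ :=
  X 0 * X 2 * X 4 + C 2 * (X 1 * X 2 * X 3) - X 2 ^ 3 - X 0 * X 3 ^ 2 - X 1 ^ 2 * X 4

/-- The cubic covariant of spin three. -/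
noncomputable def cubicCovariant : MvPolynomial (Fin 5) ℂ :=
  X 0 ^ 2 * X 3 - C 3 * (X 0 * X 1 * X 2) + C 2 * X 1 ^ 3

lemma LPlus_X : LPlus (X 0) = 0 ∧ LPlus (X 1) = X 0 ∧ LPlus (X 2) = C 2 * X 1 ∧
    LPlus (X 3) = C 3 * X 2 ∧ LPlus (X 4) = C 4 * X 3 := by
  simp [LPlus, map_ofNat]

lemma LMinus_X : LMinus (X 0) = C 4 * X 1 ∧ LMinus (X 1) = C 3 * X 2 ∧ LMinus (X 2) = C 2 * X 3 ∧
    LMinus (X 3) = X 4 ∧ LMinus (X 4) = 0 := by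
  simp [LMinus, map_ofNat]

lemma LZ_X : LZ (X 0) = C 2 * X 0 ∧ LZ (X 1) = X 1 ∧ LZ (X 2) = 0 ∧ LZ (X 3) = -X 3 ∧
    LZ (X 4) = -(C 2 * X 4) := by
  simp [LZ, map_ofNat]

lemma derivation_C {σ : Type*} (D : Derivation ℂ (MvPolynomial σ ℂ) (MvPolynomial σ ℂ)) (c : ℂ) :
    D (C c) = 0 :=
  D.map_algebraMap c

lemma isHomogeneous_X_mul_X (i j : Fin 5) :
    (X i * X j : MvPolynomial (Fin 5) ℂ).IsHomogeneous 2 :=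
  (isHomogeneous_X ℂ i).mul (isHomogeneous_X ℂ j)

lemma isHomogeneous_X_mul_X_mul_X (i j k : Fin 5) :
    (X i * X j * X k : MvPolynomial (Fin 5) ℂ).IsHomogeneous 3 :=
  ((isHomogeneous_X ℂ i).mul (isHomogeneous_X ℂ j)).mul (isHomogeneous_X ℂ k)

lemma quadInvariant_mem : quadInvariant ∈ highestWeight 2 0 := by
  obtain ⟨p0, p1, p2, p3, p4⟩ := LPlus_X
  obtain ⟨z0, z1, z2, z3, z4⟩ := LZ_X
  refine mem_highestWeight_iff.2 ⟨((isHomogeneous_X_mul_X 0 4).sub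
    ((isHomogeneous_X_mul_X 1 3).C_mul 4)).add ((isHomogeneous_X_pow 2 2).C_mul 3), ?_, ?_⟩
  · simp only [quadInvariant, Derivation.leibniz, Derivation.leibniz_pow, derivation_C,
      smul_eq_mul, nsmul_eq_mul, map_add, map_sub, p0, p1, p2, p3, p4]
    simp [map_ofNat C]
    try ring
  · simp only [quadInvariant, Derivation.leibniz, Derivation.leibniz_pow, derivation_C,
      smul_eq_mul, nsmul_eq_mul, map_add, map_sub, z0, z1, z2, z3, z4]
    simp [map_ofNat C, smul_eq_C_mul]
    try ring

lemma hessCovariant_mem : hessCovariant ∈ highestWeight 2 2 := by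
  obtain ⟨p0, p1, p2, p3, p4⟩ := LPlus_X
  obtain ⟨z0, z1, z2, z3, z4⟩ := LZ_X
  refine mem_highestWeight_iff.2 ⟨(isHomogeneous_X_mul_X 0 2).sub
    (isHomogeneous_X_pow 1 2), ?_, ?_⟩
  · simp only [hessCovariant, Derivation.leibniz, Derivation.leibniz_pow, derivation_C,
      smul_eq_mul, nsmul_eq_mul, map_add, map_sub, p0, p1, p2, p3, p4]
    simp [map_ofNat C]
    try ring
  · simp only [hessCovariant, Derivation.leibniz, Derivation.leibniz_pow, derivation_C,
      smul_eq_mul, nsmul_eq_mul, map_add, map_sub, z0, z1, z2, z3, z4]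
    simp [map_ofNat C, smul_eq_C_mul]
    try ring

lemma X_zero_sq_mem : (X 0 ^ 2 : MvPolynomial (Fin 5) ℂ) ∈ highestWeight 2 4 := by
  obtain ⟨p0, p1, p2, p3, p4⟩ := LPlus_X
  obtain ⟨z0, z1, z2, z3, z4⟩ := LZ_X
  refine mem_highestWeight_iff.2 ⟨isHomogeneous_X_pow 0 2, ?_, ?_⟩
  · simp only [Derivation.leibniz, Derivation.leibniz_pow, derivation_C,
      smul_eq_mul, nsmul_eq_mul, map_add, map_sub, p0, p1, p2, p3, p4]
    simp [map_ofNat C]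
    try ring
  · simp only [Derivation.leibniz, Derivation.leibniz_pow, derivation_C,
      smul_eq_mul, nsmul_eq_mul, map_add, map_sub, z0, z1, z2, z3, z4]
    simp [map_ofNat C, smul_eq_C_mul]
    try ring

lemma cubicInvariant_mem : cubicInvariant ∈ highestWeight 3 0 := by
  obtain ⟨p0, p1, p2, p3, p4⟩ := LPlus_X
  obtain ⟨z0, z1, z2, z3, z4⟩ := LZ_X
  refine mem_highestWeight_iff.2 ⟨((((isHomogeneous_X_mul_X_mul_X 0 2 4).add
    ((isHomogeneous_X_mul_X_mul_X 1 2 3).C_mul 2)).sub (isHomogeneous_X_pow 2 3)).sub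
    ((isHomogeneous_X ℂ 0).mul (isHomogeneous_X_pow 3 2))).sub
    ((isHomogeneous_X_pow 1 2).mul (isHomogeneous_X ℂ 4)), ?_, ?_⟩
  · simp only [cubicInvariant, Derivation.leibniz, Derivation.leibniz_pow, derivation_C,
      smul_eq_mul, nsmul_eq_mul, map_add, map_sub, p0, p1, p2, p3, p4]
    simp [map_ofNat C]
    try ring
  · simp only [cubicInvariant, Derivation.leibniz, Derivation.leibniz_pow, derivation_C,
      smul_eq_mul, nsmul_eq_mul, map_add, map_sub, z0, z1, z2, z3, z4]
    simp [map_ofNat C, smul_eq_C_mul]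
    try ring

lemma quadInvariant_mul_mem : quadInvariant * X 0 ∈ highestWeight 3 2 := by
  obtain ⟨p0, p1, p2, p3, p4⟩ := LPlus_X
  obtain ⟨z0, z1, z2, z3, z4⟩ := LZ_X
  refine mem_highestWeight_iff.2 ⟨(mem_highestWeight_iff.1 quadInvariant_mem).1.mul
    (isHomogeneous_X ℂ 0), ?_, ?_⟩
  · simp only [quadInvariant, Derivation.leibniz, Derivation.leibniz_pow, derivation_C,
      smul_eq_mul, nsmul_eq_mul, map_add, map_sub, p0, p1, p2, p3, p4]
    simp [map_ofNat C]
    try ring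
  · simp only [quadInvariant, Derivation.leibniz, Derivation.leibniz_pow, derivation_C,
      smul_eq_mul, nsmul_eq_mul, map_add, map_sub, z0, z1, z2, z3, z4]
    simp [map_ofNat C, smul_eq_C_mul]
    try ring

lemma cubicCovariant_mem : cubicCovariant ∈ highestWeight 3 3 := by
  obtain ⟨p0, p1, p2, p3, p4⟩ := LPlus_X
  obtain ⟨z0, z1, z2, z3, z4⟩ := LZ_X
  refine mem_highestWeight_iff.2 ⟨(((isHomogeneous_X_pow 0 2).mul (isHomogeneous_X ℂ 3)).sub
    ((isHomogeneous_X_mul_X_mul_X 0 1 2).C_mul 3)).add ((isHomogeneous_X_pow 1 3).C_mul 2), ?_, ?_⟩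
  · simp only [cubicCovariant, Derivation.leibniz, Derivation.leibniz_pow, derivation_C,
      smul_eq_mul, nsmul_eq_mul, map_add, map_sub, p0, p1, p2, p3, p4]
    simp [map_ofNat C]
    try ring
  · simp only [cubicCovariant, Derivation.leibniz, Derivation.leibniz_pow, derivation_C,
      smul_eq_mul, nsmul_eq_mul, map_add, map_sub, z0, z1, z2, z3, z4]
    simp [map_ofNat C, smul_eq_C_mul]
    try ring

lemma hessCovariant_mul_mem : hessCovariant * X 0 ∈ highestWeight 3 4 := by
  obtain ⟨p0, p1, p2, p3, p4⟩ := LPlus_X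
  obtain ⟨z0, z1, z2, z3, z4⟩ := LZ_X
  refine mem_highestWeight_iff.2 ⟨(mem_highestWeight_iff.1 hessCovariant_mem).1.mul
    (isHomogeneous_X ℂ 0), ?_, ?_⟩
  · simp only [hessCovariant, Derivation.leibniz, Derivation.leibniz_pow, derivation_C,
      smul_eq_mul, nsmul_eq_mul, map_add, map_sub, p0, p1, p2, p3, p4]
    simp [map_ofNat C]
    try ring
  · simp only [hessCovariant, Derivation.leibniz, Derivation.leibniz_pow, derivation_C,
      smul_eq_mul, nsmul_eq_mul, map_add, map_sub, z0, z1, z2, z3, z4]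
    simp [map_ofNat C, smul_eq_C_mul]
    try ring

lemma X_zero_cube_mem : (X 0 ^ 3 : MvPolynomial (Fin 5) ℂ) ∈ highestWeight 3 6 := by
  obtain ⟨p0, p1, p2, p3, p4⟩ := LPlus_X
  obtain ⟨z0, z1, z2, z3, z4⟩ := LZ_X
  refine mem_highestWeight_iff.2 ⟨isHomogeneous_X_pow 0 3, ?_, ?_⟩
  · simp only [Derivation.leibniz, Derivation.leibniz_pow, derivation_C,
      smul_eq_mul, nsmul_eq_mul, map_add, map_sub, p0, p1, p2, p3, p4]
    simp [map_ofNat C]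
    try ring
  · simp only [Derivation.leibniz, Derivation.leibniz_pow, derivation_C,
      smul_eq_mul, nsmul_eq_mul, map_add, map_sub, z0, z1, z2, z3, z4]
    simp [map_ofNat C, smul_eq_C_mul]
    try ring

/-! ### Solving `L_+ F = 0` on each weight space in degrees two and three. -/

lemma highestWeight_two_zero : highestWeight 2 0 = Submodule.span ℂ {quadInvariant} := by
  refine le_antisymm ?_ (by simpa using quadInvariant_mem)
  intro F hF
  obtain ⟨p0, p1, p2, p3, p4⟩ := LPlus_X
  have hsum := eq_sum_of_mem_highestWeight hF
    {![1, 0, 0, 0, 1], ![0, 1, 0, 1, 0], ![0, 0, 2, 0, 0]} (by decide)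
  rw [Finset.sum_insert (by decide), Finset.sum_insert (by decide), Finset.sum_singleton] at hsum
  generalize coeff (Finsupp.equivFunOnFinite.symm ![1, 0, 0, 0, 1]) F = a at hsum
  generalize coeff (Finsupp.equivFunOnFinite.symm ![0, 1, 0, 1, 0]) F = b at hsum
  generalize coeff (Finsupp.equivFunOnFinite.symm ![0, 0, 2, 0, 0]) F = c at hsum
  simp only [Matrix.cons_val, pow_zero, pow_one, mul_one, one_mul] at hsum
  have hL := (mem_highestWeight_iff.1 hF).2.1
  rw [hsum] at hL
  simp only [Derivation.leibniz, Derivation.leibniz_pow, derivation_C,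
      smul_eq_mul, nsmul_eq_mul, map_add, map_sub, p0, p1, p2, p3, p4] at hL
  -- Evaluation at a 0-1 vector retains only the monomials of `L_+ F` supported on its nonzero
  -- entries, giving a linear equation between the coefficients. The lemmas below that need such
  -- equations obtain them in this way.
  have e1 := congrArg (eval ![1, 0, 0, 1, 0]) hL
  have e2 := congrArg (eval ![0, 1, 1, 0, 0]) hL
  simp at e1 e2
  have hb : b = -4 * a := by linear_combination e1
  have hc : c = 3 * a := by linear_combination (1 / 4 : ℂ) * e2 - 3 / 4 * e1
  rw [hsum, hb, hc]
  refine Submodule.mem_span_singleton.2 ⟨a, ?_⟩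
  simp [quadInvariant, smul_eq_C_mul, map_ofNat C]
  try ring

lemma highestWeight_two_one : highestWeight 2 1 = ⊥ := by
  rw [eq_bot_iff]
  intro F hF
  obtain ⟨p0, p1, p2, p3, p4⟩ := LPlus_X
  have hsum := eq_sum_of_mem_highestWeight hF
    {![1, 0, 0, 1, 0], ![0, 1, 1, 0, 0]} (by decide)
  rw [Finset.sum_insert (by decide), Finset.sum_singleton] at hsum
  generalize coeff (Finsupp.equivFunOnFinite.symm ![1, 0, 0, 1, 0]) F = a at hsum
  generalize coeff (Finsupp.equivFunOnFinite.symm ![0, 1, 1, 0, 0]) F = b at hsum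
  simp only [Matrix.cons_val, pow_zero, pow_one, mul_one, one_mul] at hsum
  have hL := (mem_highestWeight_iff.1 hF).2.1
  rw [hsum] at hL
  simp only [Derivation.leibniz, Derivation.leibniz_pow, derivation_C,
      smul_eq_mul, nsmul_eq_mul, map_add, map_sub, p0, p1, p2, p3, p4] at hL
  have e1 := congrArg (eval ![0, 1, 0, 0, 0]) hL
  have e2 := congrArg (eval ![1, 0, 1, 0, 0]) hL
  simp at e1 e2
  have hb : b = 0 := by linear_combination e1
  have ha : a = 0 := by linear_combination (1 / 3 : ℂ) * e2 - 1 / 3 * hb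
  rw [hsum, hb, ha]
  simp

lemma highestWeight_two_two : highestWeight 2 2 = Submodule.span ℂ {hessCovariant} := by
  refine le_antisymm ?_ (by simpa using hessCovariant_mem)
  intro F hF
  obtain ⟨p0, p1, p2, p3, p4⟩ := LPlus_X
  have hsum := eq_sum_of_mem_highestWeight hF
    {![1, 0, 1, 0, 0], ![0, 2, 0, 0, 0]} (by decide)
  rw [Finset.sum_insert (by decide), Finset.sum_singleton] at hsum
  generalize coeff (Finsupp.equivFunOnFinite.symm ![1, 0, 1, 0, 0]) F = a at hsum
  generalize coeff (Finsupp.equivFunOnFinite.symm ![0, 2, 0, 0, 0]) F = b at hsum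
  simp only [Matrix.cons_val, pow_zero, pow_one, mul_one, one_mul] at hsum
  have hL := (mem_highestWeight_iff.1 hF).2.1
  rw [hsum] at hL
  simp only [Derivation.leibniz, Derivation.leibniz_pow, derivation_C,
      smul_eq_mul, nsmul_eq_mul, map_add, map_sub, p0, p1, p2, p3, p4] at hL
  have e1 := congrArg (eval ![1, 1, 0, 0, 0]) hL
  simp at e1
  have hb : b = -a := by linear_combination (1 / 2 : ℂ) * e1
  rw [hsum, hb]
  refine Submodule.mem_span_singleton.2 ⟨a, ?_⟩
  simp [hessCovariant, smul_eq_C_mul, map_ofNat C]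
  try ring

lemma highestWeight_two_three : highestWeight 2 3 = ⊥ := by
  rw [eq_bot_iff]
  intro F hF
  obtain ⟨p0, p1, p2, p3, p4⟩ := LPlus_X
  have hsum := eq_sum_of_mem_highestWeight hF
    {![1, 1, 0, 0, 0]} (by decide)
  rw [Finset.sum_singleton] at hsum
  generalize coeff (Finsupp.equivFunOnFinite.symm ![1, 1, 0, 0, 0]) F = a at hsum
  simp only [Matrix.cons_val, pow_zero, pow_one, mul_one, one_mul] at hsum
  have hL := (mem_highestWeight_iff.1 hF).2.1
  rw [hsum] at hL
  simp only [Derivation.leibniz, Derivation.leibniz_pow, derivation_C,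
      smul_eq_mul, nsmul_eq_mul, map_add, map_sub, p0, p1, p2, p3, p4] at hL
  have e1 := congrArg (eval ![1, 0, 0, 0, 0]) hL
  simp at e1
  have ha : a = 0 := by linear_combination e1
  rw [hsum, ha]
  simp

lemma highestWeight_two_four : highestWeight 2 4 = Submodule.span ℂ {X 0 ^ 2} := by
  refine le_antisymm ?_ (by simpa using X_zero_sq_mem)
  intro F hF
  obtain ⟨p0, p1, p2, p3, p4⟩ := LPlus_X
  have hsum := eq_sum_of_mem_highestWeight hF
    {![2, 0, 0, 0, 0]} (by decide)
  rw [Finset.sum_singleton] at hsum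
  generalize coeff (Finsupp.equivFunOnFinite.symm ![2, 0, 0, 0, 0]) F = a at hsum
  simp only [Matrix.cons_val, pow_zero, pow_one, mul_one, one_mul] at hsum
  rw [hsum]
  refine Submodule.mem_span_singleton.2 ⟨a, ?_⟩
  simp [smul_eq_C_mul, map_ofNat C]
  try ring

lemma highestWeight_three_zero : highestWeight 3 0 = Submodule.span ℂ {cubicInvariant} := by
  refine le_antisymm ?_ (by simpa using cubicInvariant_mem)
  intro F hF
  obtain ⟨p0, p1, p2, p3, p4⟩ := LPlus_X
  have hsum := eq_sum_of_mem_highestWeight hF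
    {![1, 0, 1, 0, 1], ![1, 0, 0, 2, 0], ![0, 2, 0, 0, 1], ![0, 1, 1, 1, 0], ![0, 0, 3, 0, 0]} (by decide)
  rw [Finset.sum_insert (by decide), Finset.sum_insert (by decide), Finset.sum_insert (by decide), Finset.sum_insert (by decide), Finset.sum_singleton] at hsum
  generalize coeff (Finsupp.equivFunOnFinite.symm ![1, 0, 1, 0, 1]) F = a at hsum
  generalize coeff (Finsupp.equivFunOnFinite.symm ![1, 0, 0, 2, 0]) F = b at hsum
  generalize coeff (Finsupp.equivFunOnFinite.symm ![0, 2, 0, 0, 1]) F = c at hsum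
  generalize coeff (Finsupp.equivFunOnFinite.symm ![0, 1, 1, 1, 0]) F = e at hsum
  generalize coeff (Finsupp.equivFunOnFinite.symm ![0, 0, 3, 0, 0]) F = f at hsum
  simp only [Matrix.cons_val, pow_zero, pow_one, mul_one, one_mul] at hsum
  have hL := (mem_highestWeight_iff.1 hF).2.1
  rw [hsum] at hL
  simp only [Derivation.leibniz, Derivation.leibniz_pow, derivation_C,
      smul_eq_mul, nsmul_eq_mul, map_add, map_sub, p0, p1, p2, p3, p4] at hL
  have e1 := congrArg (eval ![1, 1, 0, 0, 1]) hL
  have e2 := congrArg (eval ![1, 0, 1, 1, 0]) hL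
  have e3 := congrArg (eval ![0, 1, 0, 1, 0]) hL
  have e4 := congrArg (eval ![0, 1, 1, 0, 0]) hL
  simp at e1 e2 e3 e4
  have hc : c = -a := by linear_combination (1 / 2 : ℂ) * e1
  have he : e = 2 * a := by linear_combination (1 / 2 : ℂ) * e3 - 2 * hc
  have hb : b = -a := by linear_combination (1 / 6 : ℂ) * e2 - 1 / 6 * he
  have hf : f = -a := by linear_combination (1 / 6 : ℂ) * e4 - 1 / 2 * he
  rw [hsum, hc, he, hb, hf]
  refine Submodule.mem_span_singleton.2 ⟨a, ?_⟩
  simp [cubicInvariant, smul_eq_C_mul, map_ofNat C]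
  try ring

lemma highestWeight_three_one : highestWeight 3 1 = ⊥ := by
  rw [eq_bot_iff]
  intro F hF
  obtain ⟨p0, p1, p2, p3, p4⟩ := LPlus_X
  have hsum := eq_sum_of_mem_highestWeight hF
    {![1, 1, 0, 0, 1], ![1, 0, 1, 1, 0], ![0, 2, 0, 1, 0], ![0, 1, 2, 0, 0]} (by decide)
  rw [Finset.sum_insert (by decide), Finset.sum_insert (by decide), Finset.sum_insert (by decide), Finset.sum_singleton] at hsum
  generalize coeff (Finsupp.equivFunOnFinite.symm ![1, 1, 0, 0, 1]) F = a at hsum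
  generalize coeff (Finsupp.equivFunOnFinite.symm ![1, 0, 1, 1, 0]) F = b at hsum
  generalize coeff (Finsupp.equivFunOnFinite.symm ![0, 2, 0, 1, 0]) F = c at hsum
  generalize coeff (Finsupp.equivFunOnFinite.symm ![0, 1, 2, 0, 0]) F = e at hsum
  simp only [Matrix.cons_val, pow_zero, pow_one, mul_one, one_mul] at hsum
  have hL := (mem_highestWeight_iff.1 hF).2.1
  rw [hsum] at hL
  simp only [Derivation.leibniz, Derivation.leibniz_pow, derivation_C,
      smul_eq_mul, nsmul_eq_mul, map_add, map_sub, p0, p1, p2, p3, p4] at hL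
  have e1 := congrArg (eval ![1, 0, 0, 0, 1]) hL
  have e2 := congrArg (eval ![1, 0, 1, 0, 0]) hL
  have e3 := congrArg (eval ![0, 1, 1, 0, 0]) hL
  have e4 := congrArg (eval ![1, 1, 0, 1, 0]) hL
  simp at e1 e2 e3 e4
  have ha : a = 0 := by linear_combination e1
  have hb : b = 0 := by
    linear_combination (-1 / 15 : ℂ) * (e3 - 4 * e2 - 3 / 2 * e4 + 6 * e1)
  have hc : c = 0 := by linear_combination (1 / 2 : ℂ) * e4 - hb - 2 * e1
  have he : e = 0 := by linear_combination e2 - 3 * hb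
  rw [hsum, ha, hb, hc, he]
  simp

lemma highestWeight_three_two : highestWeight 3 2 = Submodule.span ℂ {quadInvariant * X 0} := by
  refine le_antisymm ?_ (by simpa using quadInvariant_mul_mem)
  intro F hF
  obtain ⟨p0, p1, p2, p3, p4⟩ := LPlus_X
  have hsum := eq_sum_of_mem_highestWeight hF
    {![2, 0, 0, 0, 1], ![1, 1, 0, 1, 0], ![1, 0, 2, 0, 0], ![0, 2, 1, 0, 0]} (by decide)
  rw [Finset.sum_insert (by decide), Finset.sum_insert (by decide), Finset.sum_insert (by decide), Finset.sum_singleton] at hsum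
  generalize coeff (Finsupp.equivFunOnFinite.symm ![2, 0, 0, 0, 1]) F = a at hsum
  generalize coeff (Finsupp.equivFunOnFinite.symm ![1, 1, 0, 1, 0]) F = b at hsum
  generalize coeff (Finsupp.equivFunOnFinite.symm ![1, 0, 2, 0, 0]) F = c at hsum
  generalize coeff (Finsupp.equivFunOnFinite.symm ![0, 2, 1, 0, 0]) F = e at hsum
  simp only [Matrix.cons_val, pow_zero, pow_one, mul_one, one_mul] at hsum
  have hL := (mem_highestWeight_iff.1 hF).2.1
  rw [hsum] at hL
  simp only [Derivation.leibniz, Derivation.leibniz_pow, derivation_C,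
      smul_eq_mul, nsmul_eq_mul, map_add, map_sub, p0, p1, p2, p3, p4] at hL
  have e1 := congrArg (eval ![0, 1, 0, 0, 0]) hL
  have e2 := congrArg (eval ![1, 0, 0, 1, 0]) hL
  have e3 := congrArg (eval ![1, 1, 1, 0, 0]) hL
  simp at e1 e2 e3
  have he : e = 0 := by linear_combination e1
  have hb : b = -4 * a := by linear_combination e2
  have hc : c = 3 * a := by linear_combination (1 / 4 : ℂ) * e3 - he - 3 / 4 * hb
  rw [hsum, he, hb, hc]
  refine Submodule.mem_span_singleton.2 ⟨a, ?_⟩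
  simp [quadInvariant, smul_eq_C_mul, map_ofNat C]
  try ring

lemma highestWeight_three_three : highestWeight 3 3 = Submodule.span ℂ {cubicCovariant} := by
  refine le_antisymm ?_ (by simpa using cubicCovariant_mem)
  intro F hF
  obtain ⟨p0, p1, p2, p3, p4⟩ := LPlus_X
  have hsum := eq_sum_of_mem_highestWeight hF
    {![2, 0, 0, 1, 0], ![1, 1, 1, 0, 0], ![0, 3, 0, 0, 0]} (by decide)
  rw [Finset.sum_insert (by decide), Finset.sum_insert (by decide), Finset.sum_singleton] at hsum
  generalize coeff (Finsupp.equivFunOnFinite.symm ![2, 0, 0, 1, 0]) F = a at hsum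
  generalize coeff (Finsupp.equivFunOnFinite.symm ![1, 1, 1, 0, 0]) F = b at hsum
  generalize coeff (Finsupp.equivFunOnFinite.symm ![0, 3, 0, 0, 0]) F = c at hsum
  simp only [Matrix.cons_val, pow_zero, pow_one, mul_one, one_mul] at hsum
  have hL := (mem_highestWeight_iff.1 hF).2.1
  rw [hsum] at hL
  simp only [Derivation.leibniz, Derivation.leibniz_pow, derivation_C,
      smul_eq_mul, nsmul_eq_mul, map_add, map_sub, p0, p1, p2, p3, p4] at hL
  have e1 := congrArg (eval ![1, 0, 1, 0, 0]) hL
  have e2 := congrArg (eval ![1, 1, 0, 0, 0]) hL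
  simp at e1 e2
  have hb : b = -3 * a := by linear_combination e1
  have hc : c = 2 * a := by linear_combination (1 / 3 : ℂ) * e2 - 2 / 3 * hb
  rw [hsum, hb, hc]
  refine Submodule.mem_span_singleton.2 ⟨a, ?_⟩
  simp [cubicCovariant, smul_eq_C_mul, map_ofNat C]
  try ring

lemma highestWeight_three_four : highestWeight 3 4 = Submodule.span ℂ {hessCovariant * X 0} := by
  refine le_antisymm ?_ (by simpa using hessCovariant_mul_mem)
  intro F hF
  obtain ⟨p0, p1, p2, p3, p4⟩ := LPlus_X
  have hsum := eq_sum_of_mem_highestWeight hF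
    {![2, 0, 1, 0, 0], ![1, 2, 0, 0, 0]} (by decide)
  rw [Finset.sum_insert (by decide), Finset.sum_singleton] at hsum
  generalize coeff (Finsupp.equivFunOnFinite.symm ![2, 0, 1, 0, 0]) F = a at hsum
  generalize coeff (Finsupp.equivFunOnFinite.symm ![1, 2, 0, 0, 0]) F = b at hsum
  simp only [Matrix.cons_val, pow_zero, pow_one, mul_one, one_mul] at hsum
  have hL := (mem_highestWeight_iff.1 hF).2.1
  rw [hsum] at hL
  simp only [Derivation.leibniz, Derivation.leibniz_pow, derivation_C,
      smul_eq_mul, nsmul_eq_mul, map_add, map_sub, p0, p1, p2, p3, p4] at hL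
  have e1 := congrArg (eval ![1, 1, 0, 0, 0]) hL
  simp at e1
  have hb : b = -a := by linear_combination (1 / 2 : ℂ) * e1
  rw [hsum, hb]
  refine Submodule.mem_span_singleton.2 ⟨a, ?_⟩
  simp [hessCovariant, smul_eq_C_mul, map_ofNat C]
  try ring

lemma highestWeight_three_five : highestWeight 3 5 = ⊥ := by
  rw [eq_bot_iff]
  intro F hF
  obtain ⟨p0, p1, p2, p3, p4⟩ := LPlus_X
  have hsum := eq_sum_of_mem_highestWeight hF
    {![2, 1, 0, 0, 0]} (by decide)
  rw [Finset.sum_singleton] at hsum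
  generalize coeff (Finsupp.equivFunOnFinite.symm ![2, 1, 0, 0, 0]) F = a at hsum
  simp only [Matrix.cons_val, pow_zero, pow_one, mul_one, one_mul] at hsum
  have hL := (mem_highestWeight_iff.1 hF).2.1
  rw [hsum] at hL
  simp only [Derivation.leibniz, Derivation.leibniz_pow, derivation_C,
      smul_eq_mul, nsmul_eq_mul, map_add, map_sub, p0, p1, p2, p3, p4] at hL
  have e1 := congrArg (eval ![1, 0, 0, 0, 0]) hL
  simp at e1
  have ha : a = 0 := by linear_combination e1
  rw [hsum, ha]
  simp

lemma highestWeight_three_six : highestWeight 3 6 = Submodule.span ℂ {X 0 ^ 3} := by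
  refine le_antisymm ?_ (by simpa using X_zero_cube_mem)
  intro F hF
  obtain ⟨p0, p1, p2, p3, p4⟩ := LPlus_X
  have hsum := eq_sum_of_mem_highestWeight hF
    {![3, 0, 0, 0, 0]} (by decide)
  rw [Finset.sum_singleton] at hsum
  generalize coeff (Finsupp.equivFunOnFinite.symm ![3, 0, 0, 0, 0]) F = a at hsum
  simp only [Matrix.cons_val, pow_zero, pow_one, mul_one, one_mul] at hsum
  rw [hsum]
  refine Submodule.mem_span_singleton.2 ⟨a, ?_⟩
  simp [smul_eq_C_mul, map_ofNat C]
  try ring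

lemma ne_zero_of_eval {F : MvPolynomial (Fin 5) ℂ} (x : Fin 5 → ℂ) (h : eval x F ≠ 0) : F ≠ 0 := by
  rintro rfl
  simp at h

lemma quadInvariant_ne_zero : quadInvariant ≠ 0 :=
  ne_zero_of_eval ![1, 0, 0, 0, 1] (by simp [quadInvariant])

lemma hessCovariant_ne_zero : hessCovariant ≠ 0 :=
  ne_zero_of_eval ![1, 0, 1, 0, 0] (by simp [hessCovariant])

lemma cubicInvariant_ne_zero : cubicInvariant ≠ 0 :=
  ne_zero_of_eval ![0, 0, 1, 0, 0] (by simp [cubicInvariant])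

lemma cubicCovariant_ne_zero : cubicCovariant ≠ 0 :=
  ne_zero_of_eval ![1, 0, 0, 1, 0] (by simp [cubicCovariant])

lemma finrank_highestWeight_two (j : ℕ) : Module.finrank ℂ (highestWeight 2 j) =
    if j ∈ ({0, 2, 4} : Finset ℕ) then 1 else 0 := by
  rcases Nat.lt_or_ge 4 j with hj | hj
  · rw [highestWeight_eq_bot_of_gt hj, finrank_bot, if_neg]
    simp
    omega
  · interval_cases j
    · rw [highestWeight_two_zero, finrank_span_singleton quadInvariant_ne_zero]
      rfl
    · rw [highestWeight_two_one, finrank_bot]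
      rfl
    · rw [highestWeight_two_two, finrank_span_singleton hessCovariant_ne_zero]
      rfl
    · rw [highestWeight_two_three, finrank_bot]
      rfl
    · rw [highestWeight_two_four, finrank_span_singleton (pow_ne_zero _ (X_ne_zero _))]
      rfl

lemma finrank_highestWeight_three (j : ℕ) : Module.finrank ℂ (highestWeight 3 j) =
    if j ∈ ({0, 2, 3, 4, 6} : Finset ℕ) then 1 else 0 := by
  rcases Nat.lt_or_ge 6 j with hj | hj
  · rw [highestWeight_eq_bot_of_gt hj, finrank_bot, if_neg]
    simp
    omega
  · interval_cases j
    · rw [highestWeight_three_zero, finrank_span_singleton cubicInvariant_ne_zero]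
      rfl
    · rw [highestWeight_three_one, finrank_bot]
      rfl
    · rw [highestWeight_three_two, finrank_span_singleton
        (mul_ne_zero quadInvariant_ne_zero (X_ne_zero _))]
      rfl
    · rw [highestWeight_three_three, finrank_span_singleton cubicCovariant_ne_zero]
      rfl
    · rw [highestWeight_three_four, finrank_span_singleton
        (mul_ne_zero hessCovariant_ne_zero (X_ne_zero _))]
      rfl
    · rw [highestWeight_three_five, finrank_bot]
      rfl
    · rw [highestWeight_three_six, finrank_span_singleton (pow_ne_zero _ (X_ne_zero _))]
      rfl

/-! ### Values of the highest weight vectors on the sphere -/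

lemma eval_coord_quadInvariant (p : SU2) : eval (coord p) quadInvariant = 0 := by
  have h := quadratic_invariant_binaryCoeff (p.1 0 0) (p.1 1 0) (p.1 0 1) (p.1 1 1) three_mul_mu_sq
  rw [← coord_eq] at h
  simpa [quadInvariant] using h

lemma eval_formVbar (x : Fin 2 → ℂ) :
    eval x formVbar = x 0 ^ 4 + x 1 ^ 4 - 6 * mu * x 0 ^ 2 * x 1 ^ 2 := by
  simp [formVbar, six_mul_mu]

lemma eval_st_formVbar (p : SU2) : eval (st p) formVbar =
    binaryCoeff (-mu) (p.1 0 0) (p.1 1 0) (p.1 0 1) (p.1 1 1) 0 := by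
  rw [eval_formVbar]
  simp [st, binaryCoeff]
  ring

lemma eval_st_formV (p : SU2) : eval (st p) formV = coord p 0 := by
  rw [eval_formV, coord_eq]
  simp [st, binaryCoeff]

lemma eval_coord_hessCovariant (p : SU2) :
    eval (coord p) hessCovariant = mu * eval (st p) formVbar := by
  have h := hessian_binaryCoeff_zero (p.1 0 0) (p.1 1 0) (p.1 0 1) (p.1 1 1) three_mul_mu_sq
  rw [← coord_eq, p.det_eq, ← eval_st_formVbar] at h
  simpa [hessCovariant] using h

lemma eval_coord_cubicInvariant (p : SU2) :
    eval (coord p) cubicInvariant = 4 / 3 * mu := by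
  have h := cubic_invariant_binaryCoeff (p.1 0 0) (p.1 1 0) (p.1 0 1) (p.1 1 1) three_mul_mu_sq
  rw [← coord_eq, p.det_eq] at h
  simp [cubicInvariant]
  simp at h
  linear_combination (1 / 3 : ℂ) * h

lemma eval_coord_cubicCovariant (p : SU2) :
    eval (coord p) cubicCovariant = 4 * eval (st p) formP := by
  have h := cubic_covariant_binaryCoeff (p.1 0 0) (p.1 1 0) (p.1 0 1) (p.1 1 1) three_mul_mu_sq
  rw [← coord_eq, p.det_eq] at h
  simp [cubicCovariant, formP, st]
  simp at h
  linear_combination h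

/-- A difference of squares: the cross term is `-36μ² s⁴t⁴ = 12 s⁴t⁴`, which with `2 s⁴t⁴` gives the
coefficient 14. -/
lemma formV_mul_formVbar : formV * formVbar = formW := by
  have h : (C mu) ^ 2 * 3 = (-1 : MvPolynomial (Fin 2) ℂ) := by
    rw [← map_pow, ← map_ofNat C, ← map_mul, mul_comm, three_mul_mu_sq, map_neg, map_one]
  rw [formV, formVbar, formW, C_eq_six_mul_mu]
  linear_combination (-12 * X 0 ^ 4 * X 1 ^ 4) * h

lemma eval_coord_hessCovariant_mul (p : SU2) :
    eval (coord p) (hessCovariant * X 0) = mu * eval (st p) formW := by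
  rw [map_mul, eval_coord_hessCovariant, eval_X, ← eval_st_formV, ← formV_mul_formVbar, map_mul]
  ring

lemma eval_coord_X_zero_cube (p : SU2) :
    eval (coord p) (X 0 ^ 3) = eval (st p) (formV ^ 3) := by
  rw [map_pow, eval_X, ← eval_st_formV, map_pow]

lemma descendant_smul {A : Type} [CommRing A] [Algebra ℂ A] (D : Derivation ℂ A A) (N l : ℕ)
    (a : ℂ) (f : A) : descendant D N l (a • f) = a • descendant D N l f := by
  have h : D^[l] (a • f) = a • D^[l] f := by
    induction l with
    | zero => rfl
    | succ l ih => rw [Function.iterate_succ_apply', ih, D.map_smul, Function.iterate_succ_apply']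
  rw [descendant, h, smul_comm, descendant]

/-- Lowering the Hessian produces its remaining coefficients as quadratic forms in the coordinates,
and the Hessian of `V` is `μ` times the conjugate quartic. -/
lemma eval_coord_descendant_hessCovariant (p : SU2) (l : Fin 5) :
    eval (coord p) (descendant LMinus 4 l hessCovariant) =
      mu * binaryCoeff (-mu) (p.1 0 0) (p.1 1 0) (p.1 0 1) (p.1 1 1) l := by
  obtain ⟨m0, m1, m2, m3, m4⟩ := LMinus_X
  have s1 : LMinus hessCovariant = (2 : ℂ) • (X 0 * X 3 - X 1 * X 2) := by
    simp only [hessCovariant, Derivation.leibniz, Derivation.leibniz_pow, map_sub, m0, m1, m2]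
    simp [smul_eq_C_mul, map_ofNat C]
    ring
  have s2 : LMinus (X 0 * X 3 - X 1 * X 2) = X 0 * X 4 + C 2 * (X 1 * X 3) - C 3 * X 2 ^ 2 := by
    simp only [Derivation.leibniz, map_sub, m0, m1, m2, m3]
    simp [map_ofNat C]
    ring
  have s3 : LMinus (X 0 * X 4 + C 2 * (X 1 * X 3) - C 3 * X 2 ^ 2) =
      (6 : ℂ) • (X 1 * X 4 - X 2 * X 3) := by
    simp only [Derivation.leibniz, Derivation.leibniz_pow, map_sub, map_add, derivation_C,
      m0, m1, m2, m3, m4]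
    simp [smul_eq_C_mul, map_ofNat C]
    ring
  have s4 : LMinus (X 1 * X 4 - X 2 * X 3) = (2 : ℂ) • (X 2 * X 4 - X 3 ^ 2) := by
    simp only [Derivation.leibniz, map_sub, m1, m2, m3, m4]
    simp [smul_eq_C_mul, map_ofNat C]
    ring
  have h0 := hessian_binaryCoeff_zero (p.1 0 0) (p.1 1 0) (p.1 0 1) (p.1 1 1) three_mul_mu_sq
  have h1 := hessian_binaryCoeff_one (p.1 0 0) (p.1 1 0) (p.1 0 1) (p.1 1 1) three_mul_mu_sq
  have h2 := hessian_binaryCoeff_two (p.1 0 0) (p.1 1 0) (p.1 0 1) (p.1 1 1) three_mul_mu_sq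
  have h3 := hessian_binaryCoeff_three (p.1 0 0) (p.1 1 0) (p.1 0 1) (p.1 1 1) three_mul_mu_sq
  have h4 := hessian_binaryCoeff_four (p.1 0 0) (p.1 1 0) (p.1 0 1) (p.1 1 1) three_mul_mu_sq
  rw [← coord_eq, p.det_eq, one_pow, mul_one] at h0 h1 h2 h3 h4
  fin_cases l
  · simpa [descendant, hessCovariant, Nat.factorial] using h0
  · simp [descendant, s1, Nat.factorial]
    linear_combination (1 / 2 : ℂ) * h1
  · simp [descendant, s1, s2, Nat.factorial]
    linear_combination (1 / 6 : ℂ) * h2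
  · simp [descendant, s1, s2, s3, Nat.factorial]
    linear_combination (1 / 2 : ℂ) * h3
  · simp [descendant, s1, s2, s3, s4, Nat.factorial]
    linear_combination h4

/-- For a unitary matrix of determinant one conjugation sends `(s, t, b, d)` to `(d, -b, -t, s)`,
the substitution of `binaryCoeff_reverse`, and it turns `μ` into `-μ`. -/
lemma conj_coord (p : SU2) (l : Fin 5) : conj (coord p l) = (-1) ^ (l : ℕ) *
    binaryCoeff (-mu) (p.1 0 0) (p.1 1 0) (p.1 0 1) (p.1 1 1) l.rev := by
  rw [← binaryCoeff_reverse, coord_eq, map_binaryCoeff, conj_mu, ← p.apply_one_one,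
    p.apply_zero_one, p.apply_one_one]
  simp

lemma exists_of_mem_span_singleton {F G : MvPolynomial (Fin 5) ℂ}
    (hF : F ∈ Submodule.span ℂ {G}) (h0 : F ≠ 0) : ∃ a : ℂ, a ≠ 0 ∧ F = a • G := by
  obtain ⟨a, rfl⟩ := Submodule.mem_span_singleton.1 hF
  exact ⟨a, by rintro rfl; simp at h0, rfl⟩

lemma exists_conj_coord_eq {F : MvPolynomial (Fin 5) ℂ} (hF : F ∈ highestWeight 2 2)
    (h0 : F ≠ 0) : ∃ c : ℂ, c ≠ 0 ∧ ∀ p, ∀ l : Fin 5, conj (coord p l) =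
      c * (-1) ^ (l : ℕ) * eval (coord p) (descendant LMinus 4 (4 - l) F) := by
  rw [highestWeight_two_two] at hF
  obtain ⟨a, ha, rfl⟩ := exists_of_mem_span_singleton hF h0
  refine ⟨(a * mu)⁻¹, inv_ne_zero (mul_ne_zero ha mu_ne_zero), fun p l => ?_⟩
  have h := eval_coord_descendant_hessCovariant p l.rev
  have hl : ((l.rev : Fin 5) : ℕ) = 4 - l := by rw [Fin.val_rev]; omega
  rw [hl] at h
  rw [descendant_smul, smul_eval, h, conj_coord]
  have := mu_ne_zero
  field_simp

lemma exists_eval_coord_eq {F G : MvPolynomial (Fin 5) ℂ} {φ : MvPolynomial (Fin 2) ℂ} {e : ℂ}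
    (he : e ≠ 0) (hG : ∀ p, eval (coord p) G = e * eval (st p) φ)
    (hF : F ∈ Submodule.span ℂ {G}) (h0 : F ≠ 0) :
    ∃ c : ℂ, c ≠ 0 ∧ ∀ p, eval (coord p) F = c * eval (st p) φ := by
  obtain ⟨a, ha, rfl⟩ := exists_of_mem_span_singleton hF h0
  exact ⟨a * e, mul_ne_zero ha he, fun p => by rw [smul_eval, hG, mul_assoc]⟩

lemma eval_smul_of_isHomogeneous {σ : Type*} {n : ℕ} {F : MvPolynomial σ ℂ}
    (hF : F.IsHomogeneous n) (a : ℂ) (x : σ → ℂ) : eval (a • x) F = a ^ n * eval x F := by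
  rw [eval_eq, eval_eq, Finset.mul_sum]
  refine Finset.sum_congr rfl fun m hm => ?_
  have h := hF (mem_support_iff.1 hm)
  rw [Finsupp.weight_apply, Finsupp.sum] at h
  simp only [Pi.smul_apply, smul_eq_mul, mul_pow, Finset.prod_mul_distrib]
  rw [Finset.prod_pow_eq_pow_sum, ← h]
  simp
  ring

lemma eval_aeval {σ τ : Type*} (x : τ → ℂ) (φ : σ → MvPolynomial τ ℂ) (F : MvPolynomial σ ℂ) :
    eval x (aeval φ F) = eval (fun i => eval x (φ i)) F := by
  induction F using MvPolynomial.induction_on with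
  | C a => simp [algebraMap_eq]
  | add p q hp hq => simp only [map_add, hp, hq]
  | mul_X p i hp => simp only [map_mul, hp, aeval_X, eval_X]

lemma normalisation {K : MvPolynomial (Fin 5) ℂ} (hK : K ∈ highestWeight 3 0) (h0 : K ≠ 0) :
    ∃ c : ℂ, c ≠ 0 ∧ (∀ p, eval (coord p) K = c) ∧
      ∀ p, ∀ z : Fin 5 → ℂ, (∃ a : ℂ, a ≠ 0 ∧ z = a • coord p) →
        (eval z K = c ↔ ∃ ζ : ℂ, ζ ^ 3 = 1 ∧ z = ζ • coord p) := by
  have hhom := (mem_highestWeight_iff.1 hK).1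
  have hev (a : ℂ) (x : Fin 5 → ℂ) : eval (a • x) K = a ^ 3 * eval x K := eval_smul_of_isHomogeneous hhom a x
  rw [highestWeight_three_zero] at hK
  obtain ⟨b, hb, rfl⟩ := exists_of_mem_span_singleton hK h0
  have hc : b * (4 / 3 * mu) ≠ 0 := mul_ne_zero hb (mul_ne_zero (by norm_num) mu_ne_zero)
  have hval (p : SU2) : eval (coord p) (b • cubicInvariant) = b * (4 / 3 * mu) := by
    rw [smul_eval, eval_coord_cubicInvariant]
  refine ⟨_, hc, hval, ?_⟩
  rintro p z ⟨a, -, rfl⟩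
  rw [hev, hval, mul_eq_right₀ hc]
  constructor
  · exact fun h => ⟨a, h, rfl⟩
  · rintro ⟨ζ, hζ, h⟩
    rw [smul_left_injective ℂ (coord_ne_zero p) h, hζ]

lemma mem_highestWeight_three_two_iff (F : MvPolynomial (Fin 5) ℂ) :
    F ∈ highestWeight 3 2 ↔ ∃ Q ∈ highestWeight 2 0, F = Q * X 0 := by
  rw [highestWeight_three_two, highestWeight_two_zero]
  simp only [Submodule.mem_span_singleton]
  constructor
  · rintro ⟨a, rfl⟩
    exact ⟨_, ⟨a, rfl⟩, by rw [smul_mul_assoc]⟩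
  · rintro ⟨_, ⟨a, rfl⟩, rfl⟩
    exact ⟨a, by rw [smul_mul_assoc]⟩

/-! ### Independence of `s`, `t`, `conj s`, `conj t` -/

/-- A polynomial in `s`, `t`, `conj s`, `conj t` that vanishes for all complex numbers `s`, `t`
vanishes identically. -/
lemma eq_zero_of_eval_conj {G : MvPolynomial (Fin 4) ℂ}
    (h : ∀ s t : ℂ, eval ![s, t, conj s, conj t] G = 0) : G = 0 := by
  -- Passage to real and imaginary parts, `s = x₀ + i x₂` and `t = x₁ + i x₃`. The transformed
  -- polynomial vanishes on `ℝ⁴`, hence identically; inverting this linear change then gives `G =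
  -- 0`.
  let φ : Fin 4 → MvPolynomial (Fin 4) ℂ :=
    ![X 0 + C Complex.I * X 2, X 1 + C Complex.I * X 3, X 0 - C Complex.I * X 2,
      X 1 - C Complex.I * X 3]
  have hφ (x : Fin 4 → ℂ) : eval x (aeval φ G) = eval ![x 0 + Complex.I * x 2,
      x 1 + Complex.I * x 3, x 0 - Complex.I * x 2, x 1 - Complex.I * x 3] G := by
    rw [eval_aeval]
    congr 2
    ext i
    fin_cases i <;> simp [φ]
  have h0 : aeval φ G = 0 := by
    refine funext_set (fun _ => Set.range ((↑) : ℝ → ℂ))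
      (fun _ => Set.infinite_range_of_injective Complex.ofReal_injective) fun x hx => ?_
    choose y hy using fun i => hx i (Set.mem_univ i)
    rw [hφ, map_zero, ← h (x 0 + Complex.I * x 2) (x 1 + Complex.I * x 3)]
    simp [← hy, sub_eq_add_neg]
  refine MvPolynomial.funext fun x => ?_
  have := hφ ![(x 0 + x 2) / 2, (x 1 + x 3) / 2, (x 0 - x 2) / (2 * Complex.I),
    (x 1 - x 3) / (2 * Complex.I)]
  rw [h0, map_zero] at this
  rw [map_zero, this]
  congr 2
  ext i
  have hI : Complex.I ≠ 0 := Complex.I_ne_zero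
  fin_cases i <;> simp <;> field_simp <;> ring

lemma exists_eq_mul_SU2 (s t : ℂ) : ∃ (r : ℝ) (p : SU2), s = r * p.1 0 0 ∧ t = r * p.1 1 0 := by
  by_cases h : Complex.normSq s + Complex.normSq t = 0
  · have hs := Complex.normSq_nonneg s
    have ht := Complex.normSq_nonneg t
    exact ⟨0, 1, by simpa using Complex.normSq_eq_zero.1 (by linarith),
      by simpa using Complex.normSq_eq_zero.1 (by linarith)⟩
  · have hpos : 0 < Complex.normSq s + Complex.normSq t :=
      lt_of_le_of_ne (add_nonneg (Complex.normSq_nonneg s) (Complex.normSq_nonneg t)) (Ne.symm h)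
    obtain ⟨r, hr⟩ : ∃ r, r = Real.sqrt (Complex.normSq s + Complex.normSq t) := ⟨_, rfl⟩
    have hr0 : (r : ℂ) ≠ 0 := by
      rw [hr]
      exact_mod_cast (Real.sqrt_pos.2 hpos).ne'
    have hr2 : (r : ℂ) ^ 2 = s * conj s + t * conj t := by
      rw [Complex.mul_conj, Complex.mul_conj, ← Complex.ofReal_add, ← Complex.ofReal_pow, hr,
        Real.sq_sqrt hpos.le]
    refine ⟨r, SU2.mk (s / r) (t / r) ?_, ?_, ?_⟩
    · simp only [map_div₀, Complex.conj_ofReal]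
      field_simp
      exact hr2.symm
    · simp only [SU2.mk, Matrix.of_apply, Matrix.cons_val]
      field_simp
    · simp only [SU2.mk, Matrix.of_apply, Matrix.cons_val]
      field_simp

/-- A homogeneous form vanishing at the points `coord p` vanishes at the coefficients of the form
`V` after an arbitrary substitution. -/
lemma eval_binaryCoeff_eq_zero {n : ℕ} {F : MvPolynomial (Fin 5) ℂ} (hF : F.IsHomogeneous n)
    (h : ∀ p, eval (coord p) F = 0) (s t b d : ℂ) : eval (binaryCoeff mu s t b d) F = 0 := by
  have hG (s t u w : ℂ) : eval ![s, t, u, w] (aeval genericCoeff F) =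
      eval (binaryCoeff mu s t (-w) u) F := by
    rw [eval_aeval]
    congr 2
    ext l
    rw [genericCoeff, map_binaryCoeff]
    simp
  have h0 : aeval genericCoeff F = 0 := by
    refine eq_zero_of_eval_conj fun s t => ?_
    obtain ⟨r, p, hs, ht⟩ := exists_eq_mul_SU2 s t
    -- Every point of `ℂ²` is a real multiple of a point of the sphere, and the coordinates are
    -- homogeneous of degree four, so vanishing on the sphere extends to all `s, t`.
    have hv : binaryCoeff mu s t (-conj t) (conj s) = ((r : ℂ) ^ 4) • coord p := by
      rw [coord_eq, p.apply_zero_one, p.apply_one_one, hs, ht]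
      ext l
      fin_cases l <;> simp [binaryCoeff] <;> ring
    rw [hG, hv, eval_smul_of_isHomogeneous hF, h p, mul_zero]
  have := hG s t d (-b)
  rw [h0, map_zero, neg_neg] at this
  exact this.symm

lemma coeff_eq_zero_of_forall {c : Fin 9 → ℂ} (h : ∀ y : ℂ, ∑ i, c i * y ^ (i : ℕ) = 0)
    (i : Fin 9) : c i = 0 := by
  have h0 : ∑ i : Fin 9, Polynomial.monomial (i : ℕ) (c i) = 0 :=
    Polynomial.funext fun y => by simpa [Polynomial.eval_finsetSum] using h y
  have := congrArg (fun q => Polynomial.coeff q i) h0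
  simpa [Polynomial.finsetSum_coeff, Polynomial.coeff_monomial, Fin.val_inj] using this

lemma vanishing_quadric_iff {F : MvPolynomial (Fin 5) ℂ} (hF : F.IsHomogeneous 2) :
    (∀ p, eval (coord p) F = 0) ↔ F ∈ highestWeight 2 0 := by
  rw [highestWeight_two_zero, Submodule.mem_span_singleton]
  refine ⟨fun h => ?_, ?_⟩
  swap
  · rintro ⟨a, rfl⟩ p
    rw [smul_eval, eval_coord_quadInvariant, mul_zero]
  have hv := eval_binaryCoeff_eq_zero hF h
  have hsum := eq_sum_of_support_subset
    (T := {![2, 0, 0, 0, 0], ![1, 1, 0, 0, 0], ![1, 0, 1, 0, 0], ![1, 0, 0, 1, 0],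
      ![1, 0, 0, 0, 1], ![0, 2, 0, 0, 0], ![0, 1, 1, 0, 0], ![0, 1, 0, 1, 0], ![0, 1, 0, 0, 1],
      ![0, 0, 2, 0, 0], ![0, 0, 1, 1, 0], ![0, 0, 1, 0, 1], ![0, 0, 0, 2, 0], ![0, 0, 0, 1, 1],
      ![0, 0, 0, 0, 2]})
    fun m hm => (by decide : Finset.Nat.antidiagonalTuple 5 2 ⊆ _)
      (mem_antidiagonalTuple_of_mem_support hF hm)
  obtain ⟨c, hc⟩ : ∃ c : (Fin 5 → ℕ) → ℂ, ∀ e, coeff (Finsupp.equivFunOnFinite.symm e) F = c e :=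
    ⟨_, fun _ => rfl⟩
  simp only [hc] at hsum
  iterate 14 rw [Finset.sum_insert (by decide)] at hsum
  rw [Finset.sum_singleton] at hsum
  simp only [Matrix.cons_val, pow_zero, pow_one, mul_one, one_mul] at hsum
  generalize c ![2, 0, 0, 0, 0] = c00 at hsum
  generalize c ![1, 1, 0, 0, 0] = c01 at hsum
  generalize c ![1, 0, 1, 0, 0] = c02 at hsum
  generalize c ![1, 0, 0, 1, 0] = c03 at hsum
  generalize c ![1, 0, 0, 0, 1] = c04 at hsum
  generalize c ![0, 2, 0, 0, 0] = c11 at hsum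
  generalize c ![0, 1, 1, 0, 0] = c12 at hsum
  generalize c ![0, 1, 0, 1, 0] = c13 at hsum
  generalize c ![0, 1, 0, 0, 1] = c14 at hsum
  generalize c ![0, 0, 2, 0, 0] = c22 at hsum
  generalize c ![0, 0, 1, 1, 0] = c23 at hsum
  generalize c ![0, 0, 1, 0, 1] = c24 at hsum
  generalize c ![0, 0, 0, 2, 0] = c33 at hsum
  generalize c ![0, 0, 0, 1, 1] = c34 at hsum
  generalize c ![0, 0, 0, 0, 2] = c44 at hsum
  -- Three curves suffice. The degenerate substitution `(1, 0, y, 0)` gives the rational normal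
  -- curve `(1, y, y², y³, y⁴)`, the diagonal one `(1, 0, 0, y)` gives `(1, 0, μy², 0, y⁴)`, and
  -- `(1, 1, y, 0)` separates the pairs `c03, c12` and `c14, c23`.
  have h1 := coeff_eq_zero_of_forall (c := ![c00, c01, c02 + c11, c03 + c12, c04 + c13 + c22,
      c14 + c23, c24 + c33, c34, c44]) fun y => by
    have := hv 1 0 y 0
    rw [hsum] at this
    simp [binaryCoeff] at this
    simp [Fin.sum_univ_succ]
    linear_combination this
  have h2 := coeff_eq_zero_of_forall (c := ![c00, 0, mu * c02, 0, c04 + mu ^ 2 * c22, 0,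
      mu * c24, 0, c44]) fun y => by
    have := hv 1 0 0 y
    rw [hsum] at this
    simp [binaryCoeff] at this
    simp [Fin.sum_univ_succ]
    linear_combination this
  have h3 := coeff_eq_zero_of_forall (c := ![(2 + 6 * mu) ^ 2 * c00,
      (2 + 6 * mu) * (1 + 3 * mu) * c01, (2 + 6 * mu) * (1 + mu) * c02 + (1 + 3 * mu) ^ 2 * c11,
      (2 + 6 * mu) * c03 + (1 + 3 * mu) * (1 + mu) * c12,
      (2 + 6 * mu) * c04 + (1 + 3 * mu) * c13 + (1 + mu) ^ 2 * c22,
      (1 + 3 * mu) * c14 + (1 + mu) * c23, (1 + mu) * c24 + c33, c34, c44]) fun y => by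
    have := hv 1 1 y 0
    rw [hsum] at this
    simp [binaryCoeff] at this
    simp [Fin.sum_univ_succ]
    linear_combination this
  have hmu := mu_ne_zero
  have hm2 := three_mul_mu_sq
  have e00 : c00 = 0 := h1 0
  have e01 : c01 = 0 := h1 1
  have e34 : c34 = 0 := h1 7
  have e44 : c44 = 0 := h1 8
  have e02 : c02 = 0 := (mul_eq_zero.1 (h2 2 : mu * c02 = 0)).resolve_left hmu
  have e24 : c24 = 0 := (mul_eq_zero.1 (h2 6 : mu * c24 = 0)).resolve_left hmu
  have h12 : c02 + c11 = 0 := h1 2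
  have h13 : c03 + c12 = 0 := h1 3
  have h14 : c04 + c13 + c22 = 0 := h1 4
  have h15 : c14 + c23 = 0 := h1 5
  have h16 : c24 + c33 = 0 := h1 6
  have h24 : c04 + mu ^ 2 * c22 = 0 := h2 4
  have h33 : (2 + 6 * mu) * c03 + (1 + 3 * mu) * (1 + mu) * c12 = 0 := h3 3
  have h35 : (1 + 3 * mu) * c14 + (1 + mu) * c23 = 0 := h3 5
  have e11 : c11 = 0 := by linear_combination h12 - e02
  have e33 : c33 = 0 := by linear_combination h16 - e24
  have e03 : c03 = 0 := by
    -- `(1 + 3 μ) (1 - μ) = 2 + 2 μ`, whose inverse is `3 (1 - μ) / 8`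
    linear_combination (3 / 8 * (1 - mu)) * (h33 - (1 + 3 * mu) * (1 + mu) * h13)
      + (3 / 8 * (1 - mu)) * c03 * hm2 + (1 / 4) * c03 * hm2
  have e12 : c12 = 0 := by linear_combination h13 - e03
  have e14 : c14 = 0 := by
    have : (2 * mu) * c14 = 0 := by linear_combination h35 - (1 + mu) * h15
    simpa [hmu] using this
  have e23 : c23 = 0 := by linear_combination h15 - e14
  have e22 : c22 = 3 * c04 := by linear_combination -3 * h24 + c22 * hm2
  have e13 : c13 = -4 * c04 := by linear_combination h14 - e22
  refine ⟨c04, ?_⟩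
  rw [hsum, e00, e01, e02, e03, e11, e12, e13, e14, e22, e23, e24, e33, e34, e44, quadInvariant]
  simp [smul_eq_C_mul, map_ofNat C]
  ring

lemma linearIndependent_coord :
    LinearIndependent ℂ (fun (l : Fin 5) (p : SU2) => coord p l) := by
  rw [Fintype.linearIndependent_iff]
  intro c hc
  let F : MvPolynomial (Fin 5) ℂ := ∑ l, C (c l) * X l
  have hF : F.IsHomogeneous 1 := IsHomogeneous.sum _ _ _ fun l _ => isHomogeneous_C_mul_X _ _
  have h := eval_binaryCoeff_eq_zero hF fun p => by
    simpa [F] using congrFun hc p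
  -- On the substitution `(1, 0, y, 0)` the coordinates are `1, y, y², y³, y⁴`.
  have h2 := coeff_eq_zero_of_forall (c := ![c 0, c 1, c 2, c 3, c 4, 0, 0, 0, 0]) fun y => by
    have := h 1 0 y 0
    simp [F, binaryCoeff, Fin.sum_univ_five] at this
    simp [Fin.sum_univ_succ]
    linear_combination this
  intro l
  fin_cases l
  · exact h2 0
  · exact h2 1
  · exact h2 2
  · exact h2 3
  · exact h2 4

/-! ### Invariant binary forms -/

/-- The action of matrices on binary forms by linear substitution. -/
noncomputable def linAct (g : Matrix (Fin 2) (Fin 2) ℂ) :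
    MvPolynomial (Fin 2) ℂ →ₐ[ℂ] MvPolynomial (Fin 2) ℂ :=
  aeval fun i => C (g i 0) * X 0 + C (g i 1) * X 1

lemma eval_linAct (g : Matrix (Fin 2) (Fin 2) ℂ) (f : MvPolynomial (Fin 2) ℂ) (x : Fin 2 → ℂ) :
    eval x (linAct g f) = eval (g.mulVec x) f := by
  rw [linAct, eval_aeval]
  congr 2
  ext i
  simp [Matrix.mulVec, dotProduct, Fin.sum_univ_two]

lemma linAct_genI (a b : ℕ) : linAct genI.1 (X 0 ^ a * X 1 ^ b) =
    (Complex.I ^ a * (-Complex.I) ^ b) • (X 0 ^ a * X 1 ^ b) := by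
  simp [linAct, genI, smul_eq_C_mul, mul_pow]
  ring

lemma linAct_genK (a b : ℕ) : linAct genK.1 (X 0 ^ a * X 1 ^ b) =
    (Complex.I ^ (a + b)) • (X 0 ^ b * X 1 ^ a) := by
  simp [linAct, genK, SU2.mk, smul_eq_C_mul, mul_pow]
  ring

lemma genI_mulVec (x : Fin 2 → ℂ) :
    genI.1.mulVec x = ![Complex.I * x 0, -Complex.I * x 1] := by
  ext i
  fin_cases i <;> simp [genI, Matrix.mulVec, dotProduct, Fin.sum_univ_two]

lemma genOmega_mulVec (x : Fin 2 → ℂ) : genOmega.1.mulVec x =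
    ![(1 + Complex.I) / 2 * (x 0 + Complex.I * x 1),
      (1 + Complex.I) / 2 * (x 0 - Complex.I * x 1)] := by
  ext i
  fin_cases i <;> simp [genOmega, Matrix.mulVec, dotProduct, Fin.sum_univ_two] 
  · linear_combination (-x 1 / 2) * Complex.I_sq
  · linear_combination (x 1 / 2) * Complex.I_sq

lemma one_add_I_div_two_sq : ((1 + Complex.I) / 2) ^ 2 = Complex.I / 2 := by
  linear_combination (1 / 4 : ℂ) * Complex.I_sq

lemma linAct_genOmega_formV : linAct genOmega.1 formV = zeta • formV := by
  refine MvPolynomial.funext fun x => ?_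
  have h := eval_formV_mulVec ⟨genOmega, genOmega_mem⟩ x
  rw [coe_tetraChar, coord_genOmega_zero] at h
  rw [eval_linAct, h, smul_eval]

lemma linAct_genOmega_formVbar : linAct genOmega.1 formVbar = (zeta ^ 2) • formVbar := by
  refine MvPolynomial.funext fun x => ?_
  have hz : zeta ^ 2 = (-1 + 3 * mu) / 2 := by
    have := zeta_sq_add
    have hz : zeta = -(1 + 3 * mu) / 2 := rfl
    linear_combination this - hz
  have hI := Complex.I_sq
  rw [eval_linAct, smul_eval, eval_formVbar, eval_formVbar, genOmega_mulVec, hz]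
  simp only [Matrix.cons_val]
  generalize hw : (1 + Complex.I) / 2 = w
  have hw2 : w ^ 2 = Complex.I / 2 := by rw [← hw, one_add_I_div_two_sq]
  have hw4 : w ^ 4 = -1 / 4 := by linear_combination (w ^ 2 + Complex.I / 2) * hw2 + hI / 4
  have h1 : (x 0 + Complex.I * x 1) ^ 4 + (x 0 - Complex.I * x 1) ^ 4 =
      2 * x 0 ^ 4 - 12 * x 0 ^ 2 * x 1 ^ 2 + 2 * x 1 ^ 4 := by
    linear_combination (12 * x 0 ^ 2 * x 1 ^ 2 + 2 * (Complex.I ^ 2 - 1) * x 1 ^ 4) * hI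
  have h2 : (x 0 + Complex.I * x 1) * (x 0 - Complex.I * x 1) = x 0 ^ 2 + x 1 ^ 2 := by
    linear_combination (-x 1 ^ 2) * hI
  have h3 : (w * (x 0 + Complex.I * x 1)) ^ 4 + (w * (x 0 - Complex.I * x 1)) ^ 4
      - 6 * mu * (w * (x 0 + Complex.I * x 1)) ^ 2 * (w * (x 0 - Complex.I * x 1)) ^ 2 =
      w ^ 4 * ((x 0 + Complex.I * x 1) ^ 4 + (x 0 - Complex.I * x 1) ^ 4
        - 6 * mu * ((x 0 + Complex.I * x 1) * (x 0 - Complex.I * x 1)) ^ 2) := by ring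
  rw [h3, hw4, h1, h2]
  linear_combination (3 * x 0 ^ 2 * x 1 ^ 2) * three_mul_mu_sq

lemma linAct_genOmega_formP : linAct genOmega.1 formP = formP := by
  refine MvPolynomial.funext fun x => ?_
  have hI := Complex.I_sq
  rw [eval_linAct, genOmega_mulVec]
  simp [formP]
  generalize hw : (1 + Complex.I) / 2 = w
  have hw2 : w ^ 2 = Complex.I / 2 := by rw [← hw, one_add_I_div_two_sq]
  have hw6 : w ^ 6 = -Complex.I / 8 := by
    linear_combination (w ^ 4 + w ^ 2 * Complex.I / 2 + Complex.I ^ 2 / 4) * hw2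
      + Complex.I * hI / 8
  have h1 : (x 0 + Complex.I * x 1) ^ 4 - (x 0 - Complex.I * x 1) ^ 4 =
      8 * Complex.I * (x 0 ^ 3 * x 1 - x 0 * x 1 ^ 3) := by
    linear_combination (8 * Complex.I * x 0 * x 1 ^ 3) * hI
  have h2 : (x 0 + Complex.I * x 1) * (x 0 - Complex.I * x 1) = x 0 ^ 2 + x 1 ^ 2 := by
    linear_combination (-x 1 ^ 2) * hI
  calc _ = w ^ 6 * ((x 0 + Complex.I * x 1) * (x 0 - Complex.I * x 1)) *
        ((x 0 + Complex.I * x 1) ^ 4 - (x 0 - Complex.I * x 1) ^ 4) := by ring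
    _ = _ := by
      rw [hw6, h1, h2]
      linear_combination (-(x 0 ^ 2 + x 1 ^ 2) * (x 0 ^ 3 * x 1 - x 0 * x 1 ^ 3)) * hI

lemma linAct_genI_formP : linAct genI.1 formP = formP := by
  have hI := Complex.I_sq
  have hI4 := Complex.I_pow_four
  refine MvPolynomial.funext fun x => ?_
  rw [eval_linAct, genI_mulVec]
  simp [formP, Even.neg_pow (show Even 4 by decide), mul_pow, hI4]
  linear_combination (-x 0 * x 1 * (x 0 ^ 4 - x 1 ^ 4)) * hI

lemma linAct_genI_formW : linAct genI.1 formW = formW := by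
  have hI4 := Complex.I_pow_four
  have hI8 : Complex.I ^ 8 = 1 := by rw [show 8 = 4 * 2 by rfl, pow_mul, hI4, one_pow]
  refine MvPolynomial.funext fun x => ?_
  rw [eval_linAct, genI_mulVec]
  simp [formW, Even.neg_pow (show Even 4 by decide), Even.neg_pow (show Even 8 by decide),
    mul_pow, hI4, hI8]

/-- `W` is the product of `V` and its conjugate form, on which `genOmega` acts by the inverse
scalars `zeta` and `zeta ^ 2`. -/
lemma linAct_genOmega_formW : linAct genOmega.1 formW = formW := by
  rw [← formV_mul_formVbar, map_mul, linAct_genOmega_formV, linAct_genOmega_formVbar,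
    smul_mul_smul_comm, ← pow_succ', zeta_pow_three, one_smul]

lemma eval_mulVec_of_linAct {f : MvPolynomial (Fin 2) ℂ} (hI : linAct genI.1 f = f)
    (hO : linAct genOmega.1 f = f) (g : tetra) (x : Fin 2 → ℂ) :
    eval (g.1.1.mulVec x) f = eval x f := by
  obtain ⟨g, hg⟩ := g
  change eval (g.1.mulVec x) f = eval x f
  induction hg using Subgroup.closure_induction generalizing x with
  | mem y hy =>
    rcases hy with rfl | rfl
    · rw [← eval_linAct, hI]
    · rw [← eval_linAct, hO]
  | one => simp
  | mul a b _ _ ha hb =>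
    change eval ((a.1 * b.1).mulVec x) f = _
    rw [← Matrix.mulVec_mulVec, ha, hb]
  | inv a _ ha =>
    have h := ha ((a⁻¹).1.mulVec x)
    have h1 : a.1 * (a⁻¹).1 = 1 := congrArg Subtype.val (mul_inv_cancel a)
    rw [Matrix.mulVec_mulVec, h1, Matrix.one_mulVec] at h
    exact h.symm

lemma eval_mulVec_of_mem_adjoin {f : MvPolynomial (Fin 2) ℂ}
    (hf : f ∈ Algebra.adjoin ℂ {formP, formW, formV ^ 3}) (g : tetra) (x : Fin 2 → ℂ) :
    eval (g.1.1.mulVec x) f = eval x f := by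
  induction hf using Algebra.adjoin_induction with
  | mem f hf =>
    rcases hf with rfl | rfl | rfl
    · exact eval_mulVec_of_linAct linAct_genI_formP linAct_genOmega_formP g x
    · exact eval_mulVec_of_linAct linAct_genI_formW linAct_genOmega_formW g x
    · rw [map_pow, eval_formV_mulVec, mul_pow, ← Units.val_pow_eq_pow_val, tetraChar_pow_three,
        Units.val_one, one_mul, map_pow]
  | algebraMap r => simp [algebraMap_eq]
  | add p q _ _ hp hq => rw [map_add, hp, hq, map_add]
  | mul p q _ _ hp hq => rw [map_mul, hp, hq, map_mul]

/-! ### Invariants of the quaternion group. -/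

/-- The algebra generated by `V`, its conjugate and `P`: the invariants of the quaternion group. -/
noncomputable def quatInvariants : Subalgebra ℂ (MvPolynomial (Fin 2) ℂ) :=
  (aeval ![formV, formVbar, formP] :
    MvPolynomial (Fin 3) ℂ →ₐ[ℂ] MvPolynomial (Fin 2) ℂ).range

lemma formV_mem : formV ∈ quatInvariants := ⟨X 0, by simp⟩

lemma formVbar_mem : formVbar ∈ quatInvariants := ⟨X 1, by simp⟩

lemma formP_mem : formP ∈ quatInvariants := ⟨X 2, by simp⟩

lemma sq_mul_sq_mem : (X 0 * X 1) ^ 2 ∈ quatInvariants := by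
  have h : ((X 0 * X 1) ^ 2 : MvPolynomial (Fin 2) ℂ) = (12 * mu)⁻¹ • (formV - formVbar) := by
    rw [formV, formVbar, smul_eq_C_mul, six_mul_mu]
    have h1 : C ((12 * mu)⁻¹) * C (6 * mu) * 2 = (1 : MvPolynomial (Fin 2) ℂ) := by
      rw [← map_ofNat C 2, ← map_mul, ← map_mul, ← map_one C]
      congr 1
      have := mu_ne_zero
      field_simp
      norm_num
    linear_combination (-(X 0 ^ 2 * X 1 ^ 2)) * h1
  rw [h]
  exact Subalgebra.smul_mem _ (sub_mem formV_mem formVbar_mem) _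

lemma pow_four_add_pow_four_mem : X 0 ^ 4 + X 1 ^ 4 ∈ quatInvariants := by
  have h : (X 0 ^ 4 + X 1 ^ 4 : MvPolynomial (Fin 2) ℂ) = (2 : ℂ)⁻¹ • (formV + formVbar) := by
    rw [formV, formVbar, smul_eq_C_mul]
    have h1 : C ((2 : ℂ)⁻¹) * 2 = (1 : MvPolynomial (Fin 2) ℂ) := by
      rw [← map_ofNat C 2, ← map_mul, ← map_one C]
      norm_num
    linear_combination (-(X 0 ^ 4 + X 1 ^ 4)) * h1
  rw [h]
  exact Subalgebra.smul_mem _ (add_mem formV_mem formVbar_mem) _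

/-- The recursion `p_{k+2} = (x + y) p_{k+1} - xy p_k` with `x = s⁴`, `y = t⁴`, satisfied by `x^k +
y^k` and by `x^k - y^k`; here `xy = (s²t²)²`. -/
lemma power_sum_mem (k : ℕ) : ((X 0 ^ 4) ^ k + (X 1 ^ 4) ^ k ∈ quatInvariants) ∧
    (X 0 * X 1 * ((X 0 ^ 4) ^ k - (X 1 ^ 4) ^ k) ∈ quatInvariants) := by
  induction k using Nat.twoStepInduction with
  | zero => exact ⟨⟨2, by simp [map_ofNat]; norm_num⟩, ⟨0, by simp⟩⟩
  | one => exact ⟨by simpa using pow_four_add_pow_four_mem, by simpa [formP] using formP_mem⟩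
  | more k h0 h1 =>
    constructor
    · have h : ((X 0 ^ 4) ^ (k + 2) + (X 1 ^ 4) ^ (k + 2) : MvPolynomial (Fin 2) ℂ) =
          (X 0 ^ 4 + X 1 ^ 4) * ((X 0 ^ 4) ^ (k + 1) + (X 1 ^ 4) ^ (k + 1)) -
            ((X 0 * X 1) ^ 2) ^ 2 * ((X 0 ^ 4) ^ k + (X 1 ^ 4) ^ k) := by ring
      rw [h]
      exact sub_mem (mul_mem pow_four_add_pow_four_mem h1.1)
        (mul_mem (pow_mem sq_mul_sq_mem 2) h0.1)
    · have h : (X 0 * X 1 * ((X 0 ^ 4) ^ (k + 2) - (X 1 ^ 4) ^ (k + 2)) :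
          MvPolynomial (Fin 2) ℂ) =
          (X 0 ^ 4 + X 1 ^ 4) * (X 0 * X 1 * ((X 0 ^ 4) ^ (k + 1) - (X 1 ^ 4) ^ (k + 1))) -
            ((X 0 * X 1) ^ 2) ^ 2 * (X 0 * X 1 * ((X 0 ^ 4) ^ k - (X 1 ^ 4) ^ k)) := by ring
      rw [h]
      exact sub_mem (mul_mem pow_four_add_pow_four_mem h1.2)
        (mul_mem (pow_mem sq_mul_sq_mem 2) h0.2)

lemma symmetrized_mem (r k : ℕ) : X 0 ^ (r + 4 * k) * X 1 ^ r +
    (-1) ^ r * (X 0 ^ r * X 1 ^ (r + 4 * k)) ∈ quatInvariants := by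
  obtain ⟨n, rfl | rfl⟩ := r.even_or_odd'
  · have h : (X 0 ^ (2 * n + 4 * k) * X 1 ^ (2 * n) + (-1) ^ (2 * n) * (X 0 ^ (2 * n) *
        X 1 ^ (2 * n + 4 * k)) : MvPolynomial (Fin 2) ℂ) =
        ((X 0 * X 1) ^ 2) ^ n * ((X 0 ^ 4) ^ k + (X 1 ^ 4) ^ k) := by
      rw [pow_mul (-1 : MvPolynomial (Fin 2) ℂ)]
      simp
      ring
    rw [h]
    exact mul_mem (pow_mem sq_mul_sq_mem n) (power_sum_mem k).1
  · have h : (X 0 ^ (2 * n + 1 + 4 * k) * X 1 ^ (2 * n + 1) + (-1) ^ (2 * n + 1) *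
        (X 0 ^ (2 * n + 1) * X 1 ^ (2 * n + 1 + 4 * k)) : MvPolynomial (Fin 2) ℂ) =
        ((X 0 * X 1) ^ 2) ^ n * (X 0 * X 1 * ((X 0 ^ 4) ^ k - (X 1 ^ 4) ^ k)) := by
      rw [pow_succ (-1 : MvPolynomial (Fin 2) ℂ), pow_mul (-1 : MvPolynomial (Fin 2) ℂ)]
      simp
      ring
    rw [h]
    exact mul_mem (pow_mem sq_mul_sq_mem n) (power_sum_mem k).2

/-! ### Averaging in three steps. -/

/-- Averaging over the group generated by `genI`. -/
noncomputable def averageI : MvPolynomial (Fin 2) ℂ →ₗ[ℂ] MvPolynomial (Fin 2) ℂ :=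
  let T := (linAct genI.1).toLinearMap
  (4 : ℂ)⁻¹ • (1 + T + T ^ 2 + T ^ 3)

/-- Averaging over `1` and `genK`. -/
noncomputable def averageK : MvPolynomial (Fin 2) ℂ →ₗ[ℂ] MvPolynomial (Fin 2) ℂ :=
  (2 : ℂ)⁻¹ • (1 + (linAct genK.1).toLinearMap)

/-- Averaging over `1`, `genOmega`, `genOmega ^ 2`. -/
noncomputable def averageOmega : MvPolynomial (Fin 2) ℂ →ₗ[ℂ] MvPolynomial (Fin 2) ℂ :=
  let T := (linAct genOmega.1).toLinearMap
  (3 : ℂ)⁻¹ • (1 + T + T ^ 2)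

lemma averageI_apply_of_eigen {f : MvPolynomial (Fin 2) ℂ} {c : ℂ} (h : linAct genI.1 f = c • f) :
    averageI f = ((1 + c + c ^ 2 + c ^ 3) / 4) • f := by
  simp only [averageI, LinearMap.smul_apply, LinearMap.add_apply, Module.End.one_apply, pow_succ,
    pow_zero, one_mul, Module.End.mul_apply, AlgHom.toLinearMap_apply, h, map_smul]
  module

lemma averageOmega_apply_of_eigen {f : MvPolynomial (Fin 2) ℂ} {c : ℂ}
    (h : linAct genOmega.1 f = c • f) : averageOmega f = ((1 + c + c ^ 2) / 3) • f := by
  simp only [averageOmega, LinearMap.smul_apply, LinearMap.add_apply, Module.End.one_apply,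
    pow_succ, pow_zero, one_mul, Module.End.mul_apply, AlgHom.toLinearMap_apply, h, map_smul]
  module

lemma averageK_mem {r k : ℕ} : averageK (X 0 ^ (r + 4 * k) * X 1 ^ r) ∈ quatInvariants ∧
    averageK (X 0 ^ r * X 1 ^ (r + 4 * k)) ∈ quatInvariants := by
  have hI : Complex.I ^ (r + 4 * k + r) = (-1) ^ r := by
    rw [show r + 4 * k + r = 2 * r + 4 * k by ring, pow_add, pow_mul, pow_mul, Complex.I_pow_four,
      Complex.I_sq, one_pow, mul_one]
  have hI' : Complex.I ^ (r + (r + 4 * k)) = (-1) ^ r := by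
    rw [← hI]; ring
  have h := symmetrized_mem r k
  constructor
  · convert Subalgebra.smul_mem _ h (2 : ℂ)⁻¹ using 1
    simp only [averageK, LinearMap.smul_apply, LinearMap.add_apply, Module.End.one_apply,
      AlgHom.toLinearMap_apply, linAct_genK, hI]
    simp [smul_eq_C_mul]
  · convert Subalgebra.smul_mem _ h ((2 : ℂ)⁻¹ * (-1) ^ r) using 1
    simp only [averageK, LinearMap.smul_apply, LinearMap.add_apply, Module.End.one_apply,
      AlgHom.toLinearMap_apply, linAct_genK, hI']
    have h1 : ((-1) ^ r * (-1) ^ r : MvPolynomial (Fin 2) ℂ) = 1 := by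
      rw [← mul_pow]; simp
    simp [smul_eq_C_mul]
    linear_combination (-C (2 : ℂ)⁻¹ * X 0 ^ r * X 1 ^ (r + 4 * k)) * h1

lemma map_mem_of_forall_monomial {M : Submodule ℂ (MvPolynomial (Fin 2) ℂ)}
    (T : MvPolynomial (Fin 2) ℂ →ₗ[ℂ] MvPolynomial (Fin 2) ℂ)
    (h : ∀ a b : ℕ, T (X 0 ^ a * X 1 ^ b) ∈ M) (f : MvPolynomial (Fin 2) ℂ) : T f ∈ M := by
  induction f using MvPolynomial.induction_on' with
  | monomial m c =>
    have hm : monomial m c = c • (X 0 ^ m 0 * X 1 ^ m 1 : MvPolynomial (Fin 2) ℂ) := by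
      rw [monomial_eq, Finsupp.prod_fintype _ _ (fun _ => pow_zero _), Fin.prod_univ_two,
        smul_eq_C_mul]
    rw [hm, map_smul]
    exact M.smul_mem _ (h _ _)
  | add p q hp hq => rw [map_add]; exact M.add_mem hp hq

lemma mod_four_eq_zero_or_sum_eq_zero {w : ℂ} (hw : w ^ 2 = -1) (n : ℕ) :
    n % 4 = 0 ∨ 1 + w ^ n + (w ^ n) ^ 2 + (w ^ n) ^ 3 = 0 := by
  have h4 : w ^ 4 = 1 := by linear_combination (w ^ 2 - 1) * hw
  have hn : w ^ n = w ^ (n % 4) := by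
    conv_lhs => rw [← Nat.div_add_mod n 4, pow_add, pow_mul, h4, one_pow, one_mul]
  rw [hn]
  have hlt : n % 4 < 4 := Nat.mod_lt _ (by norm_num)
  interval_cases n % 4
  · exact Or.inl rfl
  · right
    linear_combination (1 + w) * hw
  · right
    linear_combination (w ^ 4 + 1) * hw
  · right
    linear_combination (w ^ 7 - w ^ 5 + w ^ 4 + w ^ 3 - w ^ 2 + 1) * hw

/-- `genI` scales `s^a t^b` by `i^(a-b)`, so the first average keeps only monomials with `4 ∣ a -
b`. The second one symmetrizes these up to sign. -/
lemma averageK_averageI_mem (f : MvPolynomial (Fin 2) ℂ) :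
    averageK (averageI f) ∈ quatInvariants := by
  refine map_mem_of_forall_monomial (M := Subalgebra.toSubmodule quatInvariants)
    (averageK ∘ₗ averageI) (fun a b => ?_) f
  rw [Subalgebra.mem_toSubmodule, LinearMap.comp_apply,
    averageI_apply_of_eigen (linAct_genI a b), map_smul]
  have hII : Complex.I * -Complex.I = 1 := by simp
  rcases le_total a b with h | h
  · obtain ⟨n, rfl⟩ := Nat.exists_eq_add_of_le h
    rw [pow_add, ← mul_assoc, ← mul_pow, hII, one_pow, one_mul]
    rcases mod_four_eq_zero_or_sum_eq_zero (w := -Complex.I) (by simp) n with hn | hn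
    · rw [← Nat.div_add_mod n 4, hn, add_zero]
      exact Subalgebra.smul_mem _ averageK_mem.2 _
    · rw [hn, zero_div, zero_smul]
      exact zero_mem _
  · obtain ⟨n, rfl⟩ := Nat.exists_eq_add_of_le h
    have hc : Complex.I ^ (b + n) * (-Complex.I) ^ b = Complex.I ^ n := by
      rw [pow_add, mul_right_comm, ← mul_pow, hII, one_pow, one_mul]
    rw [hc]
    rcases mod_four_eq_zero_or_sum_eq_zero Complex.I_sq n with hn | hn
    · rw [← Nat.div_add_mod n 4, hn, add_zero]
      exact Subalgebra.smul_mem _ averageK_mem.1 _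
    · rw [hn, zero_div, zero_smul]
      exact zero_mem _

lemma mod_three_eq_zero_or_sum_eq_zero (n : ℕ) :
    n % 3 = 0 ∨ 1 + zeta ^ n + (zeta ^ n) ^ 2 = 0 := by
  have hn : zeta ^ n = zeta ^ (n % 3) := by
    conv_lhs => rw [← Nat.div_add_mod n 3, pow_add, pow_mul, zeta_pow_three, one_pow, one_mul]
  rw [hn]
  have hlt : n % 3 < 3 := Nat.mod_lt _ (by norm_num)
  interval_cases n % 3
  · exact Or.inl rfl
  · right
    linear_combination zeta_sq_add
  · right
    linear_combination (zeta ^ 2 - zeta + 1) * zeta_sq_add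

/-- This syzygy makes the cube of the conjugate form redundant as a generator. -/
lemma formVbar_pow_three : formVbar ^ 3 = formV ^ 3 - C (36 * mu) * formP ^ 2 := by
  have h : (C mu) ^ 2 * 3 = (-1 : MvPolynomial (Fin 2) ℂ) := by
    rw [← map_pow, ← map_ofNat C, ← map_mul, mul_comm, three_mul_mu_sq, map_neg, map_one]
  have h36 : C (36 * mu) = (36 * C mu : MvPolynomial (Fin 2) ℂ) := by rw [map_mul, map_ofNat]
  rw [formV, formVbar, formP, C_eq_six_mul_mu, h36]
  linear_combination (-144 * C mu * (X 0 ^ 2 * X 1 ^ 2) ^ 3) * h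

lemma averageOmega_mem {f : MvPolynomial (Fin 2) ℂ} (hf : f ∈ quatInvariants) :
    averageOmega f ∈ Algebra.adjoin ℂ {formP, formW, formV ^ 3} := by
  have hP : formP ∈ Algebra.adjoin ℂ {formP, formW, formV ^ 3} :=
    Algebra.subset_adjoin (by simp)
  have hW : formW ∈ Algebra.adjoin ℂ {formP, formW, formV ^ 3} :=
    Algebra.subset_adjoin (by simp)
  have hV : formV ^ 3 ∈ Algebra.adjoin ℂ {formP, formW, formV ^ 3} :=
    Algebra.subset_adjoin (by simp)
  have hVbar : formVbar ^ 3 ∈ Algebra.adjoin ℂ {formP, formW, formV ^ 3} := by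
    rw [formVbar_pow_three]
    exact sub_mem hV (mul_mem (Subalgebra.algebraMap_mem _ _) (pow_mem hP 2))
  obtain ⟨G, rfl⟩ := hf
  change averageOmega (aeval _ G) ∈ _
  induction G using MvPolynomial.induction_on' with
  | monomial m c =>
    obtain ⟨a, ha⟩ : ∃ a, a = m 0 := ⟨_, rfl⟩
    obtain ⟨b, hb⟩ : ∃ b, b = m 1 := ⟨_, rfl⟩
    obtain ⟨e, he⟩ : ∃ e, e = m 2 := ⟨_, rfl⟩
    have hm : aeval ![formV, formVbar, formP] (monomial m c) =
        c • (formV ^ a * formVbar ^ b * formP ^ e) := by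
      rw [aeval_monomial, Finsupp.prod_fintype _ _ (fun _ => pow_zero _), Fin.prod_univ_three,
        Algebra.smul_def, ha, hb, he]
      rfl
    have heig : linAct genOmega.1 (formV ^ a * formVbar ^ b * formP ^ e) =
        (zeta ^ (a + 2 * b)) • (formV ^ a * formVbar ^ b * formP ^ e) := by
      rw [map_mul, map_mul, map_pow, map_pow, map_pow, linAct_genOmega_formV,
        linAct_genOmega_formVbar, linAct_genOmega_formP, smul_pow, smul_pow, smul_mul_smul_comm,
        smul_mul_assoc, pow_add, pow_mul]
    rw [hm, map_smul, averageOmega_apply_of_eigen heig]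
    refine Subalgebra.smul_mem _ ?_ _
    rcases mod_three_eq_zero_or_sum_eq_zero (a + 2 * b) with h | h
    -- Here `a ≡ b` modulo 3. Pairing equal powers of `V` and its conjugate into powers of `W`
    -- leaves a power of one of the two cubes.
    · refine Subalgebra.smul_mem _ (mul_mem ?_ (pow_mem hP _)) _
      rcases le_total a b with hab | hab
      · obtain ⟨k, hk⟩ : ∃ k, b = a + 3 * k := ⟨(b - a) / 3, by omega⟩
        have : formV ^ a * formVbar ^ b = formW ^ a * (formVbar ^ 3) ^ k := by
          rw [hk, ← formV_mul_formVbar]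
          ring
        rw [this]
        exact mul_mem (pow_mem hW _) (pow_mem hVbar _)
      · obtain ⟨k, hk⟩ : ∃ k, a = b + 3 * k := ⟨(a - b) / 3, by omega⟩
        have : formV ^ a * formVbar ^ b = formW ^ b * (formV ^ 3) ^ k := by
          rw [hk, ← formV_mul_formVbar]
          ring
        rw [this]
        exact mul_mem (pow_mem hW _) (pow_mem hV _)
    · rw [h, zero_div, zero_smul]
      exact zero_mem _
  | add p q hp hq =>
    rw [map_add, map_add]
    exact add_mem hp hq

lemma invariant_iff_mem_adjoin (f : MvPolynomial (Fin 2) ℂ) :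
    (∀ (γ : tetra) (x : Fin 2 → ℂ), eval (γ.1.1.mulVec x) f = eval x f) ↔
      f ∈ Algebra.adjoin ℂ {formP, formW, formV ^ 3} := by
  refine ⟨fun h => ?_, eval_mulVec_of_mem_adjoin⟩
  have hinv {g : SU2} (hg : g ∈ tetra) : linAct g.1 f = f :=
    MvPolynomial.funext fun x => by rw [eval_linAct]; exact h ⟨g, hg⟩ x
  have hI : averageI f = f := by
    rw [averageI_apply_of_eigen (c := 1) (by rw [hinv genI_mem, one_smul])]
    norm_num
  have hK : averageK f = f := by
    simp only [averageK, LinearMap.smul_apply, LinearMap.add_apply, Module.End.one_apply,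
      AlgHom.toLinearMap_apply, hinv genK_mem]
    module
  have hO : averageOmega f = f := by
    rw [averageOmega_apply_of_eigen (c := 1) (by rw [hinv genOmega_mem, one_smul])]
    norm_num
  -- The composite of the three averages need not be analysed as a projection: it fixes every
  -- invariant and its image lies in the algebra.
  have := averageOmega_mem (averageK_averageI_mem f)
  rwa [hI, hK, hO] at this

/-! ### Polynomials on the sphere -/

lemma derivation_map_of_X {σ τ : Type*} (D : Derivation ℂ (MvPolynomial σ ℂ) (MvPolynomial σ ℂ))
    (E : Derivation ℂ (MvPolynomial τ ℂ) (MvPolynomial τ ℂ))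
    (φ : MvPolynomial σ ℂ →ₐ[ℂ] MvPolynomial τ ℂ) (h : ∀ i, E (φ (X i)) = φ (D (X i)))
    (F : MvPolynomial σ ℂ) : E (φ F) = φ (D F) := by
  induction F using MvPolynomial.induction_on with
  | C a => simp [← algebraMap_eq]
  | add p q hp hq => simp only [map_add, hp, hq]
  | mul_X p i hp => simp only [map_mul, Derivation.leibniz, smul_eq_mul, map_add, hp, h]

/-- The inclusion of the polynomials in `s`, `t` in those in `s`, `t`, `conj s`, `conj t`. -/
noncomputable def inclST : MvPolynomial (Fin 2) ℂ →ₐ[ℂ] MvPolynomial (Fin 4) ℂ :=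
  aeval (![X 0, X 1] : Fin 2 → MvPolynomial (Fin 4) ℂ)

lemma inclST_X : inclST (X 0) = X 0 ∧ inclST (X 1) = X 1 := by
  simp [inclST]

lemma inclST_C (a : ℂ) : inclST (C a) = C a := inclST.commutes a

/-- The polynomial `s * conj s + t * conj t`. -/
noncomputable def normForm : MvPolynomial (Fin 4) ℂ := X 0 * X 2 + X 1 * X 3

lemma JMinus_X : JMinus (X 0) = -X 3 ∧ JMinus (X 1) = X 2 ∧ JMinus (X 2) = 0 ∧
    JMinus (X 3) = 0 := by
  simp [JMinus]

lemma JMinus_normForm_mul (G : MvPolynomial (Fin 4) ℂ) :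
    JMinus (normForm * G) = normForm * JMinus G := by
  obtain ⟨x0, x1, x2, x3⟩ := JMinus_X
  have h : JMinus normForm = 0 := by
    simp only [normForm, map_add, Derivation.leibniz, x0, x1, x2, x3, smul_eq_mul]
    ring
  rw [Derivation.leibniz, h, smul_zero, add_zero, smul_eq_mul]

/-- In the term where `J_-` acts on `t`, the product `s s̄` is replaced by `normForm - t t̄`. For `e
= 0` the truncated exponent `e - 1` is harmless because its coefficient vanishes. -/
lemma JMinus_monomial_succ_left (a e c f : ℕ) :
    JMinus (X 0 ^ (a + 1) * X 1 ^ e * X 3 ^ c * X 2 ^ f) =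
      (-(a + e + 1 : ℂ)) • (X 0 ^ a * X 1 ^ e * X 3 ^ (c + 1) * X 2 ^ f) +
        (e : ℂ) • (normForm * (X 0 ^ a * X 1 ^ (e - 1) * X 3 ^ c * X 2 ^ f)) := by
  obtain ⟨x0, x1, x2, x3⟩ := JMinus_X
  simp only [Derivation.leibniz, Derivation.leibniz_pow, x0, x1, x2, x3, smul_eq_mul, normForm,
    nsmul_eq_mul, smul_eq_C_mul]
  cases e with
  | zero =>
    simp
    ring
  | succ e =>
    simp
    ring

lemma JMinus_monomial_succ_right (a e c f : ℕ) :
    JMinus (X 0 ^ a * X 1 ^ (e + 1) * X 3 ^ c * X 2 ^ f) =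
      (a + e + 1 : ℂ) • (X 0 ^ a * X 1 ^ e * X 3 ^ c * X 2 ^ (f + 1)) -
        (a : ℂ) • (normForm * (X 0 ^ (a - 1) * X 1 ^ e * X 3 ^ c * X 2 ^ f)) := by
  obtain ⟨x0, x1, x2, x3⟩ := JMinus_X
  simp only [Derivation.leibniz, Derivation.leibniz_pow, x0, x1, x2, x3, smul_eq_mul, normForm,
    nsmul_eq_mul, smul_eq_C_mul]
  cases a with
  | zero =>
    simp
    ring
  | succ a =>
    simp
    ring

/-- The polynomials in `s`, `t` generate all polynomials in `s`, `t`, `conj s`, `conj t` under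
the lowering operator and multiplication by `s * conj s + t * conj t`. -/
lemma eq_top_of_JMinus_mem (N : Submodule ℂ (MvPolynomial (Fin 4) ℂ))
    (h0 : ∀ f : MvPolynomial (Fin 2) ℂ, inclST f ∈ N)
    (hJ : ∀ G ∈ N, JMinus G ∈ N) (hn : ∀ G ∈ N, normForm * G ∈ N) : N = ⊤ := by
  -- Induction on the degree in `s̄, t̄`: modulo a multiple of `normForm` of lower such degree,
  -- `J_-` raises it by one, with coefficient `±(a + e + 1) ≠ 0`.
  have hmono : ∀ n a e c f : ℕ, c + f = n → X 0 ^ a * X 1 ^ e * X 3 ^ c * X 2 ^ f ∈ N := by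
    intro n
    induction n with
    | zero =>
      intro a e c f hcf
      obtain ⟨rfl, rfl⟩ : c = 0 ∧ f = 0 := by omega
      have h := h0 (X 0 ^ a * X 1 ^ e)
      rw [map_mul, map_pow, map_pow, inclST_X.1, inclST_X.2] at h
      rwa [pow_zero, pow_zero, mul_one, mul_one]
    | succ n ih =>
      intro a e c f hcf
      have hne : (a + e + 1 : ℂ) ≠ 0 := by exact_mod_cast Nat.succ_ne_zero (a + e)
      cases c with
      | succ c =>
        have h1 := hJ _ (ih (a + 1) e c f (by omega))
        have h2 := N.smul_mem (e : ℂ) (hn _ (ih a (e - 1) c f (by omega)))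
        rw [JMinus_monomial_succ_left] at h1
        have h3 := N.sub_mem h1 h2
        rw [add_sub_cancel_right] at h3
        exact (N.smul_mem_iff (neg_ne_zero.2 hne)).1 h3
      | zero =>
        obtain ⟨f, rfl⟩ : ∃ k, f = k + 1 := ⟨n, by omega⟩
        have h1 := hJ _ (ih a (e + 1) 0 f (by omega))
        have h2 := N.smul_mem (a : ℂ) (hn _ (ih (a - 1) e 0 f (by omega)))
        rw [JMinus_monomial_succ_right] at h1
        have h3 := N.add_mem h1 h2
        rw [sub_add_cancel] at h3
        exact (N.smul_mem_iff hne).1 h3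
  rw [eq_top_iff]
  intro G _
  induction G using MvPolynomial.induction_on' with
  | monomial m c =>
    have hm : monomial m c =
        c • (X 0 ^ m 0 * X 1 ^ m 1 * X 3 ^ m 3 * X 2 ^ m 2 : MvPolynomial (Fin 4) ℂ) := by
      rw [monomial_eq, Finsupp.prod_fintype _ _ (fun _ => pow_zero _), Fin.prod_univ_four,
        smul_eq_C_mul]
      ring
    rw [hm]
    exact N.smul_mem _ (hmono _ _ _ _ _ rfl)
  | add p q hp hq => exact N.add_mem (hp trivial) (hq trivial)

/-! ### The algebra of forms of degrees divisible by three in the coordinates -/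

/-- The ideal of the sphere. -/
noncomputable def sphereIdeal : Ideal (MvPolynomial (Fin 4) ℂ) := Ideal.span {normForm - 1}

lemma mk_normForm : Ideal.Quotient.mk sphereIdeal normForm = 1 := by
  rw [← map_one (Ideal.Quotient.mk sphereIdeal), Ideal.Quotient.eq]
  exact Ideal.subset_span rfl

lemma three_mul_C_mu_sq {σ : Type*} : 3 * (C mu) ^ 2 = (-1 : MvPolynomial σ ℂ) := by
  rw [← map_pow, ← map_ofNat C, ← map_mul, three_mul_mu_sq, map_neg, map_one]

lemma normForm_eq :
    (X 0 * X 2 - X 1 * -X 3 : MvPolynomial (Fin 4) ℂ) = normForm := by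
  rw [normForm]
  ring

lemma inclST_formV : inclST formV = genericCoeff 0 := by
  simp only [formV, C_eq_six_mul_mu]
  simp [genericCoeff, binaryCoeff, map_ofNat inclST, inclST_X, inclST_C]

lemma aeval_cubicInvariant :
    aeval genericCoeff cubicInvariant = C (4 / 3 * mu) * normForm ^ 6 := by
  have h := cubic_invariant_binaryCoeff (X 0) (X 1) (-X 3) (X 2)
    (three_mul_C_mu_sq (σ := Fin 4))
  rw [normForm_eq] at h
  have h1 : C (4 / 3 * mu) * 3 = (4 * C mu : MvPolynomial (Fin 4) ℂ) := by
    rw [← map_ofNat C 3, ← map_ofNat C 4, ← map_mul, ← map_mul]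
    congr 1
    ring
  have h3 : (3 : MvPolynomial (Fin 4) ℂ) ≠ 0 := by norm_num
  apply mul_left_cancel₀ h3
  rw [← mul_assoc, mul_comm 3 (C _), h1, ← h]
  simp [cubicInvariant, genericCoeff, map_ofNat]

lemma aeval_cubicCovariant :
    aeval genericCoeff cubicCovariant = 4 * normForm ^ 3 * inclST formP := by
  have h := cubic_covariant_binaryCoeff (X 0) (X 1) (-X 3) (X 2)
    (three_mul_C_mu_sq (σ := Fin 4))
  rw [normForm_eq] at h
  simp [cubicCovariant, genericCoeff, map_ofNat, formP, inclST_X]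
  exact h

lemma aeval_hessCovariant : aeval genericCoeff hessCovariant =
    C mu * normForm ^ 2 * inclST formVbar := by
  have h := hessian_binaryCoeff_zero (X 0) (X 1) (-X 3) (X 2)
    (three_mul_C_mu_sq (σ := Fin 4))
  rw [normForm_eq] at h
  have h1 : inclST formVbar = binaryCoeff (-C mu) (X 0) (X 1) (-X 3) (X 2) 0 := by
    simp only [formVbar, C_eq_six_mul_mu]
    simp [binaryCoeff, map_ofNat inclST, inclST_X, inclST_C]
    ring
  rw [h1, ← h]
  simp [hessCovariant, genericCoeff]

lemma isHomogeneous_LMinus {n : ℕ} {F : MvPolynomial (Fin 5) ℂ} (hF : F.IsHomogeneous n) :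
    (LMinus F).IsHomogeneous n := by
  have hL : LMinus = (C 4 * X 1 : MvPolynomial (Fin 5) ℂ) • pderiv 0 +
      (C 3 * X 2 : MvPolynomial (Fin 5) ℂ) • pderiv 1 +
      (C 2 * X 3 : MvPolynomial (Fin 5) ℂ) • pderiv 2 + (X 4 : MvPolynomial (Fin 5) ℂ) • pderiv 3 := by
    refine derivation_ext fun i => ?_
    fin_cases i <;> simp [LMinus, pderiv_X, map_ofNat C]
  -- A partial derivative lowers the degree by one, truncated at zero, so constants are treated
  -- separately.
  cases n with
  | zero =>
    have h0 : F = C (coeff 0 F) := by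
      rw [← totalDegree_eq_zero_iff_eq_C]
      exact Nat.le_zero.1 hF.totalDegree_le
    rw [h0, derivation_C]
    exact isHomogeneous_zero _ _ _
  | succ n =>
    have h (i j : Fin 5) (c : ℂ) : (C c * X j * pderiv i F).IsHomogeneous (n + 1) := by
      have := (isHomogeneous_C_mul_X c j).mul (hF.pderiv (i := i))
      rwa [Nat.add_sub_cancel, add_comm] at this
    have h3 := h 3 4 1
    rw [map_one, one_mul] at h3
    rw [hL]
    exact (((h 0 1 4).add (h 1 2 3)).add (h 2 3 2)).add h3

/-- The cubic invariant, normalized to take the value one on the sphere. -/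
noncomputable def unitCubic : MvPolynomial (Fin 5) ℂ := (4 / 3 * mu)⁻¹ • cubicInvariant

lemma isHomogeneous_unitCubic : unitCubic.IsHomogeneous 3 :=
  (homogeneousSubmodule (Fin 5) ℂ 3).smul_mem _ (mem_highestWeight_iff.1 cubicInvariant_mem).1

lemma mk_aeval_unitCubic : Ideal.Quotient.mk sphereIdeal (aeval genericCoeff unitCubic) = 1 := by
  have h : (4 / 3 * mu)⁻¹ * (4 / 3 * mu) = 1 :=
    inv_mul_cancel₀ (mul_ne_zero (by norm_num) mu_ne_zero)
  rw [unitCubic, map_smul, aeval_cubicInvariant, smul_eq_C_mul, ← mul_assoc, ← C_mul, h, C_1,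
    one_mul, map_pow, mk_normForm, one_pow]

/-- The polynomials that agree on the sphere with a form of degree divisible by three in the
coordinates. -/
noncomputable def tripleForms : Subalgebra ℂ (MvPolynomial (Fin 4) ℂ) where
  carrier := {G | ∃ (n : ℕ) (F : MvPolynomial (Fin 5) ℂ), F.IsHomogeneous (3 * n) ∧
    Ideal.Quotient.mk sphereIdeal G = Ideal.Quotient.mk sphereIdeal (aeval genericCoeff F)}
  mul_mem' := by
    rintro G₁ G₂ ⟨n₁, F₁, h₁, e₁⟩ ⟨n₂, F₂, h₂, e₂⟩
    refine ⟨n₁ + n₂, F₁ * F₂, ?_, by simp only [map_mul, e₁, e₂]⟩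
    rw [mul_add]
    exact h₁.mul h₂
  add_mem' := by
    rintro G₁ G₂ ⟨n₁, F₁, h₁, e₁⟩ ⟨n₂, F₂, h₂, e₂⟩
    -- The cubic equal to one on the sphere brings both summands to the common degree `3(n₁ + n₂)`.
    refine ⟨n₁ + n₂, F₁ * unitCubic ^ n₂ + F₂ * unitCubic ^ n₁, ?_, ?_⟩
    · have h1 := h₁.mul (isHomogeneous_unitCubic.pow n₂)
      have h2 := h₂.mul (isHomogeneous_unitCubic.pow n₁)
      rw [← mul_add] at h1 h2
      rw [add_comm n₂ n₁] at h2
      exact h1.add h2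
    · simp only [map_add, map_mul, map_pow, mk_aeval_unitCubic, e₁, e₂, one_pow, mul_one]
  algebraMap_mem' r := ⟨0, C r, isHomogeneous_C _ _, by rw [aeval_C]⟩

/-- `J_-` kills `normForm`, hence preserves the ideal of the sphere, and on forms in the coordinates
it is `L_-`, which preserves the degree. -/
lemma JMinus_mem_tripleForms {G : MvPolynomial (Fin 4) ℂ} (hG : G ∈ tripleForms) :
    JMinus G ∈ tripleForms := by
  obtain ⟨n, F, hF, e⟩ := hG
  refine ⟨n, LMinus F, isHomogeneous_LMinus hF, ?_⟩
  rw [Ideal.Quotient.eq, sphereIdeal, Ideal.mem_span_singleton] at e ⊢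
  obtain ⟨H, hH⟩ := e
  refine ⟨JMinus H, ?_⟩
  have h1 := derivation_map_of_X LMinus JMinus (aeval genericCoeff)
    (fun i => by rw [aeval_X, JMinus_genericCoeff]) F
  rw [← h1, ← map_sub, hH, sub_mul, map_sub, JMinus_normForm_mul, one_mul, sub_mul, one_mul]

lemma normForm_mul_mem_tripleForms {G : MvPolynomial (Fin 4) ℂ} (hG : G ∈ tripleForms) :
    normForm * G ∈ tripleForms := by
  obtain ⟨n, F, hF, e⟩ := hG
  exact ⟨n, F, hF, by rw [map_mul, mk_normForm, one_mul, e]⟩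

lemma inclST_mem_tripleForms {f : MvPolynomial (Fin 2) ℂ}
    (hf : f ∈ Algebra.adjoin ℂ {formP, formW, formV ^ 3}) :
    inclST f ∈ tripleForms := by
  have hle : Algebra.adjoin ℂ {formP, formW, formV ^ 3} ≤ tripleForms.comap (inclST) := by
    rw [Algebra.adjoin_le_iff]
    rintro _ (rfl | rfl | rfl)
    · refine ⟨1, C (4⁻¹) * cubicCovariant,
        (mem_highestWeight_iff.1 cubicCovariant_mem).1.C_mul _, ?_⟩
      have h : C (4⁻¹) * 4 = (1 : MvPolynomial (Fin 4) ℂ) := by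
        rw [← map_ofNat C 4, ← map_mul, inv_mul_cancel₀ (by norm_num), map_one]
      change Ideal.Quotient.mk sphereIdeal (inclST formP) = _
      rw [map_mul, aeval_C, algebraMap_eq, aeval_cubicCovariant, ← mul_assoc, ← mul_assoc, h,
        one_mul, map_mul, map_pow, mk_normForm, one_pow, one_mul]
    · refine ⟨1, C mu⁻¹ * (hessCovariant * X 0),
        (mem_highestWeight_iff.1 hessCovariant_mul_mem).1.C_mul _, ?_⟩
      have h : C mu⁻¹ * C mu = (1 : MvPolynomial (Fin 4) ℂ) := by
        rw [← map_mul, inv_mul_cancel₀ mu_ne_zero, map_one]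
      change Ideal.Quotient.mk sphereIdeal (inclST formW) = _
      rw [map_mul, aeval_C, algebraMap_eq, map_mul (aeval _), aeval_hessCovariant, aeval_X, ← inclST_formV,
        ← mul_assoc, ← mul_assoc, ← mul_assoc, h, one_mul, ← formV_mul_formVbar]
      simp only [map_mul, map_pow, mk_normForm]
      ring
    · refine ⟨1, X 0 ^ 3, isHomogeneous_X_pow 0 3, ?_⟩
      change Ideal.Quotient.mk sphereIdeal (inclST (formV ^ 3)) = _
      rw [map_pow, inclST_formV, map_pow (aeval _), aeval_X]
  exact hle hf

/-! ### Averaging over the tetrahedral group -/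

/-- The action of matrices on polynomials on the sphere. -/
noncomputable def sphereAct (g : Matrix (Fin 2) (Fin 2) ℂ) :
    MvPolynomial (Fin 4) ℂ →ₐ[ℂ] MvPolynomial (Fin 4) ℂ :=
  aeval ![C (g 0 0) * X 0 + C (g 0 1) * X 1, C (g 1 0) * X 0 + C (g 1 1) * X 1,
    C (g 1 1) * X 2 - C (g 1 0) * X 3, C (g 0 0) * X 3 - C (g 0 1) * X 2]

lemma sphereAct_X (g : Matrix (Fin 2) (Fin 2) ℂ) :
    sphereAct g (X 0) = C (g 0 0) * X 0 + C (g 0 1) * X 1 ∧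
    sphereAct g (X 1) = C (g 1 0) * X 0 + C (g 1 1) * X 1 ∧
    sphereAct g (X 2) = C (g 1 1) * X 2 - C (g 1 0) * X 3 ∧
    sphereAct g (X 3) = C (g 0 0) * X 3 - C (g 0 1) * X 2 := by
  simp [sphereAct]

/-- Left translations commute with the infinitesimal right action. -/
lemma JMinus_sphereAct (g : Matrix (Fin 2) (Fin 2) ℂ) (G : MvPolynomial (Fin 4) ℂ) :
    JMinus (sphereAct g G) = sphereAct g (JMinus G) := by
  obtain ⟨x0, x1, x2, x3⟩ := JMinus_X
  obtain ⟨a0, a1, a2, a3⟩ := sphereAct_X g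
  have hC (c : ℂ) (f : MvPolynomial (Fin 4) ℂ) : JMinus (C c * f) = C c * JMinus f := by
    rw [← smul_eq_C_mul, JMinus.map_smul, smul_eq_C_mul]
  refine derivation_map_of_X JMinus JMinus (sphereAct g) (fun i => ?_) G
  fin_cases i
  · change JMinus (sphereAct g (X 0)) = sphereAct g (JMinus (X 0))
    rw [a0, x0, map_neg, a3, map_add, hC, hC, x0, x1]
    ring
  · change JMinus (sphereAct g (X 1)) = sphereAct g (JMinus (X 1))
    rw [a1, x1, a2, map_add, hC, hC, x0, x1]
    ring
  · change JMinus (sphereAct g (X 2)) = sphereAct g (JMinus (X 2))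
    rw [a2, x2, map_zero, map_sub, hC, hC, x2, x3, mul_zero, mul_zero, sub_zero]
  · change JMinus (sphereAct g (X 3)) = sphereAct g (JMinus (X 3))
    rw [a3, x3, map_zero, map_sub, hC, hC, x2, x3, mul_zero, mul_zero, sub_zero]

lemma sphereAct_normForm (g : SU2) : sphereAct g.1 normForm = normForm := by
  have h := congrArg (C : ℂ → MvPolynomial (Fin 4) ℂ) g.det_eq
  simp only [map_sub, map_mul, map_one] at h
  simp [sphereAct, normForm]
  linear_combination (X 0 * X 2 + X 1 * X 3) * h

lemma sphereAct_inclST (g : Matrix (Fin 2) (Fin 2) ℂ) (f : MvPolynomial (Fin 2) ℂ) :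
    sphereAct g (inclST f) = inclST (linAct g f) := by
  obtain ⟨a0, a1, -, -⟩ := sphereAct_X g
  obtain ⟨i0, i1⟩ := inclST_X
  have key (i : Fin 2) : sphereAct g (inclST (X i)) = inclST (linAct g (X i)) := by
    rw [linAct, aeval_X, map_add, map_mul, map_mul, inclST_C, inclST_C, i0, i1]
    fin_cases i
    · exact i0 ▸ a0
    · exact i1 ▸ a1
  have h : (sphereAct g).comp inclST = inclST.comp (linAct g) := algHom_ext key
  exact DFunLike.congr_fun h f

/-- The values `s`, `t`, `conj s`, `conj t` at a point of the sphere. -/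
noncomputable def spherePoint (p : SU2) : Fin 4 → ℂ :=
  ![p.1 0 0, p.1 1 0, conj (p.1 0 0), conj (p.1 1 0)]

lemma eval_sphereAct (g p : SU2) (G : MvPolynomial (Fin 4) ℂ) :
    eval (spherePoint p) (sphereAct g.1 G) = eval (spherePoint (g * p)) G := by
  rw [sphereAct, eval_aeval]
  congr 2
  ext i
  fin_cases i <;> simp [spherePoint, Matrix.mul_apply, Fin.sum_univ_two, SU2.apply_zero_one,
    SU2.apply_one_one] <;> ring

lemma eval_spherePoint_aeval (p : SU2) (F : MvPolynomial (Fin 5) ℂ) :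
    eval (spherePoint p) (aeval genericCoeff F) = eval (coord p) F := by
  rw [eval_aeval, ← multiplet_eq]
  rfl

lemma eval_spherePoint_eq {G H : MvPolynomial (Fin 4) ℂ}
    (h : Ideal.Quotient.mk sphereIdeal G = Ideal.Quotient.mk sphereIdeal H) (p : SU2) :
    eval (spherePoint p) G = eval (spherePoint p) H := by
  rw [Ideal.Quotient.eq, sphereIdeal, Ideal.mem_span_singleton] at h
  obtain ⟨K, hK⟩ := h
  have h1 : eval (spherePoint p) normForm = 1 := by
    simpa [normForm, spherePoint] using p.normSq_eq
  rw [← sub_eq_zero, ← map_sub, hK, map_mul, map_sub, h1, map_one, sub_self, zero_mul]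

noncomputable instance fintype_tetra : Fintype tetra := Fintype.ofFinite tetra

lemma card_tetra_ne_zero : (Fintype.card tetra : ℂ) ≠ 0 := by
  exact_mod_cast Fintype.card_ne_zero

/-- Averaging over the tetrahedral group. -/
noncomputable def sphereAverage : MvPolynomial (Fin 4) ℂ →ₗ[ℂ] MvPolynomial (Fin 4) ℂ :=
  (Fintype.card tetra : ℂ)⁻¹ • ∑ g : tetra, (sphereAct g.1.1).toLinearMap

lemma sphereAverage_apply (G : MvPolynomial (Fin 4) ℂ) :
    sphereAverage G = (Fintype.card tetra : ℂ)⁻¹ • ∑ g : tetra, sphereAct g.1.1 G := by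
  simp [sphereAverage]

lemma sphereAverage_inclST_mem (f : MvPolynomial (Fin 2) ℂ) :
    sphereAverage (inclST f) ∈ tripleForms := by
  have h : sphereAverage (inclST f) = inclST
      ((Fintype.card tetra : ℂ)⁻¹ • ∑ g : tetra, linAct g.1.1 f) := by
    rw [sphereAverage_apply, map_smul, map_sum]
    simp only [sphereAct_inclST]
  rw [h]
  refine inclST_mem_tripleForms ((invariant_iff_mem_adjoin _).1 fun γ x => ?_)
  simp only [smul_eval, map_sum, eval_linAct, Matrix.mulVec_mulVec]
  congr 1
  -- Evaluation at `γ x` replaces `g` by `g γ`, which permutes the summands.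
  exact Fintype.sum_equiv (Equiv.mulRight γ) _ _ fun g => rfl

lemma sphereAverage_mem (G : MvPolynomial (Fin 4) ℂ) : sphereAverage G ∈ tripleForms := by
  have h : (Subalgebra.toSubmodule tripleForms).comap sphereAverage = ⊤ := by
    refine eq_top_of_JMinus_mem _ sphereAverage_inclST_mem (fun G hG => ?_) fun G hG => ?_
    · have := JMinus_mem_tripleForms (show sphereAverage G ∈ tripleForms from hG)
      rw [sphereAverage_apply, JMinus.map_smul, map_sum] at this
      simp only [JMinus_sphereAct] at this
      rwa [← sphereAverage_apply] at this
    · have := normForm_mul_mem_tripleForms (show sphereAverage G ∈ tripleForms from hG)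
      rw [sphereAverage_apply, mul_smul_comm, Finset.mul_sum] at this
      change sphereAverage (normForm * G) ∈ tripleForms
      rw [sphereAverage_apply]
      simpa only [map_mul, sphereAct_normForm] using this
  exact (h ▸ Submodule.mem_top : G ∈ (Subalgebra.toSubmodule tripleForms).comap sphereAverage)

lemma isPolynomialFunction_iff (f : Quot3 → ℂ) : IsPolynomialFunction f ↔
    ∃ (n : ℕ) (F : MvPolynomial (Fin 5) ℂ), F.IsHomogeneous (3 * n) ∧
      ∀ p, f (proj p) = eval (coord p) F := by
  constructor
  · rintro ⟨G, hG⟩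
    obtain ⟨n, F, hF, e⟩ := sphereAverage_mem G
    refine ⟨n, F, hF, fun p => ?_⟩
    -- The pull-back of `f` is constant on `Γ`-orbits, so averaging `G` does not change its values
    -- on the sphere.
    rw [← eval_spherePoint_aeval, ← eval_spherePoint_eq e, sphereAverage_apply, smul_eval, map_sum]
    have h (g : tetra) : eval (spherePoint p) (sphereAct g.1.1 G) = f (proj p) := by
      rw [eval_sphereAct, ← (proj_eq_proj_iff (g.1 * p) p).2 ⟨g, rfl⟩, hG (g.1 * p)]
      rfl
    simp only [h, Finset.sum_const, Finset.card_univ, nsmul_eq_mul]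
    rw [inv_mul_cancel_left₀ card_tetra_ne_zero]
  · rintro ⟨n, F, -, h⟩
    exact ⟨aeval genericCoeff F, fun p => by rw [h p, ← eval_spherePoint_aeval]; rfl⟩

lemma eval_coord_mul_of_isHomogeneous {n : ℕ} {F : MvPolynomial (Fin 5) ℂ}
    (hF : F.IsHomogeneous (3 * n)) (γ : tetra) (p : SU2) :
    eval (coord (γ.1 * p)) F = eval (coord p) F := by
  rw [coord_mul_of_mem γ.2, eval_smul_of_isHomogeneous hF, pow_mul,
    coord_apply_zero_pow_three γ.2, one_pow, one_mul]

end TetrahedralQuotient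

open TetrahedralQuotient MvPolynomial ComplexConjugate in
theorem mainTheorem3 :
    -- `V`, hence its whole multiplet, is multiplied by a nontrivial cube-root-of-unity character
    (∃ χ : tetra →* ℂˣ, χ ≠ 1 ∧ (∀ γ, χ γ ^ 3 = 1) ∧
      (∀ (γ : tetra) (x : Fin 2 → ℂ),
        eval (γ.1.1.mulVec x) formV = (χ γ : ℂ) * eval x formV) ∧
      (∀ (γ : tetra) (p : SU2), coord (γ.1 * p) = (χ γ : ℂ) • coord p)) ∧
    -- the five functions are a spin 2 multiplet of the right action
    ((∀ l, JZ (multiplet l) = aeval multiplet (LZ (X l))) ∧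
      (∀ l, JPlus (multiplet l) = aeval multiplet (LPlus (X l))) ∧
      (∀ l, JMinus (multiplet l) = aeval multiplet (LMinus (X l))) ∧
      LinearIndependent ℂ (fun (l : Fin 5) (p : SU2) => coord p l) ∧
      (∀ g : SU2, ∃ A : Matrix (Fin 5) (Fin 5) ℂ, ∀ p, coord (p * g) = A.mulVec (coord p))) ∧
    -- they embed the quotient in projective space: topological embedding and immersion
    ((∀ p, coord p ≠ 0) ∧
      (∃ φ : Quot3 → Projectivization ℂ (Fin 5 → ℂ),
        (∀ p (h : coord p ≠ 0), φ (proj p) = Projectivization.mk ℂ (coord p) h) ∧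
        Topology.IsEmbedding φ) ∧
      (∀ s t a b : ℂ, s * conj s + t * conj t = 1 → (conj s * a + conj t * b).re = 0 →
        (∃ c : ℂ, fderiv ℝ coordAt (s, t) (a, b) = c • coordAt (s, t)) → a = 0 ∧ b = 0)) ∧
    -- quadratic combinations: spins 4, 2, 0; the spin 0 one is the only relation,
    -- the spin 2 one gives the reality conditions
    ((∀ j : ℕ, Module.finrank ℂ (highestWeight 2 j) =
        if j ∈ ({0, 2, 4} : Finset ℕ) then 1 else 0) ∧
      (∀ F : MvPolynomial (Fin 5) ℂ, F.IsHomogeneous 2 →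
        ((∀ p, eval (coord p) F = 0) ↔ F ∈ highestWeight 2 0)) ∧
      (∀ F ∈ highestWeight 2 2, F ≠ 0 →
        (∃ c : ℂ, c ≠ 0 ∧ ∀ p, eval (coord p) F = c * eval (st p) formVbar) ∧
        (∃ c : ℂ, c ≠ 0 ∧ ∀ p, ∀ l : Fin 5, conj (coord p l) =
          c * (-1) ^ (l : ℕ) * eval (coord p) (descendant LMinus 4 (4 - l) F)))) ∧
    -- cubic combinations: spins 0, 2, 3, 4, 6; normalisation by the spin 0 one
    ((∀ j : ℕ, Module.finrank ℂ (highestWeight 3 j) =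
        if j ∈ ({0, 2, 3, 4, 6} : Finset ℕ) then 1 else 0) ∧
      (∀ K ∈ highestWeight 3 0, K ≠ 0 → ∃ c : ℂ, c ≠ 0 ∧ (∀ p, eval (coord p) K = c) ∧
        ∀ p, ∀ z : Fin 5 → ℂ, (∃ a : ℂ, a ≠ 0 ∧ z = a • coord p) →
          (eval z K = c ↔ ∃ ζ : ℂ, ζ ^ 3 = 1 ∧ z = ζ • coord p)) ∧
      (∀ F, F ∈ highestWeight 3 2 ↔ ∃ Q ∈ highestWeight 2 0, F = Q * X 0) ∧
      (∀ F ∈ highestWeight 3 3, F ≠ 0 →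
        ∃ c : ℂ, c ≠ 0 ∧ ∀ p, eval (coord p) F = c * eval (st p) formP) ∧
      (∀ F ∈ highestWeight 3 4, F ≠ 0 →
        ∃ c : ℂ, c ≠ 0 ∧ ∀ p, eval (coord p) F = c * eval (st p) formW) ∧
      (∀ F ∈ highestWeight 3 6, F ≠ 0 →
        ∃ c : ℂ, c ≠ 0 ∧ ∀ p, eval (coord p) F = c * eval (st p) (formV ^ 3))) ∧
    -- the forms of degrees 6, 8, 12 just obtained are fundamental invariants
    (∀ f : MvPolynomial (Fin 2) ℂ,
      (∀ (γ : tetra) (x : Fin 2 → ℂ), eval (γ.1.1.mulVec x) f = eval x f) ↔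
        f ∈ Algebra.adjoin ℂ {formP, formW, formV ^ 3}) ∧
    -- the functions on the quotient are the polynomials of degree `3 n` in the coordinates
    ((∀ (n : ℕ) (F : MvPolynomial (Fin 5) ℂ), F.IsHomogeneous (3 * n) →
        ∀ (γ : tetra) (p : SU2), eval (coord (γ.1 * p)) F = eval (coord p) F) ∧
      (∀ f : Quot3 → ℂ, IsPolynomialFunction f ↔
        ∃ (n : ℕ) (F : MvPolynomial (Fin 5) ℂ), F.IsHomogeneous (3 * n) ∧
          ∀ p, f (proj p) = eval (coord p) F)) := by
  refine ⟨⟨tetraChar, tetraChar_ne_one, tetraChar_pow_three, eval_formV_mulVec,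
      fun γ p => coord_mul_of_mem γ.2 p⟩,
    ⟨fun l => multiplet_eq ▸ JZ_genericCoeff l, fun l => multiplet_eq ▸ JPlus_genericCoeff l,
      fun l => multiplet_eq ▸ JMinus_genericCoeff l, linearIndependent_coord,
      fun g => ⟨_, fun p => coord_mul p g⟩⟩,
    ⟨coord_ne_zero, exists_isEmbedding, immersion⟩,
    ⟨finrank_highestWeight_two, fun F hF => vanishing_quadric_iff hF, fun F hF h0 =>
      ⟨exists_eval_coord_eq mu_ne_zero eval_coord_hessCovariant (highestWeight_two_two ▸ hF) h0,
        exists_conj_coord_eq hF h0⟩⟩,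
    ⟨finrank_highestWeight_three, fun K hK h0 => normalisation hK h0,
      mem_highestWeight_three_two_iff, fun F hF h0 => ?_, fun F hF h0 => ?_, fun F hF h0 => ?_⟩,
    invariant_iff_mem_adjoin,
    ⟨fun n F hF γ p => eval_coord_mul_of_isHomogeneous hF γ p, isPolynomialFunction_iff⟩⟩
  · exact exists_eval_coord_eq (e := 4) (by norm_num) eval_coord_cubicCovariant
      (highestWeight_three_three ▸ hF) h0
  · exact exists_eval_coord_eq mu_ne_zero eval_coord_hessCovariant_mul
      (highestWeight_three_four ▸ hF) h0
  · exact exists_eval_coord_eq one_ne_zero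
      (fun p => by rw [eval_coord_X_zero_cube, one_mul]) (highestWeight_three_six ▸ hF) h0
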